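/- Let $M$ be a compact connected smooth $4$-manifold without boundary, $g$ a smooth Riemannian metric on $M$, $p>2$, and $B,K$ real constants. There is a constant $C'$, depending only on $(M,g)$, $p$, $B$ and $K$, such that the following holds. Let $J$ be a smooth almost complex structure and $\omega$ an almost-Kähler form for $J$ (that is, a smooth closed $2$-form with $\omega(J\cdot,J\cdot)=\omega$ and $\omega(v,Jv)>0$ for $v\ne0$) with $g(\cdot,\cdot)=\omega(\cdot,J\cdot)$. Let $\omega'$ be another almost-Kähler form for the same $J$, solving the Calabi–Yau equation $$\omega'^2=e^F\omega^2$$ for a smooth function $F$ with $\sup_M|F|\le K$. Let $\phi_1$ be a smooth function with $$\omega'^2-\omega\wedge\omega'=-\tfrac12\,\omega'\wedge d(J\,d\phi_1),$$ where $(J\alpha)(v)=\alpha(Jv)$ for a $1$-form $\alpha$, and let $a_1$ be a smooth $1$-form with $$\omega'=\omega-\tfrac12\,d(J\,d\phi_1)+da_1 .$$ Suppose that $$\left(\int_M\left|\frac{da_1\wedge\omega}{\omega^2}\right|^p\omega^2\right)^{1/p}\le B,$$ where $M$ is oriented by $\omega^2$. Then $$\sup_M\phi_1-\inf_M\phi_1\le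 C'.$$ -/

import Mathlib

open scoped Manifold ContDiff

/-! Differential forms, almost complex structures and almost-Kähler forms on smooth
four-manifolds without boundary, modelled on `EuclideanSpace ℝ (Fin 4)`. -/

noncomputable section

namespace AlmostKahler

/-- The model space `ℝ⁴`. -/
abbrev R4 : Type := EuclideanSpace ℝ (Fin 4)

/-- The standard frame of `ℝ⁴`. -/
def stdFrame (i : Fin 4) : R4 := EuclideanSpace.single i (1 : ℝ)

section Linear

variable {V : Type*} [AddCommGroup V] [Module ℝ V] [TopologicalSpace V]

/-- The wedge product of two alternating 2-forms on a vector space (sum over shuffles, without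
normalizing factor, so that `dx¹ ∧ dx² ∧ dx³ ∧ dx⁴` is `1` on the standard frame). -/
def wedge (α β : V [⋀^Fin 2]→L[ℝ] ℝ) : V [⋀^Fin 4]→ₗ[ℝ] ℝ :=
  ((LinearMap.mul' ℝ ℝ).compAlternatingMap
    (α.toAlternatingMap.domCoprod β.toAlternatingMap)).domDomCongr
      (finSumFinEquiv : Fin 2 ⊕ Fin 2 ≃ Fin 4)

/-- The explicit formula for the wedge product of two 2-forms. -/
theorem wedge_apply (α β : V [⋀^Fin 2]→L[ℝ] ℝ) (v : Fin 4 → V) :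
    wedge α β v = α ![v 0, v 1] * β ![v 2, v 3] - α ![v 0, v 2] * β ![v 1, v 3]
      + α ![v 0, v 3] * β ![v 1, v 2] + α ![v 1, v 2] * β ![v 0, v 3]
      - α ![v 1, v 3] * β ![v 0, v 2] + α ![v 2, v 3] * β ![v 0, v 1] := by
  refine mul_left_cancel₀ (show (4 : ℝ) ≠ 0 by norm_num) ?_
  have h := MultilinearMap.domCoprod_alternization_eq α.toAlternatingMap β.toAlternatingMap
  have h2 := congrArg (fun t => (LinearMap.mul' ℝ ℝ) (t (v ∘ (finSumFinEquiv : Fin 2 ⊕ Fin 2 ≃ Fin 4)))) h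
  simp only [Fintype.card_fin, Nat.factorial] at h2
  have e : wedge α β v = (LinearMap.mul' ℝ ℝ) ((α.toAlternatingMap.domCoprod β.toAlternatingMap) (v ∘ (finSumFinEquiv : Fin 2 ⊕ Fin 2 ≃ Fin 4))) := rfl
  rw [e]
  have h3 : 4 * (LinearMap.mul' ℝ ℝ) ((α.toAlternatingMap.domCoprod β.toAlternatingMap) (v ∘ (finSumFinEquiv : Fin 2 ⊕ Fin 2 ≃ Fin 4))) =  (LinearMap.mul' ℝ ℝ) ((MultilinearMap.alternatization ((α.toAlternatingMap : MultilinearMap ℝ (fun _ : Fin 2 => V) ℝ).domCoprod (β.toAlternatingMap : MultilinearMap ℝ (fun _ : Fin 2 => V) ℝ))) (v ∘ (finSumFinEquiv : Fin 2 ⊕ Fin 2 ≃ Fin 4))) := by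
    rw [h2, AlternatingMap.smul_apply, map_nsmul]; norm_num
  rw [h3, MultilinearMap.alternatization_apply, map_sum]
  rw [← (Equiv.permCongr (finSumFinEquiv : Fin 2 ⊕ Fin 2 ≃ Fin 4)).symm.sum_comp]
  have fa : ∀ i j, α ![v j, v i] = - α ![v i, v j] := fun i j => by
    have := α.toAlternatingMap.map_swap ![v i, v j] (show (0 : Fin 2) ≠ 1 by decide)
    rw [show (![v i, v j] ∘ Equiv.swap (0 : Fin 2) 1) = ![v j, v i] by ext k; fin_cases k <;> rfl] at this
    exact this
  have fb : ∀ i j, β ![v j, v i] = - β ![v i, v j] := fun i j => by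
    have := β.toAlternatingMap.map_swap ![v i, v j] (show (0 : Fin 2) ≠ 1 by decide)
    rw [show (![v i, v j] ∘ Equiv.swap (0 : Fin 2) 1) = ![v j, v i] by ext k; fin_cases k <;> rfl] at this
    exact this
  have key : ∀ s : Equiv.Perm (Fin 4), (LinearMap.mul' ℝ ℝ) ((Equiv.Perm.sign ((Equiv.permCongr (finSumFinEquiv : Fin 2 ⊕ Fin 2 ≃ Fin 4)).symm s)) • (MultilinearMap.domDomCongr ((Equiv.permCongr (finSumFinEquiv : Fin 2 ⊕ Fin 2 ≃ Fin 4)).symm s) ((α.toAlternatingMap : MultilinearMap ℝ (fun _ : Fin 2 => V) ℝ).domCoprod (β.toAlternatingMap : MultilinearMap ℝ (fun _ : Fin 2 => V) ℝ))) (v ∘ (finSumFinEquiv : Fin 2 ⊕ Fin 2 ≃ Fin 4))) = ((Equiv.Perm.sign s : ℤ) : ℝ) * (α ![v (s 0), v (s 1)] * β ![v (s 2), v (s 3)]) := by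
    intro s
    have : Equiv.Perm.sign ((Equiv.permCongr (finSumFinEquiv : Fin 2 ⊕ Fin 2 ≃ Fin 4)).symm s) = Equiv.Perm.sign s := by
      simp [Equiv.permCongr_symm]
    rw [this]
    rcases Int.units_eq_one_or (Equiv.Perm.sign s) with h | h <;> rw [h] <;> simp <;>
    · congr 2 <;> (funext k; fin_cases k <;> rfl)
  rw [Finset.sum_congr rfl (fun s _ => key s)]
  have key2 : ∀ f : Fin 4 → Fin 4 → Fin 4 → Fin 4 → ℝ, (∑ s : Equiv.Perm (Fin 4), ((Equiv.Perm.sign s : ℤ) : ℝ) * f (s 0) (s (Fin.succ 0)) (s (Fin.succ (Fin.succ 0))) (s (Fin.succ (Fin.succ (Fin.succ 0))))) =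
     f 0 1 2 3 - f 0 1 3 2 - f 0 2 1 3 + f 0 2 3 1 + f 0 3 1 2 - f 0 3 2 1
     - f 1 0 2 3 + f 1 0 3 2 + f 1 2 0 3 - f 1 2 3 0 - f 1 3 0 2 + f 1 3 2 0
     + f 2 0 1 3 - f 2 0 3 1 - f 2 1 0 3 + f 2 1 3 0 + f 2 3 0 1 - f 2 3 1 0
     - f 3 0 1 2 + f 3 0 2 1 + f 3 1 0 2 - f 3 1 2 0 - f 3 2 0 1 + f 3 2 1 0 := by
    intro f
    rw [← (Equiv.Perm.decomposeFin (n := 3)).symm.sum_comp, Fintype.sum_prod_type]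
    simp only [← (Equiv.Perm.decomposeFin (n := 2)).symm.sum_comp, Fintype.sum_prod_type, ← (Equiv.Perm.decomposeFin (n := 1)).symm.sum_comp, Fin.sum_univ_succ, Fin.sum_univ_zero, Fintype.sum_subsingleton _ (1 : Equiv.Perm (Fin 1)), Equiv.Perm.decomposeFin.symm_sign, Equiv.Perm.decomposeFin_symm_apply_zero, Equiv.Perm.decomposeFin_symm_apply_succ]
    simp [Equiv.swap_apply_def, Fin.ext_iff]
    ring
  have key3 := key2 (fun a b c e => α ![v a, v b] * β ![v c, v e])
  refine key3.trans ?_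
  rw [fa 0 1, fa 0 2, fa 0 3, fa 1 2, fa 1 3, fa 2 3, fb 0 1, fb 0 2, fb 0 3, fb 1 2, fb 1 3, fb 2 3]
  ring

end Linear

section Manifold

variable (M : Type*) [TopologicalSpace M] [ChartedSpace R4 M]

/-- Differential `k`-forms on `M` (with no regularity required; see `IsSmoothForm`). -/
abbrev Form (k : ℕ) : Type _ := ∀ x : M, (TangentSpace (𝓡 4) x) [⋀^Fin k]→L[ℝ] ℝ

/-- Forms of top degree on `M`. -/
abbrev TopForm : Type _ := ∀ x : M, (TangentSpace (𝓡 4) x) [⋀^Fin 4]→ₗ[ℝ] ℝ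

/-- Fields of endomorphisms of the tangent spaces of `M`. -/
abbrev EndField : Type _ :=
  ∀ x : M, TangentSpace (𝓡 4) x →L[ℝ] TangentSpace (𝓡 4) x

variable {M}

/-- The differential at `y ∈ ℝ⁴` of the inverse of the chart of `M` centred at `x₀`; it maps the
standard frame to the coordinate frame `∂/∂x¹, …, ∂/∂x⁴`. -/
def paramDeriv (x₀ : M) (y : R4) :
    R4 →L[ℝ] TangentSpace (𝓡 4) ((extChartAt (𝓡 4) x₀).symm y) :=
  mfderiv 𝓘(ℝ, R4) (𝓡 4) (extChartAt (𝓡 4) x₀).symm y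

/-- The differential at `x` of the chart of `M` centred at `x₀`. -/
def chartDeriv (x₀ x : M) : TangentSpace (𝓡 4) x →L[ℝ] R4 :=
  mfderiv (𝓡 4) 𝓘(ℝ, R4) (extChartAt (𝓡 4) x₀) x

/-- The expression of a form in the chart centred at `x₀`, i.e. its pullback by the inverse
chart. It is meaningful on the target of the chart. -/
def Form.inChart {k : ℕ} (α : Form M k) (x₀ : M) (y : R4) : R4 [⋀^Fin k]→L[ℝ] ℝ :=
  (α ((extChartAt (𝓡 4) x₀).symm y)).compContinuousLinearMap (paramDeriv x₀ y)

/-- A form is smooth if its expressions in the charts are smooth. -/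
def IsSmoothForm {k : ℕ} (α : Form M k) : Prop :=
  ∀ x₀ : M, ContDiffOn ℝ ∞ (α.inChart x₀) (extChartAt (𝓡 4) x₀).target

/-- The exterior derivative: at `x` it is the exterior derivative of the expression of the form
in the chart centred at `x`. -/
def d {k : ℕ} (α : Form M k) : Form M (k + 1) := fun x =>
  (extDeriv (α.inChart x) (extChartAt (𝓡 4) x x)).compContinuousLinearMap (chartDeriv x x)

/-- The wedge product of two 2-forms on `M`. -/
def wedgeForm (α β : Form M 2) : TopForm M := fun x => wedge (α x) (β x)

/-- An almost complex structure: a smooth field of endomorphisms `J` with `J² = -1`. -/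
structure IsAlmostComplex (J : EndField M) : Prop where
  smooth : ∀ x₀ : M, ContDiffOn ℝ ∞
    (fun y : R4 => (chartDeriv x₀ ((extChartAt (𝓡 4) x₀).symm y)).comp
      ((J ((extChartAt (𝓡 4) x₀).symm y)).comp (paramDeriv x₀ y)))
    (extChartAt (𝓡 4) x₀).target
  sq_eq_neg : ∀ (x : M) (v : TangentSpace (𝓡 4) x), J x (J x v) = -v

/-- `Ω` is an almost-Kähler form for `J`: a smooth closed 2-form compatible with `J`, i.e. such
that `Ω(·, J·)` is a Riemannian metric. -/
structure IsAlmostKahlerForm (J : EndField M) (Ω : Form M 2) : Prop where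
  smooth : IsSmoothForm Ω
  closed : d Ω = 0
  compatible : ∀ (x : M) (v w : TangentSpace (𝓡 4) x), Ω x ![J x v, J x w] = Ω x ![v, w]
  pos : ∀ (x : M) (v : TangentSpace (𝓡 4) x), v ≠ 0 → 0 < Ω x ![v, J x v]

/-- The 1-form `J dφ`, where `(J α)(v) = α (J v)`. -/
def Jd (J : EndField M) (φ : M → ℝ) : Form M 1 := fun x =>
  ContinuousAlternatingMap.ofSubsingleton ℝ (TangentSpace (𝓡 4) x) ℝ (0 : Fin 1)
    ((mfderiv (𝓡 4) 𝓘(ℝ, ℝ) φ x : TangentSpace (𝓡 4) x →L[ℝ] ℝ).comp (J x))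

/-- The quotient `α / β` of two top-degree forms, where `β` is nowhere zero: the function `f` with
`α = f β`. It does not depend on the basis of the tangent space at `x`, for which we take
the standard frame of `TangentSpace (𝓡 4) x = ℝ⁴`. -/
def ratio (α β : TopForm M) (x : M) : ℝ := α x stdFrame / β x stdFrame

/-- The measure `|f| dx¹ dx² dx³ dx⁴` on the domain of the chart centred at `x₀`, extended by
zero to `M`, where `α = f dx¹ ∧ dx² ∧ dx³ ∧ dx⁴` in this chart. -/
def chartMeasure [MeasurableSpace M] (α : TopForm M) (x₀ : M) : MeasureTheory.Measure M :=
  ((MeasureTheory.volume.restrict (extChartAt (𝓡 4) x₀).target).withDensity (fun y =>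
    ENNReal.ofReal |α ((extChartAt (𝓡 4) x₀).symm y) (fun i => paramDeriv x₀ y (stdFrame i))|)).map
      (extChartAt (𝓡 4) x₀).symm

/-- The measure defined by a top-degree form `α`: integration of functions against `α`, where `M`
is oriented by `α` (if `α` is nowhere zero). The measures `chartMeasure α x₀` agree on the overlaps
of the charts by the change of variables formula, so their supremum in the lattice of measures is
the measure on `M` which restricts to `chartMeasure α x₀` on the domain of each chart. -/
def formMeasure [MeasurableSpace M] (α : TopForm M) : MeasureTheory.Measure M :=
  ⨆ x₀ : M, chartMeasure α x₀

end Manifold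

end AlmostKahler

end

open AlmostKahler

/-! Wedging `Ω' = Ω - ½ d(J dφ₁) + da₁` with `Ω` and adding the equation that defines the potential
eliminates `Ω ∧ Ω'` and leaves d(J dφ₁) ∧ (Ω + Ω') = 2(Ω² - Ω'²) + 2 da₁ ∧ Ω. Divided by Ω², this is
a scalar equation for φ₁ whose right-hand side h = -4(e^F - 1) + 4 (da₁ ∧ Ω)/Ω² is bounded in Lᵖ
with p > 2, half the dimension (`ratio_potential`).

Since Ω + Ω' is closed, Stokes' theorem applied to d(G(φ₁) J dφ₁) ∧ (Ω + Ω') gives ∫ G'(φ₁) q = ∫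
G(φ₁) h, where q = -2 dφ₁ ∧ J dφ₁ ∧ (Ω + Ω')/Ω² (`weakSolution_potential`). The unknown form Ω'
contributes a nonnegative term to q, so q dominates |dφ₁|² for the fixed metric
(`LinearAlmostKahler.sq_le`). Ellipticity from below is all that is used; no upper bound on Ω' is
needed.

The rest is the classical L^∞ estimate. The Poincaré inequality and the test function t - c bound φ₁
- c in L². The Sobolev inequality W^{1,2} ⊂ L⁴ for the square of (φ₁ - k)⁺, with test function its
cube, gives a superlinear decay inequality for the measures of superlevel sets exactly because p > 2
(`superlevel_estimate`), and Stampacchia's lemma makes them vanish beyond a controlled level.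
Applying this to φ₁ - c and to c - φ₁ bounds the oscillation (`exists_oscillation_le`).

Uniformity in (J, Ω): the pair enters only through the metric and the volume measure, and the metric
determines the measure (`formMeasure_eq`). All constants therefore come from one reference pair
compatible with g. -/

namespace AlmostKahler

/-! ### Coordinate changes and naturality of the exterior derivative -/

section Charts

variable {M : Type*} [TopologicalSpace M] [ChartedSpace R4 M]

/-- The change of coordinates from the chart centred at `x₁` to the chart centred at `x₀`. -/
noncomputable def coordChange (x₀ x₁ : M) (y : R4) : R4 :=
  extChartAt (𝓡 4) x₀ ((extChartAt (𝓡 4) x₁).symm y)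

theorem IsSmoothForm.contDiffAt {k : ℕ} {α : Form M k} (h : IsSmoothForm α) {x₀ : M} {y : R4}
    (hy : y ∈ (extChartAt (𝓡 4) x₀).target) : ContDiffAt ℝ ∞ (α.inChart x₀) y :=
  (h x₀).contDiffAt ((isOpen_extChartAt_target x₀).mem_nhds hy)

variable [IsManifold (𝓡 4) ∞ M]

theorem contDiffAt_coordChange {x₀ x₁ : M} {y : R4} (hy : y ∈ (extChartAt (𝓡 4) x₁).target)
    (hy' : (extChartAt (𝓡 4) x₁).symm y ∈ (extChartAt (𝓡 4) x₀).source) :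
    ContDiffAt ℝ ∞ (coordChange x₀ x₁) y := by
  have h := contDiffWithinAt_ext_coord_change (I := 𝓡 4) (n := ∞) x₀ x₁ (y := y)
    (by simp only [PartialEquiv.trans_source, PartialEquiv.symm_source, Set.mem_inter_iff,
          Set.mem_preimage]
        exact ⟨hy, hy'⟩)
  rw [ModelWithCorners.range_eq_univ, contDiffWithinAt_univ] at h
  exact h

theorem chartDeriv_comp_paramDeriv {x₀ : M} {y : R4} (hy : y ∈ (extChartAt (𝓡 4) x₀).target) :
    (chartDeriv x₀ ((extChartAt (𝓡 4) x₀).symm y)).comp (paramDeriv x₀ y) =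
      ContinuousLinearMap.id ℝ R4 := by
  have h := mfderiv_extChartAt_comp_mfderivWithin_extChartAt_symm (I := 𝓡 4) hy
  rw [ModelWithCorners.range_eq_univ, mfderivWithin_univ] at h
  exact h

theorem paramDeriv_comp_chartDeriv {x₀ : M} {y : R4} (hy : y ∈ (extChartAt (𝓡 4) x₀).target) :
    (paramDeriv x₀ y).comp (chartDeriv x₀ ((extChartAt (𝓡 4) x₀).symm y)) =
      ContinuousLinearMap.id ℝ (TangentSpace (𝓡 4) ((extChartAt (𝓡 4) x₀).symm y)) := by
  have h := mfderivWithin_extChartAt_symm_comp_mfderiv_extChartAt (I := 𝓡 4) hy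
  rw [ModelWithCorners.range_eq_univ, mfderivWithin_univ] at h
  exact h

theorem mdifferentiableAt_extChartAt_symm' {x₀ : M} {y : R4}
    (hy : y ∈ (extChartAt (𝓡 4) x₀).target) :
    MDifferentiableAt 𝓘(ℝ, R4) (𝓡 4) (extChartAt (𝓡 4) x₀).symm y :=
  ((contMDiffOn_extChartAt_symm (n := ∞) x₀).contMDiffAt
    ((isOpen_extChartAt_target x₀).mem_nhds hy)).mdifferentiableAt (by simp)

theorem mdifferentiableAt_extChartAt_of_mem {x₀ p : M} (hp : p ∈ (extChartAt (𝓡 4) x₀).source) :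
    MDifferentiableAt (𝓡 4) 𝓘(ℝ, R4) (extChartAt (𝓡 4) x₀) p :=
  (contMDiffAt_extChartAt' (n := ∞) (by simpa using hp)).mdifferentiableAt (by simp)

theorem fderiv_coordChange {x₀ x₁ : M} {y : R4} (hy : y ∈ (extChartAt (𝓡 4) x₁).target)
    (hy' : (extChartAt (𝓡 4) x₁).symm y ∈ (extChartAt (𝓡 4) x₀).source) :
    fderiv ℝ (coordChange x₀ x₁) y =
      (chartDeriv x₀ ((extChartAt (𝓡 4) x₁).symm y)).comp (paramDeriv x₁ y) := by
  rw [← mfderiv_eq_fderiv]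
  exact mfderiv_comp y (mdifferentiableAt_extChartAt_of_mem hy')
    (mdifferentiableAt_extChartAt_symm' hy)

/-- Chain rule for the inverse charts. Both sides are read in `R4` because they live in tangent
spaces at points that are equal only propositionally. -/
theorem paramDeriv_apply_eq {x₀ x₁ : M} {y : R4} (hy : y ∈ (extChartAt (𝓡 4) x₁).target)
    (hy' : (extChartAt (𝓡 4) x₁).symm y ∈ (extChartAt (𝓡 4) x₀).source) (v : R4) :
    (paramDeriv x₁ y v : R4) =
      (paramDeriv x₀ (coordChange x₀ x₁ y) (fderiv ℝ (coordChange x₀ x₁) y v) : R4) := by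
  have hz : coordChange x₀ x₁ y ∈ (extChartAt (𝓡 4) x₀).target :=
    (extChartAt (𝓡 4) x₀).map_source hy'
  have hs : (extChartAt (𝓡 4) x₀).symm (coordChange x₀ x₁ y) = (extChartAt (𝓡 4) x₁).symm y :=
    (extChartAt (𝓡 4) x₀).left_inv hy'
  have h := paramDeriv_comp_chartDeriv hz
  rw [fderiv_coordChange hy hy']
  have key : ∀ p q : M, p = q →
      ∀ w : R4, (chartDeriv x₀ p : R4 →L[ℝ] R4) w = (chartDeriv x₀ q : R4 →L[ℝ] R4) w := by
    rintro p q rfl w; rfl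
  have h2 := congrArg (fun A : R4 →L[ℝ] R4 => A (paramDeriv x₁ y v)) h
  refine h2.symm.trans ?_
  exact congrArg (paramDeriv x₀ (coordChange x₀ x₁ y)) (key _ _ hs _)

theorem inChart_coordChange {k : ℕ} (α : Form M k) {x₀ x₁ : M} {y : R4}
    (hy : y ∈ (extChartAt (𝓡 4) x₁).target)
    (hy' : (extChartAt (𝓡 4) x₁).symm y ∈ (extChartAt (𝓡 4) x₀).source) :
    α.inChart x₁ y = (α.inChart x₀ (coordChange x₀ x₁ y)).compContinuousLinearMap
      (fderiv ℝ (coordChange x₀ x₁) y) := by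
  have hs : (extChartAt (𝓡 4) x₀).symm (coordChange x₀ x₁ y) = (extChartAt (𝓡 4) x₁).symm y :=
    (extChartAt (𝓡 4) x₀).left_inv hy'
  have key : ∀ p q : M, p = q → ∀ w : Fin k → R4,
      (α p : R4 [⋀^Fin k]→L[ℝ] ℝ) w = (α q : R4 [⋀^Fin k]→L[ℝ] ℝ) w := by
    rintro p q rfl w; rfl
  ext v
  refine (key _ _ hs.symm _).trans ?_
  refine congrArg (α ((extChartAt (𝓡 4) x₀).symm (coordChange x₀ x₁ y)) :
    R4 [⋀^Fin k]→L[ℝ] ℝ) ?_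
  funext i
  exact paramDeriv_apply_eq hy hy' (v i)

theorem eventually_mem_chart {x₀ x₁ : M} {y : R4} (hy : y ∈ (extChartAt (𝓡 4) x₁).target)
    (hy' : (extChartAt (𝓡 4) x₁).symm y ∈ (extChartAt (𝓡 4) x₀).source) :
    ∀ᶠ z in nhds y, z ∈ (extChartAt (𝓡 4) x₁).target ∧
      (extChartAt (𝓡 4) x₁).symm z ∈ (extChartAt (𝓡 4) x₀).source :=
  Filter.inter_mem ((isOpen_extChartAt_target x₁).mem_nhds hy)
    ((mdifferentiableAt_extChartAt_symm' hy).continuousAt.preimage_mem_nhds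
      ((isOpen_extChartAt_source x₀).mem_nhds hy'))

/-- The expression of `dα` in any chart is the exterior derivative of the expression of `α`. -/
theorem inChart_d {k : ℕ} {α : Form M k} (h : IsSmoothForm α) {x₀ : M} {y : R4}
    (hy : y ∈ (extChartAt (𝓡 4) x₀).target) :
    (d α).inChart x₀ y = extDeriv (α.inChart x₀) y := by
  -- At `p`, `d` is computed in the chart centred at `p`, so the chart at `x₀` is compared with that
  -- one, and the exterior derivative commutes with pullback by the coordinate change.
  set p := (extChartAt (𝓡 4) x₀).symm y with hp
  have hy' : (extChartAt (𝓡 4) x₀).symm y ∈ (extChartAt (𝓡 4) p).source :=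
    mem_extChartAt_source p
  have hev : α.inChart x₀ =ᶠ[nhds y] fun z => (α.inChart p (coordChange p x₀ z)).compContinuousLinearMap
      (fderiv ℝ (coordChange p x₀) z) := by
    filter_upwards [eventually_mem_chart hy hy'] with z hz
    exact inChart_coordChange α hz.1 hz.2
  rw [hev.extDeriv_eq, extDeriv_pullback (r := ∞) _ (contDiffAt_coordChange hy hy')
    (by simpa using ENat.LEInfty.out),
    fderiv_coordChange hy hy']
  · rfl
  · exact (h.contDiffAt ((extChartAt (𝓡 4) p).map_source hy')).differentiableAt (by simp)

end Charts

end AlmostKahler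

namespace AlmostKahler

section LinearAlgebra

/-! ### Top-degree forms and wedge products on `ℝ⁴` -/

theorem topForm_comp (t : R4 [⋀^Fin 4]→ₗ[ℝ] ℝ) (A : R4 →ₗ[ℝ] R4) (v : Fin 4 → R4) :
    t (fun i => A (v i)) = LinearMap.det A * t v := by
  set e := (EuclideanSpace.basisFun (Fin 4) ℝ).toBasis
  rw [t.eq_smul_basis_det e]
  simp only [AlternatingMap.smul_apply, smul_eq_mul]
  have := Module.Basis.det_comp e A v
  rw [show (fun i => A (v i)) = A ∘ v from rfl, this]
  ring

theorem topForm_apply (t : R4 [⋀^Fin 4]→ₗ[ℝ] ℝ) (v : Fin 4 → R4) :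
    t v = (EuclideanSpace.basisFun (Fin 4) ℝ).toBasis.det v * t stdFrame := by
  set e := (EuclideanSpace.basisFun (Fin 4) ℝ).toBasis with he
  have h2 : (stdFrame : Fin 4 → R4) = e := by
    funext i
    simp [he, stdFrame]
  conv_lhs => rw [t.eq_smul_basis_det e]
  rw [h2, AlternatingMap.smul_apply, smul_eq_mul]
  ring

/-- A quotient of top-degree forms can be computed on any frame. -/
theorem topForm_div (s t : R4 [⋀^Fin 4]→ₗ[ℝ] ℝ) {v : Fin 4 → R4} (h : t v ≠ 0) :
    s stdFrame / t stdFrame = s v / t v := by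
  rw [topForm_apply s v, topForm_apply t v] at *
  rw [mul_div_mul_left _ _ (left_ne_zero_of_mul h)]

theorem topForm_ne_zero (t : R4 [⋀^Fin 4]→ₗ[ℝ] ℝ) {v : Fin 4 → R4} (h : t v ≠ 0) :
    t stdFrame ≠ 0 := by
  rw [topForm_apply t v] at h
  exact right_ne_zero_of_mul h

variable {V : Type*} [AddCommGroup V] [Module ℝ V] [TopologicalSpace V]

theorem wedge_comm (α β : V [⋀^Fin 2]→L[ℝ] ℝ) : wedge α β = wedge β α := by
  ext v
  simp only [wedge_apply]
  ring

theorem wedge_add_left (α α' β : V [⋀^Fin 2]→L[ℝ] ℝ) :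
    wedge (α + α') β = wedge α β + wedge α' β := by
  ext v
  simp only [wedge_apply, AlternatingMap.add_apply, ContinuousAlternatingMap.add_apply]
  ring

theorem wedge_sub_left (α α' β : V [⋀^Fin 2]→L[ℝ] ℝ) :
    wedge (α - α') β = wedge α β - wedge α' β := by
  ext v
  simp only [wedge_apply, AlternatingMap.sub_apply, ContinuousAlternatingMap.sub_apply]
  ring

theorem wedge_smul_left (c : ℝ) (α β : V [⋀^Fin 2]→L[ℝ] ℝ) :
    wedge (c • α) β = c • wedge α β := by
  ext v
  simp only [wedge_apply, AlternatingMap.smul_apply, ContinuousAlternatingMap.smul_apply,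
    smul_eq_mul]
  ring

theorem wedge_add_right (α β β' : V [⋀^Fin 2]→L[ℝ] ℝ) :
    wedge α (β + β') = wedge α β + wedge α β' := by
  rw [wedge_comm, wedge_add_left, wedge_comm β, wedge_comm β']

theorem wedge_comp (α β : R4 [⋀^Fin 2]→L[ℝ] ℝ) (A : R4 →L[ℝ] R4) (v : Fin 4 → R4) :
    wedge (α.compContinuousLinearMap A) (β.compContinuousLinearMap A) v =
      wedge α β (fun i => A (v i)) := by
  have h : ∀ x y : R4, A ∘ ![x, y] = ![A x, A y] := fun x y => by
    funext i; fin_cases i <;> rfl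
  simp only [wedge_apply, ContinuousAlternatingMap.compContinuousLinearMap_apply, h]

theorem alt2_swap (α : V [⋀^Fin 2]→L[ℝ] ℝ) (x y : V) : α ![y, x] = -α ![x, y] := by
  have := α.toAlternatingMap.map_swap ![x, y] (show (0 : Fin 2) ≠ 1 by decide)
  rw [show (![x, y] ∘ Equiv.swap (0 : Fin 2) 1) = ![y, x] by ext k; fin_cases k <;> rfl] at this
  exact this

theorem alt2_self (α : V [⋀^Fin 2]→L[ℝ] ℝ) (x : V) : α ![x, x] = 0 := by
  linarith [alt2_swap α x x]

theorem alt2_add_left (α : V [⋀^Fin 2]→L[ℝ] ℝ) (x x' y : V) :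
    α ![x + x', y] = α ![x, y] + α ![x', y] := α.vecCons_add ![y] x x'

theorem alt2_smul_left (α : V [⋀^Fin 2]→L[ℝ] ℝ) (c : ℝ) (x y : V) :
    α ![c • x, y] = c * α ![x, y] := α.vecCons_smul ![y] c x

theorem alt2_add_right (α : V [⋀^Fin 2]→L[ℝ] ℝ) (x y y' : V) :
    α ![x, y + y'] = α ![x, y] + α ![x, y'] := by
  rw [alt2_swap, alt2_add_left, alt2_swap α x y, alt2_swap α x y']; ring

theorem alt2_smul_right (α : V [⋀^Fin 2]→L[ℝ] ℝ) (c : ℝ) (x y : V) :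
    α ![x, c • y] = c * α ![x, y] := by
  rw [alt2_swap, alt2_smul_left, alt2_swap α x y]; ring

theorem alt2_zero_left (α : V [⋀^Fin 2]→L[ℝ] ℝ) (y : V) : α ![0, y] = 0 := by
  simpa using alt2_smul_left α 0 0 y

theorem alt2_neg_right (α : V [⋀^Fin 2]→L[ℝ] ℝ) (x y : V) : α ![x, -y] = -α ![x, y] := by
  simpa using alt2_smul_right α (-1) x y

/-- The wedge product `a ∧ η` of two 1-forms, the first one given as a linear functional. -/
noncomputable def wedgeOne (a : R4 →L[ℝ] ℝ) (η : R4 [⋀^Fin 1]→L[ℝ] ℝ) : R4 [⋀^Fin 2]→L[ℝ] ℝ :=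
  ContinuousAlternatingMap.alternatizeUncurryFin (a.smulRight η)

theorem wedgeOne_apply (a : R4 →L[ℝ] ℝ) (η : R4 [⋀^Fin 1]→L[ℝ] ℝ) (x y : R4) :
    wedgeOne a η ![x, y] = a x * η ![y] - a y * η ![x] := by
  have h0 : Fin.removeNth (0 : Fin 2) ![x, y] = ![y] := by funext i; fin_cases i; rfl
  have h1 : Fin.removeNth (1 : Fin 2) ![x, y] = ![x] := by funext i; fin_cases i; rfl
  rw [wedgeOne, ContinuousAlternatingMap.alternatizeUncurryFin_apply, Fin.sum_univ_two, h0, h1]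
  simp [sub_eq_add_neg]

theorem wedgeOne_comp (a : R4 →L[ℝ] ℝ) (η : R4 [⋀^Fin 1]→L[ℝ] ℝ) (A : R4 →L[ℝ] R4) :
    wedgeOne (a.comp A) (η.compContinuousLinearMap A) =
      (wedgeOne a η).compContinuousLinearMap A := by
  ext v
  have e : v = ![v 0, v 1] := by funext i; fin_cases i <;> rfl
  have h : ∀ x y : R4, A ∘ ![x, y] = ![A x, A y] := fun x y => by
    funext i; fin_cases i <;> rfl
  have h' : ∀ x : R4, A ∘ ![x] = ![A x] := fun x => by
    funext i; fin_cases i; rfl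
  rw [e, ContinuousAlternatingMap.compContinuousLinearMap_apply, h, wedgeOne_apply,
    wedgeOne_apply]
  simp only [ContinuousAlternatingMap.compContinuousLinearMap_apply, h',
    ContinuousLinearMap.comp_apply]

theorem wedgeOne_smul_left (c : ℝ) (a : R4 →L[ℝ] ℝ) (η : R4 [⋀^Fin 1]→L[ℝ] ℝ) :
    wedgeOne (c • a) η = c • wedgeOne a η := by
  ext v
  have e : v = ![v 0, v 1] := by funext i; fin_cases i <;> rfl
  rw [e, ContinuousAlternatingMap.smul_apply, wedgeOne_apply, wedgeOne_apply]
  simp only [smul_apply, smul_eq_mul]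
  ring

theorem wedgeOne_add_left (a b : R4 →L[ℝ] ℝ) (η : R4 [⋀^Fin 1]→L[ℝ] ℝ) :
    wedgeOne (a + b) η = wedgeOne a η + wedgeOne b η := by
  ext v
  have e : v = ![v 0, v 1] := by funext i; fin_cases i <;> rfl
  rw [e, ContinuousAlternatingMap.add_apply, wedgeOne_apply, wedgeOne_apply, wedgeOne_apply]
  simp only [add_apply]
  ring

/-! ### Linear algebra of a compatible pair `(J, Ω)` -/

/-- A 2-form `Ω` compatible with the linear complex structure `J`, such that `Ω(·, J·)` is an inner
product. -/
structure LinearAlmostKahler (J : R4 →L[ℝ] R4) (Ω : R4 [⋀^Fin 2]→L[ℝ] ℝ) : Prop where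
  compatible : ∀ v w : R4, Ω ![J v, J w] = Ω ![v, w]
  pos : ∀ v : R4, v ≠ 0 → 0 < Ω ![v, J v]

variable {J : R4 →L[ℝ] R4} {Ω Ω' : R4 [⋀^Fin 2]→L[ℝ] ℝ}

/-- A unitary-type frame `e₁, Je₁, e₂, Je₂` is positively oriented by `Ω ∧ Ω`. -/
theorem LinearAlmostKahler.wedge_self_apply (hJ : ∀ v, J (J v) = -v) (h : LinearAlmostKahler J Ω)
    (x y : R4) : wedge Ω Ω ![x, J x, y, J y] =
      2 * (Ω ![x, J x] * Ω ![y, J y] - Ω ![x, y] ^ 2 - Ω ![x, J y] ^ 2) := by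
  have h1 : Ω ![J x, y] = -Ω ![x, J y] := by
    have := h.compatible x (J y)
    rw [hJ, alt2_neg_right] at this
    linarith
  rw [wedge_apply]
  simp only [Matrix.cons_val]
  rw [h.compatible, h1]
  ring

/-- Strict Cauchy–Schwarz for the Hermitian metric attached to `(J, Ω)`: the functional `a` vanishes
on `y` and `J y` but not on `x`, so `x` is not in the complex line of `y`. -/
theorem LinearAlmostKahler.wedge_self_pos (hJ : ∀ v, J (J v) = -v) (h : LinearAlmostKahler J Ω)
    {a : R4 →L[ℝ] ℝ} {x y : R4} (hx : a x ≠ 0) (hy : y ≠ 0) (hay : a y = 0) (hay' : a (J y) = 0) :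
    0 < Ω ![x, J x] * Ω ![y, J y] - Ω ![x, y] ^ 2 - Ω ![x, J y] ^ 2 := by
  have hyy := h.pos y hy
  -- `w` is the component of `x` orthogonal to `y` and `J y`, scaled by `Ω ![y, J y]` to avoid a
  -- division.
  set w := Ω ![y, J y] • x + ((-Ω ![x, J y]) • y + Ω ![x, y] • J y) with hw
  have hw0 : w ≠ 0 := by
    intro h0
    have : a w = Ω ![y, J y] * a x := by simp [hw, hay, hay']
    rw [h0, map_zero] at this
    exact mul_ne_zero hyy.ne' hx this.symm
  have hpos := h.pos w hw0
  have h1 : Ω ![J x, y] = -Ω ![x, J y] := by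
    have := h.compatible x (J y)
    rw [hJ, alt2_neg_right] at this
    linarith
  have e : Ω ![w, J w] = Ω ![y, J y] *
      (Ω ![x, J x] * Ω ![y, J y] - Ω ![x, y] ^ 2 - Ω ![x, J y] ^ 2) := by
    rw [hw]
    simp only [map_add, map_smul, hJ, alt2_add_left, alt2_add_right, alt2_smul_left,
      alt2_smul_right, alt2_neg_right, h.compatible, alt2_self]
    rw [alt2_swap Ω (J x) y, h1, alt2_swap Ω x y, alt2_swap Ω y (J y)]
    ring
  rw [e] at hpos
  exact (mul_pos_iff_of_pos_left hyy).1 hpos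

/-- Two functionals cannot separate the points of `ℝ⁴`. With `b = a ∘ J`, both `y` and `J y` lie in
the kernel of `a`, which provides half of an adapted frame. -/
theorem exists_ne_zero_ker (a b : R4 →L[ℝ] ℝ) : ∃ y : R4, y ≠ 0 ∧ a y = 0 ∧ b y = 0 := by
  have h : LinearMap.ker ((a : R4 →ₗ[ℝ] ℝ).prod (b : R4 →ₗ[ℝ] ℝ)) ≠ ⊥ := by
    apply LinearMap.ker_ne_bot_of_finrank_lt
    simp
  obtain ⟨y, hy, hy0⟩ := (Submodule.ne_bot_iff _).1 h
  rw [LinearMap.mem_ker, LinearMap.prod_apply] at hy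
  exact ⟨y, hy0, congrArg Prod.fst hy, congrArg Prod.snd hy⟩

theorem LinearAlmostKahler.wedge_self_ne_zero (hJ : ∀ v, J (J v) = -v)
    (h : LinearAlmostKahler J Ω) : wedge Ω Ω stdFrame ≠ 0 := by
  set a : R4 →L[ℝ] ℝ := EuclideanSpace.proj (0 : Fin 4)
  obtain ⟨y, hy, hay, hay'⟩ := exists_ne_zero_ker a (a.comp J)
  have hx : a (EuclideanSpace.single 0 1) ≠ 0 := by simp [a]
  apply topForm_ne_zero (v := ![EuclideanSpace.single 0 1, J (EuclideanSpace.single 0 1), y, J y])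
  rw [h.wedge_self_apply hJ]
  exact (mul_pos two_pos (h.wedge_self_pos hJ hx hy hay hay')).ne'

/-- The form `-a ∧ Ja ∧ (Ω + Ω')` is nonnegative, and it controls the norm of the 1-form `a` with
respect to the metric `Ω(·, J·)`. -/
theorem LinearAlmostKahler.sq_le (hJ : ∀ v, J (J v) = -v) (h : LinearAlmostKahler J Ω)
    (h' : LinearAlmostKahler J Ω') (a : R4 →L[ℝ] ℝ) (η : R4 [⋀^Fin 1]→L[ℝ] ℝ)
    (hη : ∀ v, η ![v] = a (J v)) :
    0 ≤ -(wedge (wedgeOne a η) (Ω + Ω') stdFrame / wedge Ω Ω stdFrame) ∧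
    ∀ v, a v ^ 2 ≤ 2 * -(wedge (wedgeOne a η) (Ω + Ω') stdFrame / wedge Ω Ω stdFrame) *
      Ω ![v, J v] := by
  by_cases ha : a = 0
  · have : wedgeOne a η = 0 := by
      subst ha
      simpa using wedgeOne_smul_left 0 0 η
    have e : wedge (wedgeOne a η) (Ω + Ω') = 0 := by
      rw [this]
      simpa using wedge_smul_left 0 0 (Ω + Ω')
    rw [e]
    subst ha
    simp
  obtain ⟨y, hy, hay, hay'⟩ := exists_ne_zero_ker a (a.comp J)
  replace hay' : a (J y) = 0 := hay'
  -- On the frame `x, J x, y, J y` the 2-form `a ∧ Ja` equals -1 on `(x, J x)` and vanishes on every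
  -- other pair, so only the values on `(y, J y)` of `Ω` and `Ω'` survive.
  have key : ∀ x, a x = 1 → a (J x) = 0 →
      -(wedge (wedgeOne a η) (Ω + Ω') stdFrame / wedge Ω Ω stdFrame) =
        (Ω ![y, J y] + Ω' ![y, J y]) /
          (2 * (Ω ![x, J x] * Ω ![y, J y] - Ω ![x, y] ^ 2 - Ω ![x, J y] ^ 2)) := by
    intro x hx hJx
    have hp := h.wedge_self_pos hJ (by rw [hx]; exact one_ne_zero) hy hay hay'
    rw [topForm_div _ _ (v := ![x, J x, y, J y]), h.wedge_self_apply hJ, wedge_apply]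
    · simp only [Matrix.cons_val, wedgeOne_apply, hη, hJ, map_neg, hx, hJx, hay, hay',
        ContinuousAlternatingMap.add_apply]
      ring
    · rw [h.wedge_self_apply hJ]
      exact (mul_pos two_pos hp).ne'
  have main : ∀ v, 0 < a v ^ 2 + a (J v) ^ 2 →
      0 ≤ -(wedge (wedgeOne a η) (Ω + Ω') stdFrame / wedge Ω Ω stdFrame) ∧
      a v ^ 2 ≤ 2 * -(wedge (wedgeOne a η) (Ω + Ω') stdFrame / wedge Ω Ω stdFrame) *
        Ω ![v, J v] := by
    intro v hr
    set r := a v ^ 2 + a (J v) ^ 2 with hrdef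
    -- The complex multiple of `v` on which `a` is 1 and `a ∘ J` is 0; its squared length is that of
    -- `v` divided by `r`.
    set x := (a v / r) • v + (a (J v) / r) • J v with hxdef
    have hx : a x = 1 := by
      simp only [hxdef, map_add, map_smul, smul_eq_mul]
      field_simp
      linarith
    have hJx : a (J x) = 0 := by
      simp only [hxdef, map_add, map_smul, smul_eq_mul, hJ, map_neg]
      ring
    have hxx : Ω ![x, J x] = Ω ![v, J v] / r := by
      simp only [hxdef, map_add, map_smul, hJ, alt2_add_left, alt2_add_right, alt2_smul_left,
        alt2_smul_right, alt2_neg_right, h.compatible, alt2_self]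
      rw [alt2_swap Ω v (J v)]
      field_simp
      rw [hrdef]
      ring
    have hp := h.wedge_self_pos hJ (by rw [hx]; exact one_ne_zero) hy hay hay'
    have hyy := h.pos y hy
    have hyy' := h'.pos y hy
    have hv0 : v ≠ 0 := by
      rintro rfl
      simp [r] at hr
    have hvv := h.pos v hv0
    rw [key x hx hJx]
    refine ⟨by positivity, ?_⟩
    rw [hxx] at hp ⊢
    set D := Ω ![v, J v] / r * Ω ![y, J y] - Ω ![x, y] ^ 2 - Ω ![x, J y] ^ 2 with hD
    have hDle : D ≤ Ω ![v, J v] / r * Ω ![y, J y] := by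
      nlinarith [sq_nonneg (Ω ![x, y]), sq_nonneg (Ω ![x, J y])]
    -- The `Ω'` term is positive and is simply discarded, so the bound does not depend on the size
    -- of `Ω'`.
    have hle : r ≤ 2 * ((Ω ![y, J y] + Ω' ![y, J y]) / (2 * D)) * Ω ![v, J v] := by
      have e : 2 * ((Ω ![y, J y] + Ω' ![y, J y]) / (2 * D)) * Ω ![v, J v] =
          (Ω ![y, J y] + Ω' ![y, J y]) * Ω ![v, J v] / D := by
        field_simp
      rw [e, le_div_iff₀ hp]
      calc r * D ≤ r * (Ω ![v, J v] / r * Ω ![y, J y]) := by gcongr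
        _ = Ω ![y, J y] * Ω ![v, J v] := by field_simp
        _ ≤ _ := by nlinarith
    nlinarith [sq_nonneg (a (J v))]
  obtain ⟨v₀, hv₀⟩ : ∃ v, a v ≠ 0 := by
    by_contra! hcon
    exact ha (ContinuousLinearMap.ext hcon)
  refine ⟨(main v₀ (by positivity)).1, fun v => ?_⟩
  rcases eq_or_ne (a v) 0 with h0 | h0
  · rw [h0, zero_pow two_ne_zero]
    have h1 := (main v₀ (by positivity)).1
    rcases eq_or_ne v 0 with rfl | hv
    · simp [alt2_zero_left]
    · have := h.pos v hv
      positivity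
  · exact (main v (by positivity)).2

/-- The volume form `Ω ∧ Ω` is determined up to sign by the metric `Ω(·, J·)`. -/
theorem abs_wedge_self_eq {J₀ : R4 →L[ℝ] R4} {Ω₀ : R4 [⋀^Fin 2]→L[ℝ] ℝ}
    (hJ : ∀ v, J (J v) = -v) (hJ₀ : ∀ v, J₀ (J₀ v) = -v)
    (h : ∀ v w, Ω ![v, J w] = Ω₀ ![v, J₀ w]) :
    |wedge Ω Ω stdFrame| = |wedge Ω₀ Ω₀ stdFrame| := by
  set e := (EuclideanSpace.basisFun (Fin 4) ℝ).toBasis with he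
  have hstd : ∀ i, stdFrame i = e i := fun i => by simp [he, stdFrame]
  -- `Ω ∧ Ω` on the frame is twice the Pfaffian of the matrix of `Ω`, and the Gram matrix of the
  -- metric is that matrix times the matrix of `J`. The fourth power removes the sign of the
  -- Pfaffian and that of `det J = ±1`.
  have key : ∀ (J : R4 →L[ℝ] R4) (Ω : R4 [⋀^Fin 2]→L[ℝ] ℝ), (∀ v, J (J v) = -v) →
      (wedge Ω Ω stdFrame) ^ 4 =
        16 * (Matrix.of fun i j => Ω ![stdFrame i, J (stdFrame j)]).det ^ 2 := by
    intro J Ω hJ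
    set P : Matrix (Fin 4) (Fin 4) ℝ := Matrix.of fun i j => Ω ![stdFrame i, stdFrame j] with hP
    set N := LinearMap.toMatrix e e (J : R4 →ₗ[ℝ] R4) with hN
    have hPN : (Matrix.of fun i j => Ω ![stdFrame i, J (stdFrame j)]) = P * N := by
      ext i j
      have hs : J (stdFrame j) = ∑ k, N k j • stdFrame k := by
        simp only [hN, hstd, LinearMap.toMatrix_apply]
        exact (e.sum_repr _).symm
      rw [Matrix.of_apply, hs, Matrix.mul_apply]
      simp only [Fin.sum_univ_four, alt2_add_right, alt2_smul_right, hP, Matrix.of_apply]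
      ring
    have hdet : N.det ^ 2 = 1 := by
      have h1 : N * N = -1 := by
        rw [hN, ← LinearMap.toMatrix_comp e e e]
        have : (J : R4 →ₗ[ℝ] R4) ∘ₗ (J : R4 →ₗ[ℝ] R4) = -LinearMap.id := by
          ext v : 1
          exact hJ v
        rw [this, map_neg, LinearMap.toMatrix_id]
      rw [pow_two, ← Matrix.det_mul, h1, Matrix.det_neg]
      norm_num
    have hPdet : 4 * P.det = (wedge Ω Ω stdFrame) ^ 2 := by
      rw [wedge_apply]
      simp only [Matrix.det_succ_row_zero, Fin.sum_univ_succ, P]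
      simp [Fin.succAbove, alt2_self]
      rw [alt2_swap Ω (stdFrame 0) (stdFrame 1), alt2_swap Ω (stdFrame 0) (stdFrame 2),
        alt2_swap Ω (stdFrame 0) (stdFrame 3), alt2_swap Ω (stdFrame 1) (stdFrame 2),
        alt2_swap Ω (stdFrame 1) (stdFrame 3), alt2_swap Ω (stdFrame 2) (stdFrame 3)]
      ring
    rw [hPN, Matrix.det_mul, mul_pow, hdet]
    linear_combination (-(wedge Ω Ω stdFrame) ^ 2 - 4 * P.det) * hPdet
  have h4 : (wedge Ω Ω stdFrame) ^ 4 = (wedge Ω₀ Ω₀ stdFrame) ^ 4 := by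
    rw [key J Ω hJ, key J₀ Ω₀ hJ₀]
    simp only [h]
  have := congrArg abs h4
  rw [abs_pow, abs_pow] at this
  exact (pow_left_inj₀ (abs_nonneg _) (abs_nonneg _) (by norm_num)).1 this

end LinearAlgebra

end AlmostKahler

namespace AlmostKahler

/-! ### Stampacchia iteration on superlevel sets -/

section Iteration

open MeasureTheory

/-- Stampacchia's lemma: a nonincreasing function with superlinear decay vanishes eventually. -/
theorem stampacchia {b : ℝ → ℝ} (hb : Antitone b) (hb0 : ∀ t, 0 ≤ b t) {k₀ E δ β : ℝ}
    (hE : 0 ≤ E) (hδ : 0 < δ) (hβ : 0 < β) (hk₀ : b k₀ ≤ β)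
    (h : ∀ k l, k₀ ≤ k → k < l → (l - k) * b l ≤ E * b k ^ (1 + δ)) :
    b (k₀ + (2 * E * β ^ δ * 2 ^ (1 / δ) + 1)) = 0 := by
  -- The levels are `k₀ + D (1 - 2⁻ⁿ)`, and the claim is `b ≤ β σⁿ` there. Since `σ ^ δ = 1/2`, the
  -- superlinear gain matches the halving of the gaps, and the induction closes once `2 E β^δ ≤ σ
  -- D`. The added 1 keeps `D` positive.
  set σ : ℝ := 2 ^ (-(1 / δ)) with hσ
  set D : ℝ := 2 * E * β ^ δ * 2 ^ (1 / δ) + 1 with hD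
  have hσ0 : 0 < σ := by positivity
  have hσ1 : σ < 1 := Real.rpow_lt_one_of_one_lt_of_neg (by norm_num) (by simpa using hδ)
  have hD0 : 0 < D := by positivity
  have hσδ : ∀ n : ℕ, (σ ^ n) ^ δ = (1 / 2) ^ n := by
    intro n
    have h1 : σ ^ δ = 1 / 2 := by
      rw [hσ, ← Real.rpow_mul (by norm_num), neg_mul, one_div_mul_cancel hδ.ne',
        Real.rpow_neg_one]
      norm_num
    rw [← h1, ← Real.rpow_natCast σ n, ← Real.rpow_natCast, ← Real.rpow_mul hσ0.le,
      ← Real.rpow_mul hσ0.le, mul_comm]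
  have hσD : 2 * E * β ^ δ ≤ σ * D := by
    have : σ * 2 ^ (1 / δ) = 1 := by
      rw [hσ, ← Real.rpow_add (by norm_num)]; simp
    calc 2 * E * β ^ δ = 2 * E * β ^ δ * (σ * 2 ^ (1 / δ)) := by rw [this, mul_one]
      _ ≤ σ * D := by rw [hD]; nlinarith
  have key : ∀ n : ℕ, b (k₀ + D * (1 - (1 / 2) ^ n)) ≤ β * σ ^ n := by
    intro n
    induction n with
    | zero => simpa using hk₀
    | succ n ih =>
      have hpow : (0 : ℝ) < (1 / 2) ^ n := by positivity
      have hle : (1 / 2 : ℝ) ^ n ≤ 1 := pow_le_one₀ (by norm_num) (by norm_num)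
      have h1 := h (k₀ + D * (1 - (1 / 2) ^ n)) (k₀ + D * (1 - (1 / 2) ^ (n + 1)))
        (by nlinarith) (by rw [pow_succ]; nlinarith)
      have e1 : k₀ + D * (1 - (1 / 2) ^ (n + 1)) - (k₀ + D * (1 - (1 / 2) ^ n)) =
          D * (1 / 2) ^ n / 2 := by rw [pow_succ]; ring
      rw [e1] at h1
      have h2 : b (k₀ + D * (1 - (1 / 2) ^ n)) ^ (1 + δ) ≤ β * β ^ δ * (σ ^ n * (1 / 2) ^ n) := by
        calc _ ≤ (β * σ ^ n) ^ (1 + δ) := Real.rpow_le_rpow (hb0 _) ih (by positivity)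
          _ = β * β ^ δ * (σ ^ n * (1 / 2) ^ n) := by
            rw [Real.mul_rpow hβ.le (by positivity), Real.rpow_add hβ, Real.rpow_one,
              Real.rpow_add (by positivity : 0 < σ ^ n), Real.rpow_one, hσδ]
      have h3 : D * (1 / 2) ^ n / 2 * b (k₀ + D * (1 - (1 / 2) ^ (n + 1))) ≤
          D * (1 / 2) ^ n / 2 * (β * σ ^ (n + 1)) := by
        calc _ ≤ E * (β * β ^ δ * (σ ^ n * (1 / 2) ^ n)) :=
              h1.trans (mul_le_mul_of_nonneg_left h2 hE)
          _ = (2 * E * β ^ δ) * (β * σ ^ n * (1 / 2) ^ n / 2) := by ring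
          _ ≤ (σ * D) * (β * σ ^ n * (1 / 2) ^ n / 2) := by gcongr
          _ = _ := by rw [pow_succ]; ring
      exact le_of_mul_le_mul_left h3 (by positivity)
  have hlim : Filter.Tendsto (fun n : ℕ => β * σ ^ n) Filter.atTop (nhds 0) := by
    simpa using (tendsto_pow_atTop_nhds_zero_of_lt_one hσ0.le hσ1).const_mul β
  refine le_antisymm (ge_of_tendsto' hlim fun n => (hb ?_).trans (key n)) (hb0 _)
  have : (0 : ℝ) < (1 / 2) ^ n := by positivity
  nlinarith

variable {X : Type*} [TopologicalSpace X] [CompactSpace X] [MeasurableSpace X] [BorelSpace X]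
  {μ : Measure X} [IsFiniteMeasure μ]

theorem Continuous.memLp_of_compactSpace {f : X → ℝ} (hf : Continuous f) (r : ENNReal)
    (ν : Measure X) [IsFiniteMeasure ν] : MemLp f r ν := by
  obtain ⟨C, hC⟩ := isCompact_univ.exists_bound_of_continuousOn hf.continuousOn
  exact MemLp.of_bound hf.measurable.aestronglyMeasurable C (.of_forall fun x => hC x trivial)

theorem Continuous.integrable_of_compactSpace {f : X → ℝ} (hf : Continuous f)
    (ν : Measure X) [IsFiniteMeasure ν] : Integrable f ν :=
  memLp_one_iff_integrable.1 (Continuous.memLp_of_compactSpace hf 1 ν)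

theorem integral_mul_le_holder {p q : ℝ} (hpq : p.HolderConjugate q) {f g : X → ℝ}
    (hf : Continuous f) (hg : Continuous g) (hf0 : ∀ x, 0 ≤ f x) (hg0 : ∀ x, 0 ≤ g x)
    (ν : Measure X) [IsFiniteMeasure ν] :
    ∫ x, f x * g x ∂ν ≤ (∫ x, f x ^ p ∂ν) ^ (1 / p) * (∫ x, g x ^ q ∂ν) ^ (1 / q) :=
  integral_mul_le_Lp_mul_Lq_of_nonneg hpq (.of_forall hf0) (.of_forall hg0)
    (Continuous.memLp_of_compactSpace hf _ _) (Continuous.memLp_of_compactSpace hg _ _)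

/-- Hölder's inequality against the constant function 1, with exponent `p / r`. -/
theorem integral_rpow_le_rpow {r p : ℝ} (hr : 0 < r) (hrp : r < p) {f : X → ℝ} (hf : Continuous f)
    (hf0 : ∀ x, 0 ≤ f x) (ν : Measure X) [IsFiniteMeasure ν] :
    ∫ x, f x ^ r ∂ν ≤ (∫ x, f x ^ p ∂ν) ^ (r / p) * ν.real Set.univ ^ (1 - r / p) := by
  have hp : 0 < p := hr.trans hrp
  have hc : Continuous fun x => f x ^ r := hf.rpow_const fun _ => Or.inr hr.le
  have hpq : (p / r).HolderConjugate (1 / (1 - r / p)) := by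
    rw [Real.holderConjugate_iff]
    refine ⟨by rwa [lt_div_iff₀ hr, one_mul], ?_⟩
    simp
  have h := integral_mul_le_holder hpq hc (continuous_const (y := (1 : ℝ)))
    (fun x => Real.rpow_nonneg (hf0 x) _) (fun _ => zero_le_one) ν
  have e : ∀ x, (f x ^ r) ^ (p / r) = f x ^ p := fun x => by
    rw [← Real.rpow_mul (hf0 x), mul_div_cancel₀ _ hr.ne']
  simpa [e, Measure.real] using h

/-- The energy estimate on the superlevel set `{u > k}`, where `v = (u - k)⁺`. -/
theorem superlevel_estimate {p : ℝ} (hp : 2 < p) {C H : ℝ} (hC : 0 ≤ C)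
    {u h : X → ℝ} (hu : Continuous u) (hh : Continuous h)
    (hH : (∫ x, |h x| ^ p ∂μ) ^ (1 / p) ≤ H) {k l : ℝ} (hkl : k < l)
    (hrev : (∫ x, max (u x - k) 0 ^ 8 ∂μ) ^ (1 / 2 : ℝ) ≤
      C * (∫ x, max (u x - k) 0 ^ 3 * |h x| ∂μ + ∫ x, max (u x - k) 0 ^ 4 ∂μ))
    (hsmall : C * μ.real {x | k < u x} ^ (1 / 2 : ℝ) ≤ 1 / 2) :
    (l - k) * μ.real {x | l < u x} ^ (1 / 8 : ℝ) ≤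
      2 * C * H * μ.real {x | k < u x} ^ (5 / 8 - 1 / p) := by
  set S := {x | k < u x} with hS
  have hSm : MeasurableSet S := (isOpen_lt continuous_const hu).measurableSet
  set A := μ.real S with hA
  set v : X → ℝ := fun x => max (u x - k) 0 with hv
  have hvc : Continuous v := (hu.sub continuous_const).max continuous_const
  have hv0 : ∀ x, 0 ≤ v x := fun x => le_max_right _ _
  have hvS : ∀ x, x ∉ S → v x = 0 := fun x hx => by
    simp only [hS, Set.mem_ofPred_eq, not_lt] at hx
    exact max_eq_right (by linarith)
  have hrestr : ∀ f : X → ℝ, (∀ x, x ∉ S → f x = 0) → ∫ x in S, f x ∂μ = ∫ x, f x ∂μ :=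
    fun f hf => setIntegral_eq_integral_of_forall_compl_eq_zero hf
  set Y := ∫ x, v x ^ 8 ∂μ with hY
  have hY0 : 0 ≤ Y := integral_nonneg fun x => pow_nonneg (hv0 x) _
  have hA0 : 0 ≤ A := measureReal_nonneg
  have hp0 : 0 < p := by linarith
  have hAr : (μ.restrict S).real Set.univ = A := by simp [Measure.real, hA]
  have hhp : (∫ x in S, |h x| ^ p ∂μ) ^ (1 / p) ≤ H := by
    refine le_trans (Real.rpow_le_rpow (integral_nonneg fun x => by positivity) ?_
      (by positivity)) hH
    exact setIntegral_le_integral (Continuous.integrable_of_compactSpace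
      (hh.abs.rpow_const fun _ => Or.inr hp0.le) μ) (.of_forall fun x => by positivity)
  -- Hölder with exponents 8/3 and 8/5 turns `v³` into `v⁸`. As 8/5 < p, the remaining norm of `h`
  -- over `S` is controlled by its Lᵖ norm, at the gain of the power `5/8 - 1/p` of the measure.
  have h1 : ∫ x, v x ^ 3 * |h x| ∂μ ≤ Y ^ (3 / 8 : ℝ) * (H * A ^ (5 / 8 - 1 / p)) := by
    have hpq : (8 / 3 : ℝ).HolderConjugate (8 / 5) := by
      rw [Real.holderConjugate_iff]; norm_num
    have a1 := integral_mul_le_holder hpq (hvc.pow 3) hh.abs (fun x => pow_nonneg (hv0 x) _)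
      (fun x => abs_nonneg _) (μ.restrict S)
    have e1 : ∀ x, (v x ^ 3) ^ (8 / 3 : ℝ) = v x ^ 8 := fun x => by
      rw [← Real.rpow_natCast, ← Real.rpow_mul (hv0 x), ← Real.rpow_natCast]; norm_num
    simp only [Pi.pow_apply, e1] at a1
    rw [hrestr (fun x => v x ^ 3 * |h x|) (fun x hx => by simp [hvS x hx]),
      hrestr (fun x => v x ^ 8) (fun x hx => by simp [hvS x hx])] at a1
    have a2 := integral_rpow_le_rpow (r := 8 / 5) (p := p) (by norm_num) (by linarith) hh.abs
      (fun x => abs_nonneg _) (μ.restrict S)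
    rw [hAr] at a2
    have a3 : (∫ x in S, |h x| ^ (8 / 5 : ℝ) ∂μ) ^ (1 / (8 / 5) : ℝ) ≤ H * A ^ (5 / 8 - 1 / p) := by
      have hi0 : 0 ≤ ∫ x in S, |h x| ^ p ∂μ := integral_nonneg fun x => by positivity
      calc _ ≤ ((∫ x in S, |h x| ^ p ∂μ) ^ (8 / 5 / p) * A ^ (1 - 8 / 5 / p)) ^ (1 / (8 / 5) : ℝ) :=
            Real.rpow_le_rpow (integral_nonneg fun x => by positivity) a2 (by norm_num)
        _ = (∫ x in S, |h x| ^ p ∂μ) ^ (1 / p) * A ^ (5 / 8 - 1 / p) := by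
            rw [Real.mul_rpow (by positivity) (by positivity), ← Real.rpow_mul hi0,
              ← Real.rpow_mul hA0]
            congr 2 <;> field_simp
        _ ≤ _ := by gcongr
    calc _ ≤ Y ^ (1 / (8 / 3) : ℝ) * _ := a1
      _ ≤ Y ^ (1 / (8 / 3) : ℝ) * (H * A ^ (5 / 8 - 1 / p)) := by gcongr
      _ = _ := by norm_num
  have h2 : ∫ x, v x ^ 4 ∂μ ≤ Y ^ (1 / 2 : ℝ) * A ^ (1 / 2 : ℝ) := by
    rw [← hrestr _ (fun x hx => by simp [hvS x hx])]
    have a2 := integral_rpow_le_rpow (r := 4) (p := 8) (by norm_num) (by norm_num) hvc hv0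
      (μ.restrict S)
    rw [hAr] at a2
    have e1 : ∀ x, v x ^ (8 : ℝ) = v x ^ 8 := fun x => by
      rw [← Real.rpow_natCast]; norm_num
    have e2 : ∀ x, v x ^ (4 : ℝ) = v x ^ 4 := fun x => by
      rw [← Real.rpow_natCast]; norm_num
    simp only [e1, e2] at a2
    rw [hrestr (fun x => v x ^ 8) (fun x hx => by simp [hvS x hx])] at a2
    calc _ ≤ _ := a2
      _ = _ := by
        rw [← hY]; norm_num
  have hH0 : 0 ≤ H := le_trans (Real.rpow_nonneg (integral_nonneg fun x => by positivity) _) hH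
  -- By `hsmall`, the quartic term is at most half of the left-hand side and is absorbed.
  have h3 : Y ^ (1 / 2 : ℝ) ≤ 2 * C * H * A ^ (5 / 8 - 1 / p) * Y ^ (3 / 8 : ℝ) := by
    have a1 : Y ^ (1 / 2 : ℝ) ≤ C * (Y ^ (3 / 8 : ℝ) * (H * A ^ (5 / 8 - 1 / p)) +
        Y ^ (1 / 2 : ℝ) * A ^ (1 / 2 : ℝ)) :=
      hrev.trans (mul_le_mul_of_nonneg_left (add_le_add h1 h2) hC)
    have a2 := mul_le_mul_of_nonneg_left hsmall (Real.rpow_nonneg hY0 (1 / 2))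
    linarith
  have h4 : Y ^ (1 / 8 : ℝ) ≤ 2 * C * H * A ^ (5 / 8 - 1 / p) := by
    rcases hY0.eq_or_lt with h0 | h0
    · rw [← h0, Real.zero_rpow (by norm_num)]
      positivity
    · have e : Y ^ (1 / 2 : ℝ) = Y ^ (1 / 8 : ℝ) * Y ^ (3 / 8 : ℝ) := by
        rw [← Real.rpow_add h0]; norm_num
      rw [e] at h3
      exact le_of_mul_le_mul_right h3 (by positivity)
  refine le_trans ?_ h4
  -- Chebyshev: `v ≥ l - k` on the smaller superlevel set.
  have h5 : (l - k) ^ 8 * μ.real {x | l < u x} ≤ Y := by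
    have hi : Integrable (fun x => v x ^ 8) μ := Continuous.integrable_of_compactSpace (hvc.pow 8) μ
    have a1 := mul_meas_ge_le_integral_of_nonneg (.of_forall fun x => pow_nonneg (hv0 x) 8) hi
      ((l - k) ^ 8)
    refine le_trans (mul_le_mul_of_nonneg_left (measureReal_mono ?_) (by positivity)) a1
    intro x hx
    simp only [Set.mem_ofPred_eq] at hx ⊢
    exact pow_le_pow_left₀ (by linarith) (le_trans (by linarith) (le_max_left _ _)) 8
  have h6 := Real.rpow_le_rpow (by positivity) h5 (show (0 : ℝ) ≤ 1 / 8 by norm_num)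
  rw [Real.mul_rpow (by positivity) measureReal_nonneg] at h6
  have e : ((l - k) ^ 8) ^ (1 / 8 : ℝ) = l - k := by
    rw [← Real.rpow_natCast, ← Real.rpow_mul (by linarith)]; norm_num
  rwa [e] at h6

/-- The eighth root `b` of the measure of the superlevel set satisfies Stampacchia's inequality with
exponent `8 (5/8 - 1/p) = 1 + δ`, where `δ = 4 - 8/p` is positive exactly when `p > 2`. A superlevel
set of a continuous function is open, so once it is null it is empty. -/
theorem exists_upper_bound (μ : Measure X) [IsFiniteMeasure μ] [μ.IsOpenPosMeasure] {p : ℝ}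
    (hp : 2 < p) (C H : ℝ) (hC : 0 ≤ C) (hH0 : 0 ≤ H) :
    ∃ D : ℝ, ∀ u h : X → ℝ, Continuous u → Continuous h →
      (∫ x, |h x| ^ p ∂μ) ^ (1 / p) ≤ H → ∫ x, u x ^ 2 ∂μ ≤ H →
      (∀ k : ℝ, (∫ x, max (u x - k) 0 ^ 8 ∂μ) ^ (1 / 2 : ℝ) ≤
        C * (∫ x, max (u x - k) 0 ^ 3 * |h x| ∂μ + ∫ x, max (u x - k) 0 ^ 4 ∂μ)) →
      ∀ x, u x ≤ D := by
  set β : ℝ := μ.real Set.univ ^ (1 / 8 : ℝ) + 1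
  set δ : ℝ := 4 - 8 / p with hδdef
  have hp0 : 0 < p := by linarith
  have hδ : 0 < δ := by
    have : 8 / p < 4 := by rw [div_lt_iff₀ hp0]; linarith
    linarith
  -- Starting level: by Chebyshev and the L² bound, the superlevel set above `k₀` is small enough
  -- for the absorption hypothesis of `superlevel_estimate`, and so are all higher ones.
  set k₀ : ℝ := 2 * (C + 1) * (H + 1) with hk₀def
  have hk₀ : 0 < k₀ := by positivity
  refine ⟨k₀ + (2 * (2 * C * H) * β ^ δ * 2 ^ (1 / δ) + 1), fun u h hu hh hH h2 hrev x => ?_⟩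
  have hA0 : ∀ k, 0 ≤ μ.real {x | k < u x} := fun k => measureReal_nonneg
  have hanti : Antitone fun k => μ.real {x | k < u x} := fun k l hkl =>
    measureReal_mono fun x hx => lt_of_le_of_lt hkl hx
  have hcheb : C * μ.real {x | k₀ < u x} ^ (1 / 2 : ℝ) ≤ 1 / 2 := by
    have hi : Integrable (fun x => u x ^ 2) μ := Continuous.integrable_of_compactSpace (hu.pow 2) μ
    have a1 := mul_meas_ge_le_integral_of_nonneg (.of_forall fun x => sq_nonneg (u x)) hi (k₀ ^ 2)
    have a2 : k₀ ^ 2 * μ.real {x | k₀ < u x} ≤ H := by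
      refine le_trans (mul_le_mul_of_nonneg_left (measureReal_mono ?_) (by positivity))
        (a1.trans h2)
      intro x hx
      exact pow_le_pow_left₀ hk₀.le (le_of_lt hx) 2
    have a3 : μ.real {x | k₀ < u x} ≤ (1 / (2 * (C + 1))) ^ 2 := by
      have e : k₀ ^ 2 = (2 * (C + 1)) ^ 2 * (H + 1) ^ 2 := by rw [hk₀def]; ring
      rw [e] at a2
      have hH1 : H ≤ (H + 1) ^ 2 := by nlinarith
      rw [div_pow, one_pow, le_div_iff₀ (by positivity)]
      have := hA0 k₀
      have a4 : ((2 * (C + 1)) ^ 2 * μ.real {x | k₀ < u x}) * (H + 1) ^ 2 ≤ 1 * (H + 1) ^ 2 := by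
        linarith
      linarith [le_of_mul_le_mul_right a4 (by positivity)]
    have a5 : μ.real {x | k₀ < u x} ^ (1 / 2 : ℝ) ≤ 1 / (2 * (C + 1)) := by
      rw [← Real.sqrt_eq_rpow]
      exact (Real.sqrt_le_left (by positivity)).2 a3
    calc C * μ.real {x | k₀ < u x} ^ (1 / 2 : ℝ) ≤ C * (1 / (2 * (C + 1))) := by gcongr
      _ ≤ 1 / 2 := by
        rw [mul_one_div, div_le_div_iff₀ (by positivity) (by norm_num)]; linarith
  have hb := stampacchia (b := fun k => μ.real {x | k < u x} ^ (1 / 8 : ℝ)) (k₀ := k₀)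
    (E := 2 * C * H) (δ := δ) (β := β)
    (fun k l hkl => Real.rpow_le_rpow (hA0 l) (hanti hkl) (by norm_num))
    (fun k => Real.rpow_nonneg (hA0 k) _) (by positivity) hδ (by positivity)
    (by
      have : μ.real {x | k₀ < u x} ^ (1 / 8 : ℝ) ≤ μ.real Set.univ ^ (1 / 8 : ℝ) :=
        Real.rpow_le_rpow (hA0 _) (measureReal_mono (Set.subset_univ _)) (by norm_num)
      simp only [β]; linarith)
    (by
      intro k l hk hkl
      have hs : C * μ.real {x | k < u x} ^ (1 / 2 : ℝ) ≤ 1 / 2 := by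
        refine le_trans ?_ hcheb
        exact mul_le_mul_of_nonneg_left (Real.rpow_le_rpow (hA0 k) (hanti hk) (by norm_num)) hC
      have := superlevel_estimate hp hC hu hh hH hkl (hrev k) hs
      refine this.trans (le_of_eq ?_)
      rw [← Real.rpow_mul (hA0 k)]
      congr 2
      rw [hδdef]; ring)
  by_contra! hcon
  set D := k₀ + (2 * (2 * C * H) * β ^ δ * 2 ^ (1 / δ) + 1)
  have ho : IsOpen {x | D < u x} := isOpen_lt continuous_const hu
  have hpos := ho.measure_pos μ ⟨x, hcon⟩
  rw [Real.rpow_eq_zero (hA0 _) (by norm_num), measureReal_eq_zero_iff] at hb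
  exact hpos.ne' hb

end Iteration

end AlmostKahler

namespace AlmostKahler

/-! ### Poincaré and Sobolev inequalities in Euclidean space -/

section Euclidean

open MeasureTheory Set Metric
open scoped ENNReal NNReal

variable {E : Type*} [NormedAddCommGroup E] [NormedSpace ℝ E]

theorem sq_lintegral_le {α : Type*} [MeasurableSpace α] (ν : Measure α) [IsProbabilityMeasure ν]
    {f : α → ℝ≥0∞} (hf : AEMeasurable f ν) : (∫⁻ x, f x ∂ν) ^ 2 ≤ ∫⁻ x, f x ^ 2 ∂ν := by
  have h := ENNReal.lintegral_mul_le_Lp_mul_Lq ν (p := 2) (q := 2)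
    (by rw [Real.holderConjugate_iff]; norm_num) hf (aemeasurable_const (b := (1 : ℝ≥0∞)))
  simp only [Pi.mul_apply, mul_one, ENNReal.one_rpow, lintegral_const, measure_univ] at h
  calc (∫⁻ x, f x ∂ν) ^ 2 ≤ ((∫⁻ x, f x ^ (2 : ℝ) ∂ν) ^ (1 / 2 : ℝ)) ^ 2 :=
        pow_le_pow_left₀ zero_le h 2
    _ = ∫⁻ x, f x ^ 2 ∂ν := by
      rw [← ENNReal.rpow_natCast, ← ENNReal.rpow_mul]
      norm_num

/-- Fundamental theorem of calculus along the segment, then Cauchy–Schwarz in the parameter. -/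
theorem enorm_sub_sq_le_lintegral_fderiv {U : Set E} (hU : IsOpen U) (hUc : Convex ℝ U) {w : E → ℝ}
    (hw : ContDiffOn ℝ 1 w U) {x y : E} (hx : x ∈ U) (hy : y ∈ U) :
    ‖w y - w x‖ₑ ^ 2 ≤
      ∫⁻ t in Icc (0 : ℝ) 1, ‖fderiv ℝ w ((1 - t) • x + t • y)‖ₑ ^ 2 * ‖y - x‖ₑ ^ 2 := by
  have hγ : ∀ t ∈ Icc (0 : ℝ) 1, (1 - t) • x + t • y ∈ U := fun t ht =>
    hUc hx hy (by linarith [ht.2]) ht.1 (by ring)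
  have hd : ContinuousOn (fun t : ℝ => fderiv ℝ w ((1 - t) • x + t • y)) (Icc 0 1) :=
    (hw.continuousOn_fderiv_of_isOpen hU le_rfl).comp (by fun_prop) hγ
  have hder : ∀ t ∈ uIcc (0 : ℝ) 1, HasDerivAt (fun t : ℝ => w ((1 - t) • x + t • y))
      (fderiv ℝ w ((1 - t) • x + t • y) (y - x)) t := by
    intro t ht
    rw [uIcc_of_le zero_le_one] at ht
    have h1 : HasDerivAt (fun t : ℝ => (1 - t) • x + t • y) (y - x) t := by
      have := (((hasDerivAt_id t).const_sub 1).smul_const x).add ((hasDerivAt_id t).smul_const y)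
      rw [show y - x = -(1 : ℝ) • x + (1 : ℝ) • y by rw [neg_smul, one_smul, one_smul]; abel]
      exact this
    exact (((hw.differentiableOn (by simp)).differentiableAt
      (hU.mem_nhds (hγ t ht))).hasFDerivAt).comp_hasDerivAt t h1
  have hc : ContinuousOn (fun t : ℝ => fderiv ℝ w ((1 - t) • x + t • y) (y - x)) (Icc 0 1) :=
    hd.clm_apply continuousOn_const
  have hint := intervalIntegral.integral_eq_sub_of_hasDerivAt hder
    (by rw [intervalIntegrable_iff_integrableOn_Icc_of_le zero_le_one]
        exact hc.integrableOn_Icc)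
  simp only [sub_self, zero_smul, one_smul, zero_add, sub_zero, add_zero] at hint
  rw [← hint, intervalIntegral.integral_of_le zero_le_one, ← integral_Icc_eq_integral_Ioc]
  have hprob : IsProbabilityMeasure (volume.restrict (Icc (0 : ℝ) 1)) := ⟨by simp⟩
  calc _ ≤ (∫⁻ t in Icc (0 : ℝ) 1, ‖fderiv ℝ w ((1 - t) • x + t • y) (y - x)‖ₑ) ^ 2 :=
        pow_le_pow_left₀ zero_le (enorm_integral_le_lintegral_enorm _) 2
    _ ≤ ∫⁻ t in Icc (0 : ℝ) 1, ‖fderiv ℝ w ((1 - t) • x + t • y) (y - x)‖ₑ ^ 2 :=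
        sq_lintegral_le _ (hc.aestronglyMeasurable measurableSet_Icc).enorm
    _ ≤ _ := by
        refine lintegral_mono fun t => ?_
        rw [← mul_pow]
        exact pow_le_pow_left₀ zero_le (ContinuousLinearMap.le_opENorm _ _) 2

variable [FiniteDimensional ℝ E] [MeasurableSpace E] [BorelSpace E] (μ : Measure E) [μ.IsAddHaarMeasure]

/-- The Jacobian of the substitution is the inverse of `t` to the power of the dimension; keeping
`t` at least 1/2 bounds it. -/
theorem lintegral_comp_smul_add {F : E → ℝ≥0∞} (hF : Measurable F) (c : E) {t : ℝ}
    (ht : 1 / 2 ≤ t) : ∫⁻ y, F (c + t • y) ∂μ ≤ 2 ^ Module.finrank ℝ E * ∫⁻ z, F z ∂μ := by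
  have ht0 : 0 < t := by linarith
  have h1 : ∫⁻ y, F (c + t • y) ∂μ = ∫⁻ z, F (c + z) ∂(μ.map (t • ·)) := by
    exact (lintegral_map (f := fun z => F (c + z)) (hF.comp (measurable_const_add c))
      (measurable_const_smul t)).symm
  rw [h1, Measure.map_addHaar_smul μ ht0.ne', lintegral_smul_measure, lintegral_add_left_eq_self,
    smul_eq_mul]
  refine mul_le_mul_left ?_ _
  rw [abs_of_pos (by positivity), ← ENNReal.ofReal_ofNat 2, ← ENNReal.ofReal_pow (by norm_num)]
  apply ENNReal.ofReal_le_ofReal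
  rw [← inv_pow]
  apply pow_le_pow_left₀ (by positivity)
  rw [inv_le_comm₀ ht0 (by norm_num)]
  linarith

/-- The Poincaré inequality on convex sets, in the form of a double integral. -/
theorem lintegral_lintegral_sq_sub_le {U : Set E} (hU : IsOpen U) (hUc : Convex ℝ U) {L : ℝ≥0∞}
    (hL : ∀ x ∈ U, ∀ y ∈ U, ‖y - x‖ₑ ≤ L) {w : E → ℝ} (hw : ContDiffOn ℝ 1 w U) :
    ∫⁻ x in U, ∫⁻ y in U, ‖w y - w x‖ₑ ^ 2 ∂μ ∂μ ≤
      L ^ 2 * (2 ^ Module.finrank ℝ E * μ U) * ∫⁻ z in U, ‖fderiv ℝ w z‖ₑ ^ 2 ∂μ := by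
  -- Extension by zero lets the inner integral, after the substitution, be bounded by the integral
  -- over the whole space.
  set F : E → ℝ≥0∞ := U.indicator fun z => ‖fderiv ℝ w z‖ₑ ^ 2 with hF
  have hFm : Measurable F := by
    refine Measurable.indicator ?_ hU.measurableSet
    exact (measurable_fderiv ℝ w).enorm.pow_const 2
  have hFint : ∫⁻ z, F z ∂μ = ∫⁻ z in U, ‖fderiv ℝ w z‖ₑ ^ 2 ∂μ :=
    lintegral_indicator hU.measurableSet _
  set I := ∫⁻ z in U, ‖fderiv ℝ w z‖ₑ ^ 2 ∂μ with hI
  have hpt : ∀ x ∈ U, ∀ y ∈ U, ‖w y - w x‖ₑ ^ 2 ≤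
      ∫⁻ t in Icc (0 : ℝ) 1, F ((1 - t) • x + t • y) * L ^ 2 := by
    intro x hx y hy
    refine (enorm_sub_sq_le_lintegral_fderiv hU hUc hw hx hy).trans ?_
    refine setLIntegral_mono_ae (by fun_prop) (.of_forall fun t ht => ?_)
    rw [hF, indicator_of_mem (hUc hx hy (by linarith [ht.2]) ht.1 (by ring))]
    gcongr
    exact hL x hx y hy
  have htriple : ∀ t ∈ Icc (0 : ℝ) 1, ∫⁻ x in U, ∫⁻ y in U, F ((1 - t) • x + t • y) ∂μ ∂μ ≤
      2 ^ Module.finrank ℝ E * μ U * I := by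
    intro t ht
    -- For `t ≥ 1/2` the substitution is made in `y`; for `t ≤ 1/2` exchanging `x` and `y` replaces
    -- `t` by `1 - t`.
    have hcase : ∀ s : ℝ, 1 / 2 ≤ s →
        ∫⁻ x in U, ∫⁻ y in U, F ((1 - s) • x + s • y) ∂μ ∂μ ≤ 2 ^ Module.finrank ℝ E * μ U * I := by
      intro s hs
      calc _ ≤ ∫⁻ x in U, 2 ^ Module.finrank ℝ E * I ∂μ := by
            refine lintegral_mono fun x => ?_
            rw [← hFint]
            exact (setLIntegral_le_lintegral _ _).trans (lintegral_comp_smul_add μ hFm _ hs)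
        _ = _ := by rw [setLIntegral_const]; ring
    rcases le_total (1 / 2) t with h | h
    · exact hcase t h
    · rw [lintegral_lintegral_swap (by fun_prop)]
      refine le_trans (le_of_eq ?_) (hcase (1 - t) (by linarith))
      simp only [sub_sub_cancel]
      refine lintegral_congr fun x => lintegral_congr fun y => ?_
      rw [add_comm]
  calc ∫⁻ x in U, ∫⁻ y in U, ‖w y - w x‖ₑ ^ 2 ∂μ ∂μ
      ≤ ∫⁻ x in U, ∫⁻ y in U, (∫⁻ t in Icc (0 : ℝ) 1, F ((1 - t) • x + t • y) * L ^ 2) ∂μ ∂μ := by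
        refine setLIntegral_mono' hU.measurableSet fun x hx =>
          setLIntegral_mono' hU.measurableSet fun y hy => hpt x hx y hy
    _ = ∫⁻ x in U, (∫⁻ t in Icc (0 : ℝ) 1, (∫⁻ y in U, F ((1 - t) • x + t • y) * L ^ 2 ∂μ)) ∂μ := by
        refine lintegral_congr fun x => lintegral_lintegral_swap (by fun_prop)
    _ = ∫⁻ t in Icc (0 : ℝ) 1, (∫⁻ x in U, ∫⁻ y in U, F ((1 - t) • x + t • y) * L ^ 2 ∂μ ∂μ) := by
        refine lintegral_lintegral_swap (Measurable.aemeasurable ?_)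
        exact Measurable.lintegral_prod_right' (f := fun z : (E × ℝ) × E =>
          F ((1 - z.1.2) • z.1.1 + z.1.2 • z.2) * L ^ 2) (by fun_prop)
    _ ≤ ∫⁻ t in Icc (0 : ℝ) 1, L ^ 2 * (2 ^ Module.finrank ℝ E * μ U) * I := by
        refine setLIntegral_mono' measurableSet_Icc fun t ht => ?_
        have e : ∀ x, ∫⁻ y in U, F ((1 - t) • x + t • y) * L ^ 2 ∂μ =
            (∫⁻ y in U, F ((1 - t) • x + t • y) ∂μ) * L ^ 2 := fun x =>
          lintegral_mul_const _ (by fun_prop)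
        simp only [e]
        rw [lintegral_mul_const _ (Measurable.lintegral_prod_right' (f := fun z : E × E =>
          F ((1 - t) • z.1 + t • z.2)) (by fun_prop)), mul_comm, mul_assoc]
        exact mul_le_mul_right (htriple t ht) _
    _ = _ := by simp

/-- The local Sobolev inequality in dimension four. -/
theorem exists_sobolev_ball (hE : Module.finrank ℝ E = 4) (c : E) {r : ℝ} (hr : 0 < r) :
    ∃ C : ℝ≥0, ∀ (U : Set E) (w : E → ℝ), IsOpen U → closedBall c (2 * r) ⊆ U →
      ContDiffOn ℝ 1 w U →
      (∫⁻ z in ball c r, ‖w z‖ₑ ^ 4 ∂μ) ^ (1 / 2 : ℝ) ≤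
        C * ∫⁻ z in closedBall c (2 * r), (‖fderiv ℝ w z‖ₑ ^ 2 + ‖w z‖ₑ ^ 2) ∂μ := by
  let χ : ContDiffBump c := ⟨r, 2 * r, hr, by linarith⟩
  obtain ⟨L, hL⟩ : ∃ L : ℝ≥0, ∀ z, ‖fderiv ℝ χ z‖ ≤ L := by
    have hc : Continuous (fderiv ℝ χ) := (χ.contDiff (n := 1)).continuous_fderiv (by simp)
    obtain ⟨L, hL⟩ := (χ.hasCompactSupport.fderiv ℝ).exists_bound_of_continuous hc
    exact ⟨⟨max L 0, le_max_right _ _⟩, fun z => (hL z).trans (le_max_left _ _)⟩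
  set K := SNormLESNormFDerivOfEqConst ℝ μ 2
  refine ⟨K ^ 2 * (2 * (1 + L ^ 2)), fun U w hU hsub hw => ?_⟩
  set f : E → ℝ := fun z => χ z * w z with hf
  have hts : tsupport χ = closedBall c (2 * r) := χ.tsupport_eq
  have hout : ∀ z ∉ closedBall c (2 * r), f =ᶠ[nhds z] 0 := by
    intro z hz
    filter_upwards [isClosed_closedBall.isOpen_compl.mem_nhds hz] with y hy
    have : χ y = 0 := image_eq_zero_of_notMem_tsupport (by rwa [hts])
    simp [hf, this]
  have hfc : ContDiff ℝ 1 f := by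
    rw [contDiff_iff_contDiffAt]
    intro z
    by_cases hz : z ∈ closedBall c (2 * r)
    · exact χ.contDiff.contDiffAt.mul (hw.contDiffAt (hU.mem_nhds (hsub hz)))
    · exact contDiffAt_const.congr_of_eventuallyEq (hout z hz)
  have hfs : HasCompactSupport f := χ.hasCompactSupport.mul_right
  -- Gagliardo–Nirenberg–Sobolev for the cut-off function: in dimension four, 1/4 = 1/2 - 1/4.
  have hgns := eLpNorm_le_eLpNorm_fderiv_of_eq μ hfc hfs (p := 2) (p' := 4) (by norm_num)
    (by rw [hE]; norm_num) (by rw [hE]; norm_num)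
  have hfd : ∀ z, ‖fderiv ℝ f z‖ₑ ^ 2 ≤ (closedBall c (2 * r)).indicator
      (fun z => 2 * (1 + (L : ℝ≥0∞) ^ 2) * (‖fderiv ℝ w z‖ₑ ^ 2 + ‖w z‖ₑ ^ 2)) z := by
    intro z
    by_cases hz : z ∈ closedBall c (2 * r)
    · rw [indicator_of_mem hz]
      have hwd : DifferentiableAt ℝ w z :=
        (hw.differentiableOn (by simp)).differentiableAt (hU.mem_nhds (hsub hz))
      have hχd : DifferentiableAt ℝ χ z := χ.contDiffAt.differentiableAt (n := 1) (by simp)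
      have h1 : fderiv ℝ f z = χ z • fderiv ℝ w z + w z • fderiv ℝ χ z := fderiv_mul hχd hwd
      have h2 : ‖fderiv ℝ f z‖ ≤ ‖fderiv ℝ w z‖ + L * ‖w z‖ := by
        rw [h1]
        refine (norm_add_le _ _).trans (add_le_add ?_ ?_)
        · rw [norm_smul, Real.norm_of_nonneg χ.nonneg]
          exact mul_le_of_le_one_left (norm_nonneg _) χ.le_one
        · rw [norm_smul, mul_comm]
          exact mul_le_mul_of_nonneg_right (hL z) (norm_nonneg _)
      have h3 : ‖fderiv ℝ f z‖ ^ 2 ≤ 2 * (1 + (L : ℝ) ^ 2) * (‖fderiv ℝ w z‖ ^ 2 + ‖w z‖ ^ 2) := by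
        have := pow_le_pow_left₀ (norm_nonneg _) h2 2
        nlinarith [sq_nonneg (‖fderiv ℝ w z‖ - L * ‖w z‖), sq_nonneg (L * ‖fderiv ℝ w z‖),
          sq_nonneg ‖w z‖]
      have h4 : ‖fderiv ℝ f z‖₊ ^ 2 ≤ 2 * (1 + L ^ 2) * (‖fderiv ℝ w z‖₊ ^ 2 + ‖w z‖₊ ^ 2) := by
        exact_mod_cast h3
      simp only [enorm_eq_nnnorm]
      exact_mod_cast h4
    · have h0 : fderiv ℝ f z = 0 := by
        rw [(hout z hz).fderiv_eq]
        simp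
      rw [h0, enorm_eq_nnnorm, nnnorm_zero]
      simp
  have e4 : eLpNorm f 4 μ = (∫⁻ z, ‖f z‖ₑ ^ 4 ∂μ) ^ (1 / 4 : ℝ) := by
    rw [eLpNorm_eq_lintegral_rpow_enorm_toReal (by norm_num) (by norm_num)]
    norm_num
  have e2 : eLpNorm (fderiv ℝ f) 2 μ = (∫⁻ z, ‖fderiv ℝ f z‖ₑ ^ 2 ∂μ) ^ (1 / 2 : ℝ) := by
    rw [eLpNorm_eq_lintegral_rpow_enorm_toReal (by norm_num) (by norm_num)]
    norm_num
  have hgns' : (∫⁻ z, ‖f z‖ₑ ^ 4 ∂μ) ^ (1 / 2 : ℝ) ≤ K ^ 2 * ∫⁻ z, ‖fderiv ℝ f z‖ₑ ^ 2 ∂μ := by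
    have h := hgns
    rw [show (((4 : ℝ≥0) : ℝ≥0∞)) = 4 by norm_num, show (((2 : ℝ≥0) : ℝ≥0∞)) = 2 by norm_num,
      e4, e2] at h
    have h' := pow_le_pow_left₀ zero_le h 2
    rw [mul_pow, ← ENNReal.rpow_natCast, ← ENNReal.rpow_mul, ← ENNReal.rpow_natCast (_ ^ (1 / 2 : ℝ)),
      ← ENNReal.rpow_mul] at h'
    norm_num at h' ⊢
    exact h'
  calc (∫⁻ z in ball c r, ‖w z‖ₑ ^ 4 ∂μ) ^ (1 / 2 : ℝ)
      ≤ (∫⁻ z, ‖f z‖ₑ ^ 4 ∂μ) ^ (1 / 2 : ℝ) := by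
        refine ENNReal.rpow_le_rpow ?_ (by norm_num)
        refine le_trans (le_of_eq ?_) (setLIntegral_le_lintegral (ball c r) _)
        refine setLIntegral_congr_fun measurableSet_ball fun z hz => ?_
        have : χ z = 1 := χ.one_of_mem_closedBall (ball_subset_closedBall hz)
        simp [hf, this]
    _ ≤ K ^ 2 * ∫⁻ z, ‖fderiv ℝ f z‖ₑ ^ 2 ∂μ := hgns'
    _ ≤ K ^ 2 * ∫⁻ z in closedBall c (2 * r),
          2 * (1 + (L : ℝ≥0∞) ^ 2) * (‖fderiv ℝ w z‖ₑ ^ 2 + ‖w z‖ₑ ^ 2) ∂μ := by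
        refine mul_le_mul_right ?_ _
        rw [← lintegral_indicator measurableSet_closedBall]
        exact lintegral_mono hfd
    _ = _ := by
        rw [lintegral_const_mul' _ _ (by finiteness), ← mul_assoc]
        push_cast
        ring_nf

/-- Integration by parts against the constant function 1. -/
theorem integral_fderiv_eq_zero_of_hasCompactSupport {Φ : E → ℝ} (hΦ : ContDiff ℝ 1 Φ)
    (hs : HasCompactSupport Φ) (v : E) : ∫ x, fderiv ℝ Φ x v ∂μ = 0 := by
  have hc : Continuous fun x => fderiv ℝ Φ x v :=
    (hΦ.continuous_fderiv (by simp)).clm_apply continuous_const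
  have h := integral_mul_fderiv_eq_neg_fderiv_mul_of_integrable (μ := μ) (f := fun _ : E => (1 : ℝ))
    (g := Φ) (v := v) (by simp)
    (by simpa using hc.integrable_of_hasCompactSupport (hs.fderiv_apply ℝ v))
    (by simpa using hΦ.continuous.integrable_of_hasCompactSupport hs)
    (fun x _ => by fun_prop) (fun x _ => (hΦ.differentiable (by simp)) x)
  simpa using h

end Euclidean

end AlmostKahler

namespace AlmostKahler

/-! ### The volume measure of a top-degree form -/

section VolumeMeasure

open MeasureTheory Set
open scoped ENNReal NNReal

variable {M : Type*} [TopologicalSpace M] [ChartedSpace R4 M]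

/-- The coefficient of `α ∧ β` in the chart centred at `x₀`. -/
noncomputable def wedgeCoeff (α β : Form M 2) (x₀ : M) (y : R4) : ℝ :=
  wedge (α.inChart x₀ y) (β.inChart x₀ y) stdFrame

theorem wedgeCoeff_eq (α β : Form M 2) (x₀ : M) (y : R4) :
    wedgeForm α β ((extChartAt (𝓡 4) x₀).symm y) (fun i => paramDeriv x₀ y (stdFrame i)) =
      wedgeCoeff α β x₀ y :=
  (wedge_comp _ _ (paramDeriv x₀ y) stdFrame).symm

/-- A top-degree form pulls back by the Jacobian determinant, which is the factor in the change of
variables formula. -/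
theorem wedgeCoeff_coordChange [IsManifold (𝓡 4) ∞ M] (α β : Form M 2) {x₀ x₁ : M} {y : R4}
    (hy : y ∈ (extChartAt (𝓡 4) x₁).target)
    (hy' : (extChartAt (𝓡 4) x₁).symm y ∈ (extChartAt (𝓡 4) x₀).source) :
    wedgeCoeff α β x₁ y =
      (fderiv ℝ (coordChange x₀ x₁) y).det * wedgeCoeff α β x₀ (coordChange x₀ x₁ y) := by
  rw [wedgeCoeff, inChart_coordChange α hy hy', inChart_coordChange β hy hy', wedge_comp]
  exact topForm_comp _ (fderiv ℝ (coordChange x₀ x₁) y : R4 →ₗ[ℝ] R4) stdFrame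

variable [MeasurableSpace M]

theorem chartMeasure_wedgeForm (α β : Form M 2) (x₀ : M) :
    chartMeasure (wedgeForm α β) x₀ =
      ((volume.restrict (extChartAt (𝓡 4) x₀).target).withDensity fun y =>
        ENNReal.ofReal |wedgeCoeff α β x₀ y|).map (extChartAt (𝓡 4) x₀).symm := by
  simp only [chartMeasure, wedgeCoeff_eq]

variable [BorelSpace M]

theorem aemeasurable_extChartAt_symm (x₀ : M) {ν : Measure R4}
    (hν : ν ≪ volume.restrict (extChartAt (𝓡 4) x₀).target) :
    AEMeasurable (extChartAt (𝓡 4) x₀).symm ν :=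
  ((continuousOn_extChartAt_symm x₀).aemeasurable
    (isOpen_extChartAt_target x₀).measurableSet).mono_ac hν

theorem measurableSet_target_inter_preimage (x₀ : M) {A : Set M} (hA : MeasurableSet A) :
    MeasurableSet ((extChartAt (𝓡 4) x₀).target ∩ (extChartAt (𝓡 4) x₀).symm ⁻¹' A) := by
  have h := (continuousOn_iff_continuous_domRestrict.1
    (continuousOn_extChartAt_symm (I := 𝓡 4) x₀)).measurable hA
  have h2 := (isOpen_extChartAt_target (I := 𝓡 4) x₀).measurableSet.subtype_image h
  convert h2 using 1
  ext y
  simp [and_comm]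

theorem chartMeasure_apply (α β : Form M 2) (x₀ : M) {A : Set M} (hA : MeasurableSet A) :
    chartMeasure (wedgeForm α β) x₀ A =
      ∫⁻ y in (extChartAt (𝓡 4) x₀).target ∩ (extChartAt (𝓡 4) x₀).symm ⁻¹' A,
        ENNReal.ofReal |wedgeCoeff α β x₀ y| := by
  rw [chartMeasure_wedgeForm, Measure.map_apply_of_aemeasurable
    (aemeasurable_extChartAt_symm x₀ (withDensity_absolutelyContinuous _ _)) hA]
  set T := (extChartAt (𝓡 4) x₀).target with hT
  have hTm : MeasurableSet T := (isOpen_extChartAt_target x₀).measurableSet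
  set ν := (volume.restrict T).withDensity fun y => ENNReal.ofReal |wedgeCoeff α β x₀ y|
  have hν : ν Tᶜ = 0 :=
    withDensity_absolutelyContinuous _ _ (by rw [Measure.restrict_apply hTm.compl]; simp)
  have hm := measurableSet_target_inter_preimage x₀ hA
  have e : ν ((extChartAt (𝓡 4) x₀).symm ⁻¹' A) = ν (T ∩ (extChartAt (𝓡 4) x₀).symm ⁻¹' A) := by
    refine le_antisymm ?_ (measure_mono inter_subset_right)
    calc _ ≤ ν ((T ∩ (extChartAt (𝓡 4) x₀).symm ⁻¹' A) ∪ Tᶜ) := by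
          refine measure_mono fun y hy => ?_
          by_cases h : y ∈ T
          · exact Or.inl ⟨h, hy⟩
          · exact Or.inr h
      _ ≤ _ := (measure_union_le _ _).trans (by rw [hν, add_zero])
  rw [e, withDensity_apply _ hm, Measure.restrict_restrict hm]
  congr 2
  rw [inter_assoc, inter_comm _ T, ← inter_assoc, inter_self]

theorem chartMeasure_compl_source (α β : Form M 2) (x₀ : M) :
    chartMeasure (wedgeForm α β) x₀ (extChartAt (𝓡 4) x₀).sourceᶜ = 0 := by
  rw [chartMeasure_apply _ _ _ (isOpen_extChartAt_source x₀).measurableSet.compl]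
  have : (extChartAt (𝓡 4) x₀).target ∩
      (extChartAt (𝓡 4) x₀).symm ⁻¹' (extChartAt (𝓡 4) x₀).sourceᶜ = ∅ := by
    ext y
    simp only [mem_inter_iff, mem_preimage, mem_compl_iff, mem_empty_iff_false, iff_false, not_and,
      not_not]
    exact fun hy => (extChartAt (𝓡 4) x₀).map_target hy
  rw [this]
  simp

variable [IsManifold (𝓡 4) ∞ M]

/-- The measures `chartMeasure` agree on the overlaps of the charts. -/
theorem chartMeasure_eq_of_subset (α β : Form M 2) {x₀ x₁ : M} {A : Set M} (hA : MeasurableSet A)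
    (h₀ : A ⊆ (extChartAt (𝓡 4) x₀).source) (h₁ : A ⊆ (extChartAt (𝓡 4) x₁).source) :
    chartMeasure (wedgeForm α β) x₀ A = chartMeasure (wedgeForm α β) x₁ A := by
  rw [chartMeasure_apply _ _ _ hA, chartMeasure_apply _ _ _ hA]
  set S₁ := (extChartAt (𝓡 4) x₁).target ∩ (extChartAt (𝓡 4) x₁).symm ⁻¹' A with hS₁
  have hS₁m : MeasurableSet S₁ := measurableSet_target_inter_preimage x₁ hA
  have himg : (extChartAt (𝓡 4) x₀).target ∩ (extChartAt (𝓡 4) x₀).symm ⁻¹' A =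
      coordChange x₀ x₁ '' S₁ := by
    ext z
    constructor
    · rintro ⟨hz, hzA⟩
      refine ⟨extChartAt (𝓡 4) x₁ ((extChartAt (𝓡 4) x₀).symm z),
        ⟨(extChartAt (𝓡 4) x₁).map_source (h₁ hzA), ?_⟩, ?_⟩
      · rw [mem_preimage, (extChartAt (𝓡 4) x₁).left_inv (h₁ hzA)]
        exact hzA
      · rw [coordChange, (extChartAt (𝓡 4) x₁).left_inv (h₁ hzA),
          (extChartAt (𝓡 4) x₀).right_inv hz]
    · rintro ⟨y, ⟨hy, hyA⟩, rfl⟩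
      refine ⟨(extChartAt (𝓡 4) x₀).map_source (h₀ hyA), ?_⟩
      rw [mem_preimage, coordChange, (extChartAt (𝓡 4) x₀).left_inv (h₀ hyA)]
      exact hyA
  have hinj : InjOn (coordChange x₀ x₁) S₁ := by
    rintro y ⟨hy, hyA⟩ z ⟨hz, hzA⟩ hyz
    exact (extChartAt (𝓡 4) x₁).symm.injOn hy hz
      ((extChartAt (𝓡 4) x₀).injOn (h₀ hyA) (h₀ hzA) hyz)
  rw [himg, lintegral_image_eq_lintegral_abs_det_fderiv_mul volume hS₁m
    (fun y hy => ((contDiffAt_coordChange hy.1 (h₀ hy.2)).differentiableAt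
      (by simp)).hasFDerivAt.hasFDerivWithinAt) hinj]
  refine setLIntegral_congr_fun hS₁m fun y hy => ?_
  rw [wedgeCoeff_coordChange α β hy.1 (h₀ hy.2), abs_mul, ENNReal.ofReal_mul (abs_nonneg _)]

variable [CompactSpace M] [Nonempty M]

/-- On the domain of a chart, the measure of a top-degree form is the measure given by its
coefficient in this chart. -/
theorem formMeasure_apply_of_subset (α β : Form M 2) {x₀ : M} {A : Set M} (hA : MeasurableSet A)
    (h₀ : A ⊆ (extChartAt (𝓡 4) x₀).source) :
    formMeasure (wedgeForm α β) A = chartMeasure (wedgeForm α β) x₀ A := by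
  obtain ⟨t, -, ht⟩ := isCompact_univ.elim_nhds_subcover
    (fun x : M => (extChartAt (𝓡 4) x).source) (fun x _ => extChartAt_source_mem_nhds x)
  have htne : (t : Set M).Nonempty := by
    obtain ⟨x⟩ := ‹Nonempty M›
    have := ht (mem_univ x)
    simp only [mem_iUnion] at this
    obtain ⟨i, hi, -⟩ := this
    exact ⟨i, hi⟩
  obtain ⟨c, hc⟩ := t.countable_toSet.exists_eq_range htne
  set s : ℕ → Set M := fun i => (extChartAt (𝓡 4) (c i)).source
  have hs : ∀ i, MeasurableSet (s i) := fun i => (isOpen_extChartAt_source (c i)).measurableSet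
  have hcover : ⋃ i, s i = univ := by
    refine eq_univ_of_forall fun x => ?_
    have := ht (mem_univ x)
    simp only [mem_iUnion] at this
    obtain ⟨i, hi, hx⟩ := this
    have hi' : i ∈ range c := by rw [← hc]; exact hi
    obtain ⟨j, rfl⟩ := hi'
    exact mem_iUnion.2 ⟨j, hx⟩
  set D := disjointed s
  have hD : ∀ i, MeasurableSet (D i) := fun i => MeasurableSet.disjointed hs i
  have hDs : ∀ i, D i ⊆ s i := disjointed_subset s
  have hDu : ⋃ i, D i = univ := (iUnion_disjointed (f := s)).trans hcover
  have hsplit : ∀ (ν : Measure M) {B : Set M}, MeasurableSet B → ν B = ∑' i, ν (B ∩ D i) := by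
    intro ν B hB
    rw [← measure_iUnion (fun i j hij => (disjoint_disjointed s hij).mono inter_subset_right
      inter_subset_right) (fun i => hB.inter (hD i)), ← inter_iUnion, hDu, inter_univ]
  set m := chartMeasure (wedgeForm α β)
  -- A measure glued from the chart measures on disjoint pieces of a finite chart cover. It agrees
  -- with each chart measure on the domain of that chart, so it is an upper bound for the supremum
  -- defining `formMeasure`.
  set μ : Measure M := Measure.sum fun i => (m (c i)).restrict (D i) with hμ
  have hμA : ∀ {x₀ : M} {A : Set M}, MeasurableSet A → A ⊆ (extChartAt (𝓡 4) x₀).source →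
      μ A = m x₀ A := by
    intro x₀ A hA h₀
    rw [hμ, Measure.sum_apply _ hA, hsplit (m x₀) hA]
    refine tsum_congr fun i => ?_
    rw [Measure.restrict_apply hA]
    exact chartMeasure_eq_of_subset α β (hA.inter (hD i)) (inter_subset_right.trans (hDs i))
      (inter_subset_left.trans h₀)
  have hle : formMeasure (wedgeForm α β) ≤ μ := by
    refine iSup_le fun x => Measure.le_iff.2 fun B hB => ?_
    have hS := (isOpen_extChartAt_source (I := 𝓡 4) x).measurableSet
    calc m x B ≤ m x (B ∩ (extChartAt (𝓡 4) x).source) + m x (extChartAt (𝓡 4) x).sourceᶜ := by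
          refine (measure_mono fun z hz => ?_).trans (measure_union_le _ _)
          by_cases h : z ∈ (extChartAt (𝓡 4) x).source
          · exact Or.inl ⟨hz, h⟩
          · exact Or.inr h
      _ = μ (B ∩ (extChartAt (𝓡 4) x).source) := by
          rw [chartMeasure_compl_source, add_zero, hμA (hB.inter hS) inter_subset_right]
      _ ≤ μ B := measure_mono inter_subset_left
  refine le_antisymm ?_ (Measure.le_iff'.1 (le_iSup m x₀) A)
  exact (hle A).trans_eq (hμA hA h₀)


end VolumeMeasure

end AlmostKahler

namespace AlmostKahler

/-! ### Chart expressions and comparison with Euclidean geometry -/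

section ChartComputations

open MeasureTheory Set Metric
open scoped ENNReal NNReal

variable {M : Type*} [TopologicalSpace M] [ChartedSpace R4 M]

/-- The differential of a function, as a linear functional on the model space `ℝ⁴`. -/
noncomputable def differential (w : M → ℝ) (x : M) : R4 →L[ℝ] ℝ :=
  mfderiv (𝓡 4) 𝓘(ℝ, ℝ) w x

/-- The differential of the inverse of a chart, as an endomorphism of the model space. -/
noncomputable def paramMap (x₀ : M) (y : R4) : R4 →L[ℝ] R4 := paramDeriv x₀ y

/-- The differential of a chart, as an endomorphism of the model space. -/
noncomputable def chartMap (x₀ x : M) : R4 →L[ℝ] R4 := chartDeriv x₀ x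

theorem IsSmoothForm.contDiffOn_apply {k : ℕ} {α : Form M k} (h : IsSmoothForm α) (x₀ : M)
    (v : Fin k → R4) :
    ContDiffOn ℝ ∞ (fun y => α.inChart x₀ y v) (extChartAt (𝓡 4) x₀).target :=
  (ContinuousAlternatingMap.apply ℝ R4 ℝ v).contDiff.comp_contDiffOn (h x₀)

theorem contDiffOn_wedgeCoeff {α β : Form M 2} (hα : IsSmoothForm α) (hβ : IsSmoothForm β)
    (x₀ : M) : ContDiffOn ℝ ∞ (wedgeCoeff α β x₀) (extChartAt (𝓡 4) x₀).target := by
  have a := fun i j : Fin 4 => hα.contDiffOn_apply x₀ ![stdFrame i, stdFrame j]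
  have b := fun i j : Fin 4 => hβ.contDiffOn_apply x₀ ![stdFrame i, stdFrame j]
  refine ContDiffOn.congr (f := fun y => _) ?_ fun y _ => wedge_apply _ _ stdFrame
  exact ((((((a 0 1).mul (b 2 3)).sub ((a 0 2).mul (b 1 3))).add ((a 0 3).mul (b 1 2))).add
    ((a 1 2).mul (b 0 3))).sub ((a 1 3).mul (b 0 2))).add ((a 2 3).mul (b 0 1))

/-- Each tangent space is `ℝ⁴` itself, so the coordinate frame and the standard frame differ by
`paramMap`. The determinant cancels in quotients, which makes `ratio` independent of the chart. -/
theorem wedgeForm_apply_eq (α β : Form M 2) (x₀ : M) (y : R4) :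
    wedgeCoeff α β x₀ y = LinearMap.det (paramMap x₀ y : R4 →ₗ[ℝ] R4) *
      wedgeForm α β ((extChartAt (𝓡 4) x₀).symm y) stdFrame := by
  rw [← wedgeCoeff_eq]
  exact topForm_comp (wedgeForm α β ((extChartAt (𝓡 4) x₀).symm y))
    (paramMap x₀ y : R4 →ₗ[ℝ] R4) stdFrame

theorem continuous_of_charts {f : M → ℝ} (h : ∀ x₀ : M, ContinuousOn
    (fun y => f ((extChartAt (𝓡 4) x₀).symm y)) (extChartAt (𝓡 4) x₀).target) : Continuous f := by
  refine continuous_iff_continuousAt.2 fun x => ?_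
  have h1 : ContinuousAt (fun z => f ((extChartAt (𝓡 4) x).symm (extChartAt (𝓡 4) x z))) x :=
    ContinuousAt.comp (f := extChartAt (𝓡 4) x)
      (g := fun y => f ((extChartAt (𝓡 4) x).symm y))
      ((h x).continuousAt (extChartAt_target_mem_nhds x)) (continuousAt_extChartAt x)
  refine h1.congr ?_
  filter_upwards [extChartAt_source_mem_nhds (I := 𝓡 4) x] with z hz
  rw [(extChartAt (𝓡 4) x).left_inv hz]

theorem IsAlmostKahlerForm.linearAlmostKahler {J : EndField M}
    {Ω : Form M 2} (hΩ : IsAlmostKahlerForm J Ω) (x : M) :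
    LinearAlmostKahler (J x) (Ω x) :=
  ⟨hΩ.compatible x, hΩ.pos x⟩

theorem aemeasurable_wedgeCoeff {Ω : Form M 2} (hΩ : IsSmoothForm Ω) (x₀ : M) :
    AEMeasurable (fun y => ENNReal.ofReal |wedgeCoeff Ω Ω x₀ y|)
      (volume.restrict (extChartAt (𝓡 4) x₀).target) :=
  ((contDiffOn_wedgeCoeff hΩ hΩ x₀).continuousOn.abs.aemeasurable
    (isOpen_extChartAt_target x₀).measurableSet).ennreal_ofReal

/-- The part of `M` which corresponds to the subset `V` of `ℝ⁴` in the chart centred at `x₀`. -/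
def chartSet (x₀ : M) (V : Set R4) : Set M :=
  (extChartAt (𝓡 4) x₀).source ∩ extChartAt (𝓡 4) x₀ ⁻¹' V

theorem isOpen_chartSet (x₀ : M) {V : Set R4} (hV : IsOpen V) : IsOpen (chartSet x₀ V) :=
  isOpen_extChartAt_preimage' x₀ hV

theorem measurableSet_chartSet [MeasurableSpace M] [BorelSpace M] (x₀ : M) {V : Set R4} (hV : MeasurableSet V) :
    MeasurableSet (chartSet x₀ V) := by
  have h := (continuousOn_iff_continuous_domRestrict.1
    (continuousOn_extChartAt (I := 𝓡 4) x₀)).measurable hV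
  have h2 := (isOpen_extChartAt_source (I := 𝓡 4) x₀).measurableSet.subtype_image h
  convert h2 using 1
  ext y
  simp [chartSet, and_comm]

theorem chartSet_ball_mem_nhds (x₀ : M) {r : ℝ}
    (hr : 0 < r) : chartSet x₀ (ball (extChartAt (𝓡 4) x₀ x₀) r) ∈ nhds x₀ :=
  (isOpen_chartSet x₀ isOpen_ball).mem_nhds
    ⟨mem_extChartAt_source x₀, mem_ball_self hr⟩

theorem IsAlmostKahlerForm.wedge_ne_zero {J : EndField M}
    {Ω : Form M 2} (hJ : IsAlmostComplex J) (hΩ : IsAlmostKahlerForm J Ω)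
    (x : M) : wedgeForm Ω Ω x stdFrame ≠ 0 :=
  (hΩ.linearAlmostKahler x).wedge_self_ne_zero (hJ.sq_eq_neg x)

variable [IsManifold (𝓡 4) ∞ M]

theorem det_paramDeriv_ne_zero {x₀ : M} {y : R4} (hy : y ∈ (extChartAt (𝓡 4) x₀).target) :
    LinearMap.det (paramMap x₀ y : R4 →ₗ[ℝ] R4) ≠ 0 := by
  have h := congrArg (fun A : R4 →L[ℝ] R4 => LinearMap.det (A : R4 →ₗ[ℝ] R4))
    (chartDeriv_comp_paramDeriv hy)
  have h2 : LinearMap.det (chartMap x₀ ((extChartAt (𝓡 4) x₀).symm y) : R4 →ₗ[ℝ] R4) *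
      LinearMap.det (paramMap x₀ y : R4 →ₗ[ℝ] R4) = 1 := by
    rw [← LinearMap.det_comp]
    refine Eq.trans h ?_
    simp
  intro h0
  rw [h0, mul_zero] at h2
  exact zero_ne_one h2

/-- The quotient of two top-degree forms is the quotient of their coefficients in a chart. -/
theorem ratio_symm (α β γ δ : Form M 2) {x₀ : M} {y : R4}
    (hy : y ∈ (extChartAt (𝓡 4) x₀).target) :
    ratio (wedgeForm α β) (wedgeForm γ δ) ((extChartAt (𝓡 4) x₀).symm y) =
      wedgeCoeff α β x₀ y / wedgeCoeff γ δ x₀ y := by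
  rw [wedgeForm_apply_eq, wedgeForm_apply_eq, mul_div_mul_left _ _ (det_paramDeriv_ne_zero hy)]
  rfl

theorem wedgeCoeff_ne_zero {Ω : Form M 2} (hne : ∀ x, wedgeForm Ω Ω x stdFrame ≠ 0) {x₀ : M}
    {y : R4} (hy : y ∈ (extChartAt (𝓡 4) x₀).target) : wedgeCoeff Ω Ω x₀ y ≠ 0 := by
  rw [wedgeForm_apply_eq]
  exact mul_ne_zero (det_paramDeriv_ne_zero hy) (hne _)

theorem continuous_ratio {α β Ω : Form M 2} (hα : IsSmoothForm α) (hβ : IsSmoothForm β)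
    (hΩ : IsSmoothForm Ω) (hne : ∀ x, wedgeForm Ω Ω x stdFrame ≠ 0) :
    Continuous (ratio (wedgeForm α β) (wedgeForm Ω Ω)) := by
  refine continuous_of_charts fun x₀ => ?_
  refine ContinuousOn.congr (f := fun y => wedgeCoeff α β x₀ y / wedgeCoeff Ω Ω x₀ y) ?_
    fun y hy => ratio_symm α β Ω Ω hy
  exact (contDiffOn_wedgeCoeff hα hβ x₀).continuousOn.div
    (contDiffOn_wedgeCoeff hΩ hΩ x₀).continuousOn fun y hy => wedgeCoeff_ne_zero hne hy

theorem fderiv_comp_symm {w : M → ℝ} {x₀ : M} {y : R4} (hy : y ∈ (extChartAt (𝓡 4) x₀).target)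
    (hw : MDifferentiableAt (𝓡 4) 𝓘(ℝ, ℝ) w ((extChartAt (𝓡 4) x₀).symm y)) :
    fderiv ℝ (fun z => w ((extChartAt (𝓡 4) x₀).symm z)) y =
      (differential w ((extChartAt (𝓡 4) x₀).symm y)).comp
        (paramDeriv x₀ y : R4 →L[ℝ] R4) := by
  rw [← mfderiv_eq_fderiv]
  exact mfderiv_comp y hw (mdifferentiableAt_extChartAt_symm' hy)

theorem contDiffOn_comp_symm {n : WithTop ℕ∞} (hn : n ≤ ((⊤ : ℕ∞) : WithTop ℕ∞)) {w : M → ℝ}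
    (hw : ContMDiff (𝓡 4) 𝓘(ℝ, ℝ) n w) (x₀ : M) :
    ContDiffOn ℝ n (fun z => w ((extChartAt (𝓡 4) x₀).symm z)) (extChartAt (𝓡 4) x₀).target := by
  rw [← contMDiffOn_iff_contDiffOn]
  have : IsManifold (𝓡 4) n M := IsManifold.of_le (n := ∞) hn
  exact hw.comp_contMDiffOn (contMDiffOn_extChartAt_symm x₀)

/-- The expression of a field of endomorphisms in a chart. -/
noncomputable def EndField.inChart (J : EndField M) (x₀ : M) (y : R4) : R4 →L[ℝ] R4 :=
  (chartDeriv x₀ ((extChartAt (𝓡 4) x₀).symm y)).comp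
    ((J ((extChartAt (𝓡 4) x₀).symm y)).comp (paramDeriv x₀ y))

theorem paramDeriv_endField_inChart (J : EndField M) {x₀ : M} {y : R4}
    (hy : y ∈ (extChartAt (𝓡 4) x₀).target) (v : R4) :
    paramDeriv x₀ y (J.inChart x₀ y v) =
      J ((extChartAt (𝓡 4) x₀).symm y) (paramDeriv x₀ y v) :=
  congrArg (fun A : R4 →L[ℝ] R4 => A (J ((extChartAt (𝓡 4) x₀).symm y) (paramDeriv x₀ y v)))
    (paramDeriv_comp_chartDeriv hy)

variable {J : EndField M} {Ω : Form M 2}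

/-- The square of the norm of the differential of `w`, with respect to the metric `Ω(·, J·)`, is
at most `q`. -/
structure EnergyBound (J : EndField M) (Ω : Form M 2) (w q : M → ℝ) : Prop where
  contMDiff : ContMDiff (𝓡 4) 𝓘(ℝ, ℝ) 1 w
  continuous : Continuous q
  nonneg : ∀ x, 0 ≤ q x
  sq_le : ∀ (x : M) (v : R4), differential w x v ^ 2 ≤ q x * Ω x ![v, J x v]

/-- A ball in a chart on which the volume density of `Ω ∧ Ω` and the metric `Ω(·, J·)` are
comparable to the Euclidean ones. -/
theorem exists_comparable_ball (hJ : IsAlmostComplex J) (hΩ : IsAlmostKahlerForm J Ω) (x₀ : M) :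
    ∃ R : ℝ, 0 < R ∧ ∃ c : ℝ≥0,
      closedBall (extChartAt (𝓡 4) x₀ x₀) R ⊆ (extChartAt (𝓡 4) x₀).target ∧
      (∀ y ∈ closedBall (extChartAt (𝓡 4) x₀ x₀) R,
        ENNReal.ofReal |wedgeCoeff Ω Ω x₀ y| ≤ c) ∧
      (∀ y ∈ closedBall (extChartAt (𝓡 4) x₀ x₀) R,
        1 ≤ c * ENNReal.ofReal |wedgeCoeff Ω Ω x₀ y|) ∧
      ∀ w q, EnergyBound J Ω w q → ∀ y ∈ closedBall (extChartAt (𝓡 4) x₀ x₀) R,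
        ‖fderiv ℝ (fun z => w ((extChartAt (𝓡 4) x₀).symm z)) y‖ₑ ^ 2 ≤
          c * ENNReal.ofReal (q ((extChartAt (𝓡 4) x₀).symm y)) := by
  obtain ⟨R, hR, hsub⟩ := nhds_basis_closedBall.mem_iff.1 (extChartAt_target_mem_nhds (I := 𝓡 4) x₀)
  have hK : IsCompact (closedBall (extChartAt (𝓡 4) x₀ x₀) R) := isCompact_closedBall _ _
  have hc : ContinuousOn (wedgeCoeff Ω Ω x₀) (closedBall (extChartAt (𝓡 4) x₀ x₀) R) :=
    (contDiffOn_wedgeCoeff hΩ.smooth hΩ.smooth x₀).continuousOn.mono hsub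
  have hne : ∀ y ∈ closedBall (extChartAt (𝓡 4) x₀ x₀) R, wedgeCoeff Ω Ω x₀ y ≠ 0 := fun y hy =>
    wedgeCoeff_ne_zero (hΩ.wedge_ne_zero hJ) (hsub hy)
  obtain ⟨c₁, hc₁⟩ := hK.exists_bound_of_continuousOn hc
  obtain ⟨c₂, hc₂⟩ := hK.exists_bound_of_continuousOn (hc.inv₀ hne)
  obtain ⟨c₃, hc₃⟩ := hK.exists_bound_of_continuousOn ((hΩ.smooth x₀).continuousOn.mono hsub)
  obtain ⟨c₄, hc₄⟩ := hK.exists_bound_of_continuousOn ((hJ.smooth x₀).continuousOn.mono hsub)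
  have hc₃0 : 0 ≤ c₃ := (norm_nonneg _).trans (hc₃ _ (mem_closedBall_self hR.le))
  have hc₄0 : 0 ≤ c₄ := (norm_nonneg _).trans (hc₄ _ (mem_closedBall_self hR.le))
  -- One constant for the density, its inverse, and the bound of the metric `Ω(v, Jv)` by the
  -- Euclidean one; the last turns control of `dw` in the metric into control of its Euclidean norm.
  set c : ℝ := max (max c₁ c₂) (c₃ * c₄) with hcdef
  have hc0 : 0 ≤ c := le_max_of_le_right (by positivity)
  refine ⟨R, hR, c.toNNReal, hsub, fun y hy => ?_, fun y hy => ?_, fun w q h y hy => ?_⟩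
  · change _ ≤ ENNReal.ofReal c
    exact ENNReal.ofReal_le_ofReal
      ((hc₁ y hy).trans ((le_max_left _ _).trans (le_max_left _ _)))
  · change 1 ≤ ENNReal.ofReal c * _
    rw [← ENNReal.ofReal_mul hc0, ← ENNReal.ofReal_one]
    apply ENNReal.ofReal_le_ofReal
    have h1 : |wedgeCoeff Ω Ω x₀ y|⁻¹ ≤ c := by
      rw [← abs_inv]
      exact (hc₂ y hy).trans ((le_max_right _ _).trans (le_max_left _ _))
    rw [← inv_mul_cancel₀ (abs_ne_zero.2 (hne y hy))]
    exact mul_le_mul_of_nonneg_right h1 (abs_nonneg _)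
  · set p := (extChartAt (𝓡 4) x₀).symm y with hp
    have hq := h.nonneg p
    have key : ∀ v : R4, (fderiv ℝ (fun z => w ((extChartAt (𝓡 4) x₀).symm z)) y v) ^ 2 ≤
        c * q p * ‖v‖ ^ 2 := by
      intro v
      rw [fderiv_comp_symm (hsub hy) (h.contMDiff.mdifferentiable (by simp) _)]
      have h1 := h.sq_le p (paramDeriv x₀ y v)
      have h2 : Ω p ![paramDeriv x₀ y v, J p (paramDeriv x₀ y v)] =
          Ω.inChart x₀ y ![v, J.inChart x₀ y v] := by
        rw [← paramDeriv_endField_inChart J (hsub hy)]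
        refine congrArg (Ω p) ?_
        funext i
        fin_cases i <;> rfl
      have h3 : Ω.inChart x₀ y ![v, J.inChart x₀ y v] ≤ c * ‖v‖ ^ 2 := by
        have a1 := (le_abs_self _).trans ((Ω.inChart x₀ y).le_opNorm ![v, J.inChart x₀ y v])
        rw [Fin.prod_univ_two] at a1
        simp only [Matrix.cons_val_zero, Matrix.cons_val_one] at a1
        have a2 : ‖J.inChart x₀ y v‖ ≤ c₄ * ‖v‖ :=
          ((J.inChart x₀ y).le_opNorm v).trans
            (mul_le_mul_of_nonneg_right (hc₄ y hy) (norm_nonneg _))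
        calc _ ≤ _ := a1
          _ ≤ c₃ * (‖v‖ * (c₄ * ‖v‖)) := by
            gcongr
            exact hc₃ y hy
          _ = c₃ * c₄ * ‖v‖ ^ 2 := by ring
          _ ≤ c * ‖v‖ ^ 2 := by
            gcongr
            exact le_max_right _ _
      calc _ ≤ q p * Ω p ![paramDeriv x₀ y v, J p (paramDeriv x₀ y v)] := h1
        _ ≤ q p * (c * ‖v‖ ^ 2) := by
          rw [h2]
          exact mul_le_mul_of_nonneg_left h3 hq
        _ = _ := by ring
    have hn : ‖fderiv ℝ (fun z => w ((extChartAt (𝓡 4) x₀).symm z)) y‖ ≤ Real.sqrt (c * q p) := by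
      refine ContinuousLinearMap.opNorm_le_bound _ (Real.sqrt_nonneg _) fun v => ?_
      rw [Real.norm_eq_abs, ← Real.sqrt_sq (norm_nonneg v), ← Real.sqrt_mul (by positivity)]
      exact Real.abs_le_sqrt (key v)
    change _ ≤ ENNReal.ofReal c * _
    rw [← ENNReal.ofReal_mul hc0, ← ofReal_norm,
      ← ENNReal.ofReal_pow (norm_nonneg _)]
    apply ENNReal.ofReal_le_ofReal
    rw [← Real.sq_sqrt (show 0 ≤ c * q p by positivity)]
    exact pow_le_pow_left₀ (norm_nonneg _) hn 2

variable [MeasurableSpace M] [BorelSpace M] [CompactSpace M] [Nonempty M]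

theorem restrict_formMeasure (α β : Form M 2) (x₀ : M) :
    (formMeasure (wedgeForm α β)).restrict (extChartAt (𝓡 4) x₀).source =
      ((volume.restrict (extChartAt (𝓡 4) x₀).target).withDensity fun y =>
        ENNReal.ofReal |wedgeCoeff α β x₀ y|).map (extChartAt (𝓡 4) x₀).symm := by
  have hS := (isOpen_extChartAt_source (I := 𝓡 4) x₀).measurableSet
  rw [← chartMeasure_wedgeForm]
  ext A hA
  rw [Measure.restrict_apply hA, formMeasure_apply_of_subset α β (hA.inter hS) inter_subset_right]
  refine le_antisymm (measure_mono inter_subset_left) ?_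
  calc _ ≤ chartMeasure (wedgeForm α β) x₀ (A ∩ (extChartAt (𝓡 4) x₀).source) +
        chartMeasure (wedgeForm α β) x₀ (extChartAt (𝓡 4) x₀).sourceᶜ := by
        refine (measure_mono fun z hz => ?_).trans (measure_union_le _ _)
        by_cases h : z ∈ (extChartAt (𝓡 4) x₀).source
        · exact Or.inl ⟨hz, h⟩
        · exact Or.inr h
    _ = _ := by rw [chartMeasure_compl_source, add_zero]

theorem lintegral_chartSet (hΩ : IsSmoothForm Ω) (x₀ : M) {V : Set R4} (hV : MeasurableSet V)
    (hVt : V ⊆ (extChartAt (𝓡 4) x₀).target) {F : M → ℝ≥0∞} (hF : Measurable F) :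
    ∫⁻ x in chartSet x₀ V, F x ∂(formMeasure (wedgeForm Ω Ω)) =
      ∫⁻ y in V, ENNReal.ofReal |wedgeCoeff Ω Ω x₀ y| * F ((extChartAt (𝓡 4) x₀).symm y) := by
  set T := (extChartAt (𝓡 4) x₀).target with hT
  have hTm : MeasurableSet T := (isOpen_extChartAt_target x₀).measurableSet
  have hm := measurableSet_chartSet x₀ hV
  have h1 : ∫⁻ x in chartSet x₀ V, F x ∂(formMeasure (wedgeForm Ω Ω)) =
      ∫⁻ x, (chartSet x₀ V).indicator F x ∂((formMeasure (wedgeForm Ω Ω)).restrict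
        (extChartAt (𝓡 4) x₀).source) := by
    rw [lintegral_indicator hm, Measure.restrict_restrict hm,
      inter_eq_self_of_subset_left (show chartSet x₀ V ⊆ _ from inter_subset_left)]
  have hac := withDensity_absolutelyContinuous (volume.restrict T)
    fun y => ENNReal.ofReal |wedgeCoeff Ω Ω x₀ y|
  have hsm := aemeasurable_extChartAt_symm x₀ (Measure.AbsolutelyContinuous.refl _)
  rw [h1, restrict_formMeasure, lintegral_map' (hF.indicator hm).aemeasurable (hsm.mono_ac hac)]
  refine (lintegral_withDensity_eq_lintegral_mul₀ (aemeasurable_wedgeCoeff hΩ x₀)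
      ((hF.indicator hm).comp_aemeasurable hsm)).trans ?_
  have h2 : ∫⁻ y in V, ENNReal.ofReal |wedgeCoeff Ω Ω x₀ y| * F ((extChartAt (𝓡 4) x₀).symm y) =
      ∫⁻ y in T, V.indicator (fun y =>
        ENNReal.ofReal |wedgeCoeff Ω Ω x₀ y| * F ((extChartAt (𝓡 4) x₀).symm y)) y := by
    rw [lintegral_indicator hV, Measure.restrict_restrict hV, inter_eq_self_of_subset_left hVt]
  rw [h2]
  refine setLIntegral_congr_fun hTm fun y hy => ?_
  have hiff : (extChartAt (𝓡 4) x₀).symm y ∈ chartSet x₀ V ↔ y ∈ V := by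
    simp only [chartSet, mem_inter_iff, mem_preimage, (extChartAt (𝓡 4) x₀).right_inv hy]
    exact ⟨fun h => h.2, fun h => ⟨(extChartAt (𝓡 4) x₀).map_target hy, h⟩⟩
  simp only [Pi.mul_apply, Function.comp_apply]
  by_cases h : y ∈ V
  · rw [indicator_of_mem (hiff.2 h), indicator_of_mem h]
  · rw [indicator_of_notMem (fun h' => h (hiff.1 h')), indicator_of_notMem h, mul_zero]

/-- Integration of functions supported in the domain of a chart. -/
theorem integral_eq_integral_chart (hΩ : IsSmoothForm Ω) (x₀ : M) {f : M → ℝ}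
    (hf : Continuous f) (hfs : ∀ x ∉ (extChartAt (𝓡 4) x₀).source, f x = 0) :
    ∫ x, f x ∂(formMeasure (wedgeForm Ω Ω)) =
      ∫ y in (extChartAt (𝓡 4) x₀).target,
        |wedgeCoeff Ω Ω x₀ y| * f ((extChartAt (𝓡 4) x₀).symm y) := by
  have hac := withDensity_absolutelyContinuous
    (volume.restrict (extChartAt (𝓡 4) x₀).target) fun y => ENNReal.ofReal |wedgeCoeff Ω Ω x₀ y|
  rw [← setIntegral_eq_integral_of_forall_compl_eq_zero hfs, restrict_formMeasure,
    integral_map (aemeasurable_extChartAt_symm x₀ hac) hf.measurable.aestronglyMeasurable,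
    integral_withDensity_eq_integral_toReal_smul₀ (aemeasurable_wedgeCoeff hΩ x₀)
      (.of_forall fun y => ENNReal.ofReal_lt_top)]
  simp only [ENNReal.toReal_ofReal (abs_nonneg _), smul_eq_mul]

theorem isFiniteMeasure_formMeasure (hJ : IsAlmostComplex J) (hΩ : IsAlmostKahlerForm J Ω) :
    IsFiniteMeasure (formMeasure (wedgeForm Ω Ω)) := by
  constructor
  refine isCompact_univ.measure_lt_top_of_nhdsWithin fun x₀ _ => ?_
  rw [nhdsWithin_univ]
  obtain ⟨R, hR, c, hsub, hc, -⟩ := exists_comparable_ball hJ hΩ x₀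
  refine ⟨_, chartSet_ball_mem_nhds x₀ hR, ?_⟩
  have h := lintegral_chartSet hΩ.smooth x₀ measurableSet_ball (ball_subset_closedBall.trans hsub)
    (F := fun _ => 1) measurable_const
  simp only [setLIntegral_one, mul_one] at h
  rw [h]
  calc _ ≤ ∫⁻ _ in ball (extChartAt (𝓡 4) x₀ x₀) R, (c : ℝ≥0∞) :=
        setLIntegral_mono' measurableSet_ball fun y hy => hc y (ball_subset_closedBall hy)
    _ < ⊤ := by
        rw [setLIntegral_const]
        exact ENNReal.mul_lt_top ENNReal.coe_lt_top measure_ball_lt_top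

/-- The density vanishes nowhere in a chart. Positivity on open sets serves twice: to chain Poincaré
inequalities through overlaps, and to conclude that a null open superlevel set is empty. -/
theorem isOpenPosMeasure_formMeasure (hJ : IsAlmostComplex J) (hΩ : IsAlmostKahlerForm J Ω) :
    (formMeasure (wedgeForm Ω Ω)).IsOpenPosMeasure := by
  constructor
  rintro U hU ⟨x₀, hx₀⟩ h0
  set V := (extChartAt (𝓡 4) x₀).target ∩ (extChartAt (𝓡 4) x₀).symm ⁻¹' U with hV
  have hVo : IsOpen V :=
    (continuousOn_extChartAt_symm x₀).isOpen_inter_preimage (isOpen_extChartAt_target x₀) hU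
  have hVne : V.Nonempty := ⟨extChartAt (𝓡 4) x₀ x₀, mem_extChartAt_target x₀, by
    rw [mem_preimage, extChartAt_to_inv]; exact hx₀⟩
  have h := lintegral_chartSet hΩ.smooth x₀ hVo.measurableSet inter_subset_left
    (F := fun _ => 1) measurable_const
  simp only [setLIntegral_one, mul_one] at h
  have hsub : chartSet x₀ V ⊆ U := by
    rintro x ⟨hx, -, hx'⟩
    rwa [mem_preimage, (extChartAt (𝓡 4) x₀).left_inv hx] at hx'
  rw [measure_mono_null hsub h0] at h
  have h2 := (lintegral_eq_zero_iff' ((aemeasurable_wedgeCoeff hΩ.smooth x₀).mono_measure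
    (Measure.restrict_mono inter_subset_left le_rfl))).1 h.symm
  have h3 : ∀ᵐ y ∂(volume.restrict V), False := by
    filter_upwards [h2, ae_restrict_mem hVo.measurableSet] with y hy hyV
    simp only [Pi.zero_apply, ENNReal.ofReal_eq_zero] at hy
    exact wedgeCoeff_ne_zero (hΩ.wedge_ne_zero hJ) hyV.1 (abs_nonpos_iff.1 hy)
  rw [Filter.eventually_false_iff_eq_bot, ae_eq_bot, Measure.restrict_eq_zero] at h3
  exact (hVo.measure_pos volume hVne).ne' h3

end ChartComputations

end AlmostKahler

namespace AlmostKahler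

/-! ### Sobolev and Poincaré inequalities on the manifold -/

section SobolevPoincare

open MeasureTheory Set Metric
open scoped ENNReal NNReal

variable {M : Type*} [TopologicalSpace M] [ChartedSpace R4 M] [MeasurableSpace M]
  {J : EndField M} {Ω : Form M 2}

/-- The Poincaré inequality holds for the pair of sets `U`, `V`. -/
def PoincarePair (J : EndField M) (Ω : Form M 2) (U V : Set M) : Prop :=
  ∃ C : ℝ≥0, ∀ w q, EnergyBound J Ω w q →
    ∫⁻ x in U, ∫⁻ y in V, ‖w y - w x‖ₑ ^ 2 ∂(formMeasure (wedgeForm Ω Ω))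
      ∂(formMeasure (wedgeForm Ω Ω)) ≤
        C * ∫⁻ x, ENNReal.ofReal (q x) ∂(formMeasure (wedgeForm Ω Ω))

theorem PoincarePair.mono {U V U' V' : Set M} (h : PoincarePair J Ω U V) (hU : U' ⊆ U)
    (hV : V' ⊆ V) : PoincarePair J Ω U' V' := by
  obtain ⟨C, hC⟩ := h
  refine ⟨C, fun w q hwq => le_trans ?_ (hC w q hwq)⟩
  exact (lintegral_mono_set hU).trans (lintegral_mono fun x => lintegral_mono_set hV)

theorem PoincarePair.union_left {U U' V : Set M} (h : PoincarePair J Ω U V)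
    (h' : PoincarePair J Ω U' V) : PoincarePair J Ω (U ∪ U') V := by
  obtain ⟨C, hC⟩ := h
  obtain ⟨C', hC'⟩ := h'
  refine ⟨C + C', fun w q hwq => ?_⟩
  push_cast
  rw [add_mul]
  exact (lintegral_union_le _ U U').trans (add_le_add (hC w q hwq) (hC' w q hwq))

variable [BorelSpace M]

theorem EnergyBound.measurable {w q : M → ℝ} (h : EnergyBound J Ω w q) : Measurable w :=
  h.contMDiff.continuous.measurable

theorem measurable_sq_sub {w q : M → ℝ} (h : EnergyBound J Ω w q) :
    Measurable fun z : M × M => ‖w z.2 - w z.1‖ₑ ^ 2 :=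
  (((h.measurable.comp measurable_snd).sub (h.measurable.comp measurable_fst)).enorm).pow_const 2

theorem PoincarePair.symm [SFinite (formMeasure (wedgeForm Ω Ω))] {U V : Set M}
    (h : PoincarePair J Ω U V) : PoincarePair J Ω V U := by
  obtain ⟨C, hC⟩ := h
  refine ⟨C, fun w q hwq => le_trans (le_of_eq ?_) (hC w q hwq)⟩
  rw [lintegral_lintegral_swap (measurable_sq_sub hwq).aemeasurable]
  refine lintegral_congr fun x => lintegral_congr fun y => ?_
  rw [← enorm_neg, neg_sub]

/-- Integrate `|w z - w x|² ≤ 2 (|w y - w x|² + |w z - w y|²)` over `y` in `V` and divide by the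
measure of `V`. -/
theorem PoincarePair.trans [IsFiniteMeasure (formMeasure (wedgeForm Ω Ω))] {U V W : Set M}
    (h : PoincarePair J Ω U V) (h' : PoincarePair J Ω V W)
    (hV : formMeasure (wedgeForm Ω Ω) V ≠ 0) : PoincarePair J Ω U W := by
  obtain ⟨C, hC⟩ := h
  obtain ⟨C', hC'⟩ := h'
  set μ := formMeasure (wedgeForm Ω Ω) with hμ
  have hfin : ∀ S, μ S ≠ ⊤ := fun S => measure_ne_top μ S
  refine ⟨((μ V)⁻¹ * (2 * (μ W * C + μ U * C'))).toNNReal, fun w q hwq => ?_⟩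
  rw [ENNReal.coe_toNNReal (by
    have := hfin W; have := hfin U
    have : (μ V)⁻¹ ≠ ⊤ := ENNReal.inv_ne_top.2 hV
    finiteness)]
  set E := ∫⁻ x, ENNReal.ofReal (q x) ∂μ
  have hm := measurable_sq_sub hwq
  have hwm := hwq.measurable
  have hpt : ∀ x y z : M, ‖w z - w x‖ₑ ^ 2 ≤ 2 * (‖w y - w x‖ₑ ^ 2 + ‖w z - w y‖ₑ ^ 2) := by
    intro x y z
    have h1 : (w z - w x) ^ 2 ≤ 2 * ((w y - w x) ^ 2 + (w z - w y) ^ 2) := by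
      nlinarith [sq_nonneg ((w y - w x) - (w z - w y))]
    have h2 : ‖w z - w x‖₊ ^ 2 ≤ 2 * (‖w y - w x‖₊ ^ 2 + ‖w z - w y‖₊ ^ 2) := by
      rw [← NNReal.coe_le_coe]
      push_cast
      simpa using h1
    simp only [enorm_eq_nnnorm]
    exact_mod_cast h2
  have key : μ V * ∫⁻ x in U, ∫⁻ z in W, ‖w z - w x‖ₑ ^ 2 ∂μ ∂μ ≤
      2 * (μ W * C + μ U * C') * E := by
    calc _ = ∫⁻ x in U, ∫⁻ z in W, ∫⁻ _ in V, ‖w z - w x‖ₑ ^ 2 ∂μ ∂μ ∂μ := by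
          simp only [setLIntegral_const]
          rw [← lintegral_const_mul' _ _ (hfin V)]
          refine lintegral_congr fun x => ?_
          rw [lintegral_mul_const' _ _ (hfin V), mul_comm]
      _ ≤ ∫⁻ x in U, ∫⁻ z in W, ∫⁻ y in V,
            2 * (‖w y - w x‖ₑ ^ 2 + ‖w z - w y‖ₑ ^ 2) ∂μ ∂μ ∂μ :=
          lintegral_mono fun x => lintegral_mono fun z => lintegral_mono fun y => hpt x y z
      _ = ∫⁻ x in U, ∫⁻ z in W, 2 * (∫⁻ y in V, ‖w y - w x‖ₑ ^ 2 ∂μ +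
            ∫⁻ y in V, ‖w z - w y‖ₑ ^ 2 ∂μ) ∂μ ∂μ := by
          refine lintegral_congr fun x => lintegral_congr fun z => ?_
          rw [lintegral_const_mul' _ _ (by finiteness), lintegral_add_left (by fun_prop)]
      _ = ∫⁻ x in U, 2 * ((∫⁻ y in V, ‖w y - w x‖ₑ ^ 2 ∂μ) * μ W +
            ∫⁻ z in W, ∫⁻ y in V, ‖w z - w y‖ₑ ^ 2 ∂μ ∂μ) ∂μ := by
          refine lintegral_congr fun x => ?_
          rw [lintegral_const_mul' _ _ (by finiteness), lintegral_add_left measurable_const,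
            setLIntegral_const]
      _ = 2 * ((∫⁻ x in U, ∫⁻ y in V, ‖w y - w x‖ₑ ^ 2 ∂μ ∂μ) * μ W +
            (∫⁻ z in W, ∫⁻ y in V, ‖w z - w y‖ₑ ^ 2 ∂μ ∂μ) * μ U) := by
          rw [lintegral_const_mul' _ _ (by finiteness), lintegral_add_right _ measurable_const,
            setLIntegral_const, lintegral_mul_const' _ _ (hfin W)]
      _ ≤ 2 * ((C * E) * μ W + (C' * E) * μ U) := by
          have e : ∫⁻ z in W, ∫⁻ y in V, ‖w z - w y‖ₑ ^ 2 ∂μ ∂μ =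
              ∫⁻ y in V, ∫⁻ z in W, ‖w z - w y‖ₑ ^ 2 ∂μ ∂μ :=
            lintegral_lintegral_swap (f := fun z y => ‖w z - w y‖ₑ ^ 2)
              (hm.comp measurable_swap).aemeasurable
          rw [e]
          gcongr
          · exact hC w q hwq
          · exact hC' w q hwq
      _ = _ := by ring
  calc _ = (μ V)⁻¹ * (μ V * ∫⁻ x in U, ∫⁻ z in W, ‖w z - w x‖ₑ ^ 2 ∂μ ∂μ) := by
        rw [← mul_assoc, ENNReal.inv_mul_cancel hV (hfin V), one_mul]
    _ ≤ (μ V)⁻¹ * (2 * (μ W * C + μ U * C') * E) := mul_le_mul_right key _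
    _ = _ := by ring

variable [IsManifold (𝓡 4) ∞ M] [CompactSpace M]

section Comparison

variable [Nonempty M] {x₀ : M} {K V : Set R4} {c : ℝ≥0}

theorem lintegral_chartSet_le (hΩ : IsSmoothForm Ω) (hK : K ⊆ (extChartAt (𝓡 4) x₀).target)
    (hc : ∀ y ∈ K, ENNReal.ofReal |wedgeCoeff Ω Ω x₀ y| ≤ c) (hV : MeasurableSet V) (hVK : V ⊆ K)
    {F : M → ℝ≥0∞} (hF : Measurable F) :
    ∫⁻ x in chartSet x₀ V, F x ∂(formMeasure (wedgeForm Ω Ω)) ≤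
      c * ∫⁻ y in V, F ((extChartAt (𝓡 4) x₀).symm y) := by
  rw [lintegral_chartSet hΩ x₀ hV (hVK.trans hK) hF, ← lintegral_const_mul' _ _ (by finiteness)]
  exact setLIntegral_mono' hV fun y hy => mul_le_mul_left (hc y (hVK hy)) _

theorem lintegral_le_lintegral_formMeasure (hΩ : IsSmoothForm Ω)
    (hK : K ⊆ (extChartAt (𝓡 4) x₀).target)
    (hc : ∀ y ∈ K, 1 ≤ c * ENNReal.ofReal |wedgeCoeff Ω Ω x₀ y|) (hV : MeasurableSet V)
    (hVK : V ⊆ K) {F : M → ℝ≥0∞} (hF : Measurable F) :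
    ∫⁻ y in V, F ((extChartAt (𝓡 4) x₀).symm y) ≤
      c * ∫⁻ x, F x ∂(formMeasure (wedgeForm Ω Ω)) := by
  calc _ ≤ ∫⁻ y in V, c * (ENNReal.ofReal |wedgeCoeff Ω Ω x₀ y| *
        F ((extChartAt (𝓡 4) x₀).symm y)) := by
        refine setLIntegral_mono' hV fun y hy => ?_
        rw [← mul_assoc]
        exact le_mul_of_one_le_left zero_le (hc y (hVK hy))
    _ = c * ∫⁻ x in chartSet x₀ V, F x ∂(formMeasure (wedgeForm Ω Ω)) := by
        rw [lintegral_const_mul' _ _ (by finiteness),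
          ← lintegral_chartSet hΩ x₀ hV (hVK.trans hK) hF]
    _ ≤ _ := mul_le_mul_right (setLIntegral_le_lintegral _ _) _

end Comparison

/-- The Euclidean inequality transplanted to a comparable ball. The right-hand side is integrated
over all of `M`, so that local inequalities can be added. -/
theorem exists_sobolev_nhds [Nonempty M] (hJ : IsAlmostComplex J) (hΩ : IsAlmostKahlerForm J Ω)
    (x₀ : M) : ∃ U ∈ nhds x₀, ∃ C : ℝ≥0, ∀ w q, EnergyBound J Ω w q →
      (∫⁻ x in U, ‖w x‖ₑ ^ 4 ∂(formMeasure (wedgeForm Ω Ω))) ^ (1 / 2 : ℝ) ≤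
        C * ∫⁻ x, (ENNReal.ofReal (q x) + ‖w x‖ₑ ^ 2) ∂(formMeasure (wedgeForm Ω Ω)) := by
  obtain ⟨R, hR, c, hsub, hc, hc', hgrad⟩ := exists_comparable_ball hJ hΩ x₀
  obtain ⟨C, hC⟩ := exists_sobolev_ball (volume : Measure R4) (by simp) (extChartAt (𝓡 4) x₀ x₀)
    (half_pos hR)
  rw [mul_div_cancel₀ R two_ne_zero] at hC
  refine ⟨_, chartSet_ball_mem_nhds x₀ (half_pos hR), c ^ (1 / 2 : ℝ) * C * ((c + 1) * c),
    fun w q h => ?_⟩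
  have hw1 := contDiffOn_comp_symm (by simp) h.contMDiff x₀
  have hwm : Measurable fun x => ‖w x‖ₑ ^ 4 := h.measurable.enorm.pow_const 4
  have hFm : Measurable fun x => ENNReal.ofReal (q x) + ‖w x‖ₑ ^ 2 :=
    h.continuous.measurable.ennreal_ofReal.add (h.measurable.enorm.pow_const 2)
  have hb : ball (extChartAt (𝓡 4) x₀ x₀) (R / 2) ⊆ closedBall (extChartAt (𝓡 4) x₀ x₀) R :=
    ball_subset_closedBall.trans (closedBall_subset_closedBall (by linarith))
  calc _ ≤ (c * ∫⁻ y in ball (extChartAt (𝓡 4) x₀ x₀) (R / 2),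
        ‖w ((extChartAt (𝓡 4) x₀).symm y)‖ₑ ^ 4) ^ (1 / 2 : ℝ) :=
        ENNReal.rpow_le_rpow (lintegral_chartSet_le hΩ.smooth hsub hc measurableSet_ball hb hwm)
          (by norm_num)
    _ ≤ c ^ (1 / 2 : ℝ) * (C * ∫⁻ y in closedBall (extChartAt (𝓡 4) x₀ x₀) R,
        (‖fderiv ℝ (fun z => w ((extChartAt (𝓡 4) x₀).symm z)) y‖ₑ ^ 2 +
          ‖w ((extChartAt (𝓡 4) x₀).symm y)‖ₑ ^ 2)) := by
        rw [ENNReal.mul_rpow_of_nonneg _ _ (by norm_num)]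
        exact mul_le_mul_right (hC _ _ (isOpen_extChartAt_target x₀) hsub hw1) _
    _ ≤ c ^ (1 / 2 : ℝ) * (C * ∫⁻ y in closedBall (extChartAt (𝓡 4) x₀ x₀) R,
        (c + 1) * (ENNReal.ofReal (q ((extChartAt (𝓡 4) x₀).symm y)) +
          ‖w ((extChartAt (𝓡 4) x₀).symm y)‖ₑ ^ 2)) := by
        refine mul_le_mul_right (mul_le_mul_right
          (setLIntegral_mono' measurableSet_closedBall fun y hy => ?_) _) _
        rw [mul_add]
        refine add_le_add ((hgrad w q h y hy).trans (mul_le_mul_left le_self_add _)) ?_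
        exact le_mul_of_one_le_left zero_le le_add_self
    _ ≤ c ^ (1 / 2 : ℝ) * (C * ((c + 1) * (c *
        ∫⁻ x, (ENNReal.ofReal (q x) + ‖w x‖ₑ ^ 2) ∂(formMeasure (wedgeForm Ω Ω))))) := by
        rw [lintegral_const_mul' _ _ (by finiteness)]
        gcongr
        exact lintegral_le_lintegral_formMeasure hΩ.smooth hsub hc' measurableSet_closedBall
          subset_rfl hFm
    _ = _ := by
        push_cast
        rw [ENNReal.coe_rpow_of_nonneg _ (by norm_num)]
        ring

/-- The Sobolev inequality on a compact almost Kähler 4-manifold. -/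
theorem exists_sobolev [Nonempty M] (hJ : IsAlmostComplex J) (hΩ : IsAlmostKahlerForm J Ω) :
    ∃ C : ℝ≥0, ∀ w q, EnergyBound J Ω w q →
      (∫⁻ x, ‖w x‖ₑ ^ 4 ∂(formMeasure (wedgeForm Ω Ω))) ^ (1 / 2 : ℝ) ≤
        C * ∫⁻ x, (ENNReal.ofReal (q x) + ‖w x‖ₑ ^ 2) ∂(formMeasure (wedgeForm Ω Ω)) := by
  suffices h : ∃ C : ℝ≥0, ∀ w q, EnergyBound J Ω w q →
      (∫⁻ x in univ, ‖w x‖ₑ ^ 4 ∂(formMeasure (wedgeForm Ω Ω))) ^ (1 / 2 : ℝ) ≤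
        C * ∫⁻ x, (ENNReal.ofReal (q x) + ‖w x‖ₑ ^ 2) ∂(formMeasure (wedgeForm Ω Ω)) by
    simpa only [Measure.restrict_univ] using h
  -- The right-hand side does not depend on `S` and the square root is subadditive, so constants add
  -- under unions and compactness reduces the claim to small neighbourhoods.
  refine isCompact_univ.induction_on (p := fun S => ∃ C : ℝ≥0, ∀ w q, EnergyBound J Ω w q →
      (∫⁻ x in S, ‖w x‖ₑ ^ 4 ∂(formMeasure (wedgeForm Ω Ω))) ^ (1 / 2 : ℝ) ≤
        C * ∫⁻ x, (ENNReal.ofReal (q x) + ‖w x‖ₑ ^ 2) ∂(formMeasure (wedgeForm Ω Ω)))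
    ⟨0, fun w q _ => by simp⟩ ?_ ?_ ?_
  · rintro S T hST ⟨C, hC⟩
    exact ⟨C, fun w q h => (ENNReal.rpow_le_rpow (lintegral_mono_set hST)
      (by norm_num)).trans (hC w q h)⟩
  · rintro S T ⟨C, hC⟩ ⟨C', hC'⟩
    refine ⟨C + C', fun w q h => ?_⟩
    push_cast
    rw [add_mul]
    calc _ ≤ _ := ENNReal.rpow_le_rpow (lintegral_union_le _ S T) (by norm_num)
      _ ≤ _ := ENNReal.rpow_add_le_add_rpow _ _ (by norm_num) (by norm_num)
      _ ≤ _ := add_le_add (hC w q h) (hC' w q h)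
  · intro x _
    obtain ⟨U, hU, h⟩ := exists_sobolev_nhds hJ hΩ x
    exact ⟨U, mem_nhdsWithin_of_mem_nhds hU, h⟩

theorem exists_poincarePair_nhds [Nonempty M] (hJ : IsAlmostComplex J)
    (hΩ : IsAlmostKahlerForm J Ω) (x₀ : M) : ∃ U ∈ nhds x₀, PoincarePair J Ω U U := by
  obtain ⟨R, hR, c, hsub, hc, hc', hgrad⟩ := exists_comparable_ball hJ hΩ x₀
  set B := ball (extChartAt (𝓡 4) x₀ x₀) R with hB
  have hBK : B ⊆ closedBall (extChartAt (𝓡 4) x₀ x₀) R := ball_subset_closedBall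
  set L : ℝ≥0 := (2 * R).toNNReal with hLdef
  have hL : ∀ x ∈ B, ∀ y ∈ B, ‖y - x‖ₑ ≤ L := by
    intro x hx y hy
    rw [← edist_eq_enorm_sub, edist_dist]
    refine ENNReal.ofReal_le_ofReal ?_
    calc dist y x ≤ dist y (extChartAt (𝓡 4) x₀ x₀) + dist x (extChartAt (𝓡 4) x₀ x₀) :=
          dist_triangle_right _ _ _
      _ ≤ 2 * R := by linarith [mem_ball.1 hx, mem_ball.1 hy]
  set m : ℝ≥0 := (volume B).toNNReal with hm
  have hmB : (m : ℝ≥0∞) = volume B := ENNReal.coe_toNNReal measure_ball_lt_top.ne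
  refine ⟨_, chartSet_ball_mem_nhds x₀ hR,
    c * (c * (L ^ 2 * (2 ^ 4 * m) * (c * c))), fun w q h => ?_⟩
  have hw1 := contDiffOn_comp_symm (by simp) h.contMDiff x₀
  have hmeas := measurable_sq_sub h
  have hsfin : SFinite (formMeasure (wedgeForm Ω Ω)) := by
    have := isFiniteMeasure_formMeasure hJ hΩ
    infer_instance
  have hp := lintegral_lintegral_sq_sub_le (volume : Measure R4) (U := B) isOpen_ball
    (convex_ball _ _) hL (hw1.mono (hBK.trans hsub))
  rw [show Module.finrank ℝ R4 = 4 by simp, ← hmB] at hp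
  calc _ ≤ c * ∫⁻ x in B, ∫⁻ y in chartSet x₀ B,
        ‖w y - w ((extChartAt (𝓡 4) x₀).symm x)‖ₑ ^ 2 ∂(formMeasure (wedgeForm Ω Ω)) :=
        lintegral_chartSet_le hΩ.smooth hsub hc measurableSet_ball hBK
          hmeas.lintegral_prod_right'
    _ ≤ c * ∫⁻ x in B, c * ∫⁻ y in B,
        ‖w ((extChartAt (𝓡 4) x₀).symm y) - w ((extChartAt (𝓡 4) x₀).symm x)‖ₑ ^ 2 := by
        refine mul_le_mul_right (lintegral_mono fun x => ?_) _
        exact lintegral_chartSet_le hΩ.smooth hsub hc measurableSet_ball hBK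
          (hmeas.comp measurable_prodMk_left)
    _ ≤ c * (c * (L ^ 2 * (2 ^ 4 * m) * ∫⁻ y in B,
        ‖fderiv ℝ (fun z => w ((extChartAt (𝓡 4) x₀).symm z)) y‖ₑ ^ 2)) := by
        rw [lintegral_const_mul' _ _ (by finiteness)]
        gcongr
    _ ≤ c * (c * (L ^ 2 * (2 ^ 4 * m) * ∫⁻ y in B,
        c * ENNReal.ofReal (q ((extChartAt (𝓡 4) x₀).symm y)))) := by
        exact mul_le_mul_right (mul_le_mul_right (mul_le_mul_right
          (setLIntegral_mono' measurableSet_ball fun y hy => hgrad w q h y (hBK hy)) _) _) _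
    _ ≤ c * (c * (L ^ 2 * (2 ^ 4 * m) * (c * (c *
        ∫⁻ x, ENNReal.ofReal (q x) ∂(formMeasure (wedgeForm Ω Ω)))))) := by
        rw [lintegral_const_mul' _ _ (by finiteness)]
        gcongr
        exact lintegral_le_lintegral_formMeasure hΩ.smooth hsub hc' measurableSet_ball hBK
          h.continuous.measurable.ennreal_ofReal
    _ = _ := by
        push_cast
        ring

/-- Connectedness joins any two points by a chain of local Poincaré inequalities, so every pair of
points has neighbourhoods forming a Poincaré pair. Compactness, used once in each variable, then
passes from neighbourhoods to all of `M`. -/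
theorem poincarePair_univ [ConnectedSpace M] (hJ : IsAlmostComplex J)
    (hΩ : IsAlmostKahlerForm J Ω) : PoincarePair J Ω univ univ := by
  have hfin := isFiniteMeasure_formMeasure hJ hΩ
  have hpos := isOpenPosMeasure_formMeasure hJ hΩ
  set P : M → M → Prop := fun x y => ∃ U ∈ nhds x, ∃ V ∈ nhds y, PoincarePair J Ω U V with hP
  have hsymm : ∀ x y, P x y → P y x := by
    rintro x y ⟨U, hU, V, hV, h⟩
    exact ⟨V, hV, U, hU, h.symm⟩
  have : Std.Symm P := ⟨hsymm⟩
  have hall : ∀ x y, P x y := by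
    intro x y
    have htrans : IsTrans M P := ⟨by
      rintro x y z ⟨U, hU, V, hV, h⟩ ⟨V', hV', W, hW, h'⟩
      refine ⟨U, hU, W, hW, (h.mono subset_rfl inter_subset_left).trans
        (h'.mono inter_subset_right subset_rfl) ?_⟩
      exact (Measure.measure_pos_of_mem_nhds _ (Filter.inter_mem hV hV')).ne'⟩
    refine PreconnectedSpace.induction₂ P (fun x => ?_) htrans x y
    obtain ⟨U, hU, h⟩ := exists_poincarePair_nhds hJ hΩ x
    filter_upwards [eventually_mem_nhds_iff.2 hU] with y hy
    exact ⟨U, hU, U, hy, h⟩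
  have hempty : ∀ V, PoincarePair J Ω ∅ V := fun V => ⟨0, fun w q _ => by simp⟩
  have h1 : ∀ x, ∃ U ∈ nhds x, PoincarePair J Ω U univ := by
    intro x
    obtain ⟨U, hU, h⟩ := isCompact_univ.induction_on
      (p := fun S => ∃ U ∈ nhds x, PoincarePair J Ω S U)
      ⟨univ, Filter.univ_mem, hempty _⟩
      (fun S T hST ⟨U, hU, h⟩ => ⟨U, hU, h.mono hST subset_rfl⟩)
      (fun S T ⟨U, hU, h⟩ ⟨U', hU', h'⟩ => ⟨U ∩ U', Filter.inter_mem hU hU',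
        (h.mono subset_rfl inter_subset_left).union_left
          (h'.mono subset_rfl inter_subset_right)⟩)
      (fun y _ => by
        obtain ⟨V, hV, U, hU, h⟩ := hall y x
        exact ⟨V, mem_nhdsWithin_of_mem_nhds hV, U, hU, h⟩)
    exact ⟨U, hU, h.symm⟩
  refine isCompact_univ.induction_on (p := fun S => PoincarePair J Ω S univ) (hempty _)
    (fun S T hST h => h.mono hST subset_rfl) (fun S T h h' => h.union_left h') fun x _ => ?_
  obtain ⟨U, hU, h⟩ := h1 x
  exact ⟨U, mem_nhdsWithin_of_mem_nhds hU, h⟩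

/-- The Poincaré inequality on a compact connected almost Kähler 4-manifold. -/
theorem exists_poincare [ConnectedSpace M] (hJ : IsAlmostComplex J)
    (hΩ : IsAlmostKahlerForm J Ω) : ∃ C : ℝ≥0, ∀ w q, EnergyBound J Ω w q → ∃ c : ℝ,
      ∫⁻ y, ‖w y - c‖ₑ ^ 2 ∂(formMeasure (wedgeForm Ω Ω)) ≤
        C * ∫⁻ x, ENNReal.ofReal (q x) ∂(formMeasure (wedgeForm Ω Ω)) := by
  have hfin := isFiniteMeasure_formMeasure hJ hΩ
  have hpos := isOpenPosMeasure_formMeasure hJ hΩ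
  obtain ⟨C, hC⟩ := poincarePair_univ hJ hΩ
  set μ := formMeasure (wedgeForm Ω Ω) with hμ
  have hμ0 : μ univ ≠ 0 := (isOpen_univ.measure_pos μ univ_nonempty).ne'
  refine ⟨((μ univ)⁻¹ * C).toNNReal, fun w q h => ?_⟩
  rw [ENNReal.coe_toNNReal (ENNReal.mul_ne_top (ENNReal.inv_ne_top.2 hμ0) ENNReal.coe_ne_top)]
  have h1 := hC w q h
  simp only [Measure.restrict_univ] at h1
  -- The constant is the value of `w` at a point where the inner integral does not exceed its
  -- average.
  obtain ⟨x, hx⟩ := exists_le_laverage (μ := μ) (fun h0 => hμ0 (by rw [h0]; simp))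
    (Measurable.lintegral_prod_right' (ν := μ) (measurable_sq_sub h)).aemeasurable
  refine ⟨w x, hx.trans ?_⟩
  rw [laverage_eq, ENNReal.div_eq_inv_mul, mul_assoc]
  exact mul_le_mul_right h1 _

end SobolevPoincare

end AlmostKahler

namespace AlmostKahler

/-! ### Divergence form of `d(ψ η) ∧ Θ` in coordinates -/

section Divergence

/-- The components of the vector field dual to the 3-form `η ∧ Θ` on `ℝ⁴`. -/
noncomputable def dualField (η : R4 [⋀^Fin 1]→L[ℝ] ℝ) (Θ : R4 [⋀^Fin 2]→L[ℝ] ℝ) : Fin 4 → ℝ :=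
  let e := stdFrame
  ![η ![e 1] * Θ ![e 2, e 3] - η ![e 2] * Θ ![e 1, e 3] + η ![e 3] * Θ ![e 1, e 2],
    -(η ![e 0] * Θ ![e 2, e 3] - η ![e 2] * Θ ![e 0, e 3] + η ![e 3] * Θ ![e 0, e 2]),
    η ![e 0] * Θ ![e 1, e 3] - η ![e 1] * Θ ![e 0, e 3] + η ![e 3] * Θ ![e 0, e 1],
    -(η ![e 0] * Θ ![e 1, e 2] - η ![e 1] * Θ ![e 0, e 2] + η ![e 2] * Θ ![e 0, e 1])]

variable {η : R4 → R4 [⋀^Fin 1]→L[ℝ] ℝ} {Θ : R4 → R4 [⋀^Fin 2]→L[ℝ] ℝ} {ψ : R4 → ℝ} {y : R4}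

theorem extDeriv_one_apply (hη : DifferentiableAt ℝ η y) (v w : R4) :
    extDeriv η y ![v, w] =
      fderiv ℝ (fun z => η z ![w]) y v - fderiv ℝ (fun z => η z ![v]) y w := by
  have h0 : Fin.removeNth (0 : Fin 2) ![v, w] = ![w] := by funext i; fin_cases i; rfl
  have h1 : Fin.removeNth (1 : Fin 2) ![v, w] = ![v] := by funext i; fin_cases i; rfl
  rw [extDeriv_apply hη, Fin.sum_univ_two, h0, h1]
  simp [sub_eq_add_neg]

theorem extDeriv_two_apply (hΘ : DifferentiableAt ℝ Θ y) (u v w : R4) :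
    extDeriv Θ y ![u, v, w] = fderiv ℝ (fun z => Θ z ![v, w]) y u -
      fderiv ℝ (fun z => Θ z ![u, w]) y v + fderiv ℝ (fun z => Θ z ![u, v]) y w := by
  have h0 : Fin.removeNth (0 : Fin 3) ![u, v, w] = ![v, w] := by funext i; fin_cases i <;> rfl
  have h1 : Fin.removeNth (1 : Fin 3) ![u, v, w] = ![u, w] := by funext i; fin_cases i <;> rfl
  have h2 : Fin.removeNth (2 : Fin 3) ![u, v, w] = ![u, v] := by funext i; fin_cases i <;> rfl
  rw [extDeriv_apply hΘ, Fin.sum_univ_three, h0, h1, h2]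
  simp [sub_eq_add_neg]

/-- If `Θ` is closed, then the divergence of the vector field dual to `ψ η ∧ Θ` is
`d(ψ η) ∧ Θ`. -/
theorem sum_fderiv_dualField (hψ : DifferentiableAt ℝ ψ y) (hη : DifferentiableAt ℝ η y)
    (hΘ : DifferentiableAt ℝ Θ y) (hd : extDeriv Θ y = 0) :
    ∑ a, fderiv ℝ (fun z => ψ z * dualField (η z) (Θ z) a) y (stdFrame a) =
      ψ y * wedge (extDeriv η y) (Θ y) stdFrame +
        wedge (wedgeOne (fderiv ℝ ψ y) (η y)) (Θ y) stdFrame := by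
  have hE : ∀ i, HasFDerivAt (fun z => η z ![stdFrame i])
      (fderiv ℝ (fun z => η z ![stdFrame i]) y) y := fun i =>
    (hη.hasFDerivAt.continuousAlternatingMap_apply_const ![stdFrame i]).differentiableAt.hasFDerivAt
  have hT : ∀ i j, HasFDerivAt (fun z => Θ z ![stdFrame i, stdFrame j])
      (fderiv ℝ (fun z => Θ z ![stdFrame i, stdFrame j]) y) y := fun i j =>
    (hΘ.hasFDerivAt.continuousAlternatingMap_apply_const
      ![stdFrame i, stdFrame j]).differentiableAt.hasFDerivAt
  have hp := hψ.hasFDerivAt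
  have hD : ∀ i j k : Fin 4, fderiv ℝ (fun z => Θ z ![stdFrame j, stdFrame k]) y (stdFrame i) -
      fderiv ℝ (fun z => Θ z ![stdFrame i, stdFrame k]) y (stdFrame j) +
      fderiv ℝ (fun z => Θ z ![stdFrame i, stdFrame j]) y (stdFrame k) = 0 := fun i j k => by
    rw [← extDeriv_two_apply hΘ, hd]; rfl
  have h0 : HasFDerivAt (fun z => ψ z * dualField (η z) (Θ z) 0) _ y :=
    hp.mul ((((hE 1).mul (hT 2 3)).sub ((hE 2).mul (hT 1 3))).add ((hE 3).mul (hT 1 2)))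
  have h1 : HasFDerivAt (fun z => ψ z * dualField (η z) (Θ z) 1) _ y :=
    hp.mul ((((hE 0).mul (hT 2 3)).sub ((hE 2).mul (hT 0 3))).add ((hE 3).mul (hT 0 2))).neg
  have h2 : HasFDerivAt (fun z => ψ z * dualField (η z) (Θ z) 2) _ y :=
    hp.mul ((((hE 0).mul (hT 1 3)).sub ((hE 1).mul (hT 0 3))).add ((hE 3).mul (hT 0 1)))
  have h3 : HasFDerivAt (fun z => ψ z * dualField (η z) (Θ z) 3) _ y :=
    hp.mul ((((hE 0).mul (hT 1 2)).sub ((hE 1).mul (hT 0 2))).add ((hE 2).mul (hT 0 1))).neg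
  rw [Fin.sum_univ_four, h0.fderiv, h1.fderiv, h2.fderiv, h3.fderiv]
  simp only [wedge_apply, extDeriv_one_apply hη, wedgeOne_apply, add_apply, sub_apply, neg_apply,
    smul_apply, smul_eq_mul, dualField, Matrix.cons_val]
  -- The terms left over by the product rule are the components of `dΘ`, weighted by `ψ η`.
  linear_combination ψ y * (η y ![stdFrame 0] * hD 1 2 3 * (-1) + η y ![stdFrame 1] * hD 0 2 3 -
    η y ![stdFrame 2] * hD 0 1 3 + η y ![stdFrame 3] * hD 0 1 2)

end Divergence

end AlmostKahler

namespace AlmostKahler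

/-! ### Stokes' theorem on the manifold -/

section Stokes

open MeasureTheory Set
open scoped ENNReal NNReal

variable {M : Type*} [TopologicalSpace M] [ChartedSpace R4 M]

/-- The 2-form `dψ ∧ η`. -/
noncomputable def wedgeOneForm (ψ : M → ℝ) (η : Form M 1) : Form M 2 :=
  fun x => wedgeOne (differential ψ x) (η x)

/-- The quotient of `d(ψ η) ∧ Θ` by `Ω ∧ Ω`. -/
noncomputable def stokesIntegrand (Ω Θ : Form M 2) (η : Form M 1) (ψ : M → ℝ) (x : M) : ℝ :=
  ψ x * ratio (wedgeForm (d η) Θ) (wedgeForm Ω Ω) x +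
    ratio (wedgeForm (wedgeOneForm ψ η) Θ) (wedgeForm Ω Ω) x

theorem ratio_add (α α' β γ δ : Form M 2) (x : M) :
    ratio (wedgeForm (α + α') β) (wedgeForm γ δ) x =
      ratio (wedgeForm α β) (wedgeForm γ δ) x + ratio (wedgeForm α' β) (wedgeForm γ δ) x := by
  rw [ratio, ratio, ratio, ← add_div]
  congr 1
  exact congrArg (fun t => t stdFrame) (wedge_add_left (α x) (α' x) (β x))

theorem ratio_smul (c : ℝ) {α α' : Form M 2} (β γ δ : Form M 2) {x : M} (h : α x = c • α' x) :
    ratio (wedgeForm α β) (wedgeForm γ δ) x = c * ratio (wedgeForm α' β) (wedgeForm γ δ) x := by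
  rw [ratio, ratio, ← mul_div_assoc]
  congr 1
  have := congrArg (fun t => t stdFrame) (wedge_smul_left c (α' x) (β x))
  rw [wedgeForm, h]
  exact this

theorem differential_add {ψ₁ ψ₂ : M → ℝ} {x : M} (h₁ : MDifferentiableAt (𝓡 4) 𝓘(ℝ, ℝ) ψ₁ x)
    (h₂ : MDifferentiableAt (𝓡 4) 𝓘(ℝ, ℝ) ψ₂ x) :
    differential (fun z => ψ₁ z + ψ₂ z) x = differential ψ₁ x + differential ψ₂ x :=
  mfderiv_add h₁ h₂

theorem stokesIntegrand_add (Ω Θ : Form M 2) (η : Form M 1) {ψ₁ ψ₂ : M → ℝ}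
    (h₁ : MDifferentiable (𝓡 4) 𝓘(ℝ, ℝ) ψ₁) (h₂ : MDifferentiable (𝓡 4) 𝓘(ℝ, ℝ) ψ₂) (x : M) :
    stokesIntegrand Ω Θ η (fun z => ψ₁ z + ψ₂ z) x =
      stokesIntegrand Ω Θ η ψ₁ x + stokesIntegrand Ω Θ η ψ₂ x := by
  have e : wedgeOneForm (fun z => ψ₁ z + ψ₂ z) η = wedgeOneForm ψ₁ η + wedgeOneForm ψ₂ η := by
    funext x
    rw [wedgeOneForm, differential_add (h₁ x) (h₂ x)]
    exact wedgeOne_add_left _ _ _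
  rw [stokesIntegrand, e, ratio_add, stokesIntegrand, stokesIntegrand]
  ring

theorem stokesIntegrand_eq_zero (Ω Θ : Form M 2) (η : Form M 1) {ψ : M → ℝ} {x : M}
    (hx : x ∉ tsupport ψ) : stokesIntegrand Ω Θ η ψ x = 0 := by
  have hev : ψ =ᶠ[nhds x] fun _ => 0 := by
    filter_upwards [(isClosed_tsupport ψ).isOpen_compl.mem_nhds hx] with z hz
    exact image_eq_zero_of_notMem_tsupport hz
  have hdiff : differential ψ x = 0 := by
    rw [differential, hev.mfderiv_eq]
    exact mfderiv_const
  have h0 : wedgeOneForm ψ η x = (0 : ℝ) • (0 : Form M 2) x := by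
    have e : wedgeOne 0 (η x) = 0 := by simpa using wedgeOne_smul_left 0 0 (η x)
    rw [wedgeOneForm, hdiff]
    exact e.trans (zero_smul ℝ _).symm
  rw [stokesIntegrand, image_eq_zero_of_notMem_tsupport hx, ratio_smul 0 Θ Ω Ω h0]
  ring

variable [IsManifold (𝓡 4) ∞ M]

theorem IsSmoothForm.d {k : ℕ} {α : Form M k} (h : IsSmoothForm α) :
    IsSmoothForm (AlmostKahler.d α) := by
  intro x₀
  have h1 : ContDiffOn ℝ ∞ (fderiv ℝ (α.inChart x₀)) (extChartAt (𝓡 4) x₀).target :=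
    (h x₀).fderiv_of_isOpen (isOpen_extChartAt_target x₀) (by simp)
  have h2 := (ContinuousAlternatingMap.alternatizeUncurryFinCLM ℝ R4 ℝ (n := k)).contDiff.comp_contDiffOn h1
  refine h2.congr fun y hy => (inChart_d h hy).trans ?_
  rw [Function.comp_apply, ContinuousAlternatingMap.alternatizeUncurryFinCLM_apply]
  rfl

theorem wedgeOneForm_inChart {ψ : M → ℝ} {η : Form M 1} {x₀ : M} {y : R4}
    (hy : y ∈ (extChartAt (𝓡 4) x₀).target)
    (hψ : MDifferentiableAt (𝓡 4) 𝓘(ℝ, ℝ) ψ ((extChartAt (𝓡 4) x₀).symm y)) :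
    (wedgeOneForm ψ η).inChart x₀ y =
      wedgeOne (fderiv ℝ (fun z => ψ ((extChartAt (𝓡 4) x₀).symm z)) y) (η.inChart x₀ y) := by
  rw [fderiv_comp_symm hy hψ]
  exact (wedgeOne_comp _ (η ((extChartAt (𝓡 4) x₀).symm y)) (paramMap x₀ y)).symm

variable {Ω Θ : Form M 2} {η : Form M 1} {ψ : M → ℝ}

theorem continuous_ratio_wedgeOneForm (hψ : ContMDiff (𝓡 4) 𝓘(ℝ, ℝ) 1 ψ) (hη : IsSmoothForm η)
    (hΘ : IsSmoothForm Θ) (hΩ : IsSmoothForm Ω) (hne : ∀ x, wedgeForm Ω Ω x stdFrame ≠ 0) :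
    Continuous (ratio (wedgeForm (wedgeOneForm ψ η) Θ) (wedgeForm Ω Ω)) := by
  refine continuous_of_charts fun x₀ => ?_
  set T := (extChartAt (𝓡 4) x₀).target
  refine ContinuousOn.congr
    (f := fun y => wedge (wedgeOne (fderiv ℝ (fun z => ψ ((extChartAt (𝓡 4) x₀).symm z)) y)
      (η.inChart x₀ y)) (Θ.inChart x₀ y) stdFrame / wedgeCoeff Ω Ω x₀ y) ?_ fun y hy => by
    rw [ratio_symm _ _ _ _ hy, wedgeCoeff,
      wedgeOneForm_inChart hy (hψ.mdifferentiable (by simp) _)]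
  refine ContinuousOn.div ?_ (contDiffOn_wedgeCoeff hΩ hΩ x₀).continuousOn
    fun y hy => wedgeCoeff_ne_zero hne hy
  have hp : ∀ i : Fin 4, ContinuousOn (fun y =>
      fderiv ℝ (fun z => ψ ((extChartAt (𝓡 4) x₀).symm z)) y (stdFrame i)) T := fun i =>
    ((contDiffOn_comp_symm (by simp) hψ x₀).continuousOn_fderiv_of_isOpen
      (isOpen_extChartAt_target x₀) le_rfl).clm_apply continuousOn_const
  have he : ∀ i : Fin 4, ContinuousOn (fun y => η.inChart x₀ y ![stdFrame i]) T := fun i =>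
    (hη.contDiffOn_apply x₀ ![stdFrame i]).continuousOn
  have ht : ∀ i j : Fin 4, ContinuousOn (fun y => Θ.inChart x₀ y ![stdFrame i, stdFrame j]) T :=
    fun i j => (hΘ.contDiffOn_apply x₀ ![stdFrame i, stdFrame j]).continuousOn
  simp only [wedge_apply, wedgeOne_apply]
  have ha : ∀ i j : Fin 4, ContinuousOn (fun y =>
      fderiv ℝ (fun z => ψ ((extChartAt (𝓡 4) x₀).symm z)) y (stdFrame i) *
        η.inChart x₀ y ![stdFrame j] -
      fderiv ℝ (fun z => ψ ((extChartAt (𝓡 4) x₀).symm z)) y (stdFrame j) *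
        η.inChart x₀ y ![stdFrame i]) T := fun i j =>
    ((hp i).mul (he j)).sub ((hp j).mul (he i))
  exact ((((((ha 0 1).mul (ht 2 3)).sub ((ha 0 2).mul (ht 1 3))).add ((ha 0 3).mul (ht 1 2))).add
    ((ha 1 2).mul (ht 0 3))).sub ((ha 1 3).mul (ht 0 2))).add ((ha 2 3).mul (ht 0 1))

theorem continuous_stokesIntegrand (hψ : ContMDiff (𝓡 4) 𝓘(ℝ, ℝ) 1 ψ) (hη : IsSmoothForm η)
    (hΘ : IsSmoothForm Θ) (hΩ : IsSmoothForm Ω) (hne : ∀ x, wedgeForm Ω Ω x stdFrame ≠ 0) :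
    Continuous (stokesIntegrand Ω Θ η ψ) :=
  (hψ.continuous.mul (continuous_ratio hη.d hΘ hΩ hne)).add
    (continuous_ratio_wedgeOneForm hψ hη hΘ hΩ hne)

variable [MeasurableSpace M] [BorelSpace M] [CompactSpace M]

/-- Stokes' theorem for forms supported in the domain of a chart. -/
theorem integral_stokesIntegrand_of_subset [Nonempty M] (hψ : ContMDiff (𝓡 4) 𝓘(ℝ, ℝ) 1 ψ)
    (hη : IsSmoothForm η) (hΘ : IsSmoothForm Θ) (hd : d Θ = 0) (hΩ : IsSmoothForm Ω)
    (hne : ∀ x, wedgeForm Ω Ω x stdFrame ≠ 0) {x₀ : M}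
    (hs : tsupport ψ ⊆ (extChartAt (𝓡 4) x₀).source) :
    ∫ x, stokesIntegrand Ω Θ η ψ x ∂(formMeasure (wedgeForm Ω Ω)) = 0 := by
  set T := (extChartAt (𝓡 4) x₀).target with hT
  have hTo : IsOpen T := isOpen_extChartAt_target x₀
  set ψ' : R4 → ℝ := fun y => ψ ((extChartAt (𝓡 4) x₀).symm y) with hψ'
  have hψ'd : ContDiffOn ℝ 1 ψ' T := contDiffOn_comp_symm (by simp) hψ x₀
  rw [integral_eq_integral_chart hΩ x₀ (continuous_stokesIntegrand hψ hη hΘ hΩ hne)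
    fun x hx => stokesIntegrand_eq_zero Ω Θ η fun h => hx (hs h)]
  set K := extChartAt (𝓡 4) x₀ '' tsupport ψ with hK
  have hKc : IsCompact K := (isClosed_tsupport ψ).isCompact.image_of_continuousOn
    ((continuousOn_extChartAt x₀).mono hs)
  have hKT : K ⊆ T := by
    rintro _ ⟨x, hx, rfl⟩
    exact (extChartAt (𝓡 4) x₀).map_source (hs hx)
  have hψ0 : ∀ y ∈ T, y ∉ K → ψ' y = 0 := by
    intro y hy hyK
    refine image_eq_zero_of_notMem_tsupport (f := ψ) fun h => hyK ⟨_, h, ?_⟩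
    exact (extChartAt (𝓡 4) x₀).right_inv hy
  set ρ := wedgeCoeff Ω Ω x₀ with hρ
  have hρc : ContinuousOn ρ T := (contDiffOn_wedgeCoeff hΩ hΩ x₀).continuousOn
  have hρ0 : ∀ y ∈ T, ρ y ≠ 0 := fun y hy => wedgeCoeff_ne_zero hne hy
  -- The measure has density `|ρ|` while the divergence identity involves `ρ`. As `ρ` has no zeros,
  -- its sign is locally constant and can be moved inside derivatives.
  have hsign : ∀ y ∈ T, ∀ᶠ z in nhds y, Real.sign (ρ z) = Real.sign (ρ y) := by
    intro y hy
    have hc : ContinuousAt ρ y := hρc.continuousAt (hTo.mem_nhds hy)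
    rcases lt_or_gt_of_ne (hρ0 y hy) with h | h
    · filter_upwards [hc.eventually (gt_mem_nhds h)] with z hz
      rw [Real.sign_of_neg hz, Real.sign_of_neg h]
    · filter_upwards [hc.eventually (lt_mem_nhds h)] with z hz
      rw [Real.sign_of_pos hz, Real.sign_of_pos h]
  set g : Fin 4 → R4 → ℝ := fun a y => ψ' y * dualField (η.inChart x₀ y) (Θ.inChart x₀ y) a with hg
  have hgd : ∀ a, ContDiffOn ℝ 1 (g a) T := by
    have he : ∀ i : Fin 4, ContDiffOn ℝ 1 (fun y => η.inChart x₀ y ![stdFrame i]) T := fun i =>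
      (hη.contDiffOn_apply x₀ ![stdFrame i]).of_le (by simp)
    have ht : ∀ i j : Fin 4,
        ContDiffOn ℝ 1 (fun y => Θ.inChart x₀ y ![stdFrame i, stdFrame j]) T := fun i j =>
      (hΘ.contDiffOn_apply x₀ ![stdFrame i, stdFrame j]).of_le (by simp)
    intro a
    refine hψ'd.mul ?_
    fin_cases a
    · exact (((he 1).mul (ht 2 3)).sub ((he 2).mul (ht 1 3))).add ((he 3).mul (ht 1 2))
    · exact ((((he 0).mul (ht 2 3)).sub ((he 2).mul (ht 0 3))).add ((he 3).mul (ht 0 2))).neg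
    · exact (((he 0).mul (ht 1 3)).sub ((he 1).mul (ht 0 3))).add ((he 3).mul (ht 0 1))
    · exact ((((he 0).mul (ht 1 2)).sub ((he 1).mul (ht 0 2))).add ((he 2).mul (ht 0 1))).neg
  -- Extended by zero, the field is C¹ on all of `ℝ⁴`, because it vanishes off the compact set `K`.
  set Φ : Fin 4 → R4 → ℝ := fun a => T.indicator fun y => Real.sign (ρ y) * g a y with hΦ
  have hΦT : ∀ a, ∀ y ∈ T, Φ a =ᶠ[nhds y] fun z => Real.sign (ρ y) * g a z := by
    intro a y hy
    filter_upwards [hsign y hy, hTo.mem_nhds hy] with z hz hzT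
    simp only [hΦ, indicator_of_mem hzT, hz]
  have hΦ0 : ∀ a, ∀ y ∉ K, Φ a y = 0 := by
    intro a y hy
    by_cases hyT : y ∈ T
    · simp only [hΦ, indicator_of_mem hyT, hg, hψ0 y hyT hy]
      ring
    · exact indicator_of_notMem hyT _
  have hΦev : ∀ a, ∀ y ∉ K, Φ a =ᶠ[nhds y] fun _ => 0 := by
    intro a y hy
    filter_upwards [hKc.isClosed.isOpen_compl.mem_nhds hy] with z hz
    exact hΦ0 a z hz
  have hΦc : ∀ a, ContDiff ℝ 1 (Φ a) := by
    intro a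
    rw [contDiff_iff_contDiffAt]
    intro y
    by_cases hy : y ∈ K
    · exact (contDiffAt_const.mul ((hgd a).contDiffAt
        (hTo.mem_nhds (hKT hy)))).congr_of_eventuallyEq (hΦT a y (hKT hy))
    · exact contDiffAt_const.congr_of_eventuallyEq (hΦev a y hy)
  have hΦs : ∀ a, HasCompactSupport (Φ a) := fun a => HasCompactSupport.intro hKc (hΦ0 a)
  have hint : ∀ a, Integrable fun y => fderiv ℝ (Φ a) y (stdFrame a) := fun a =>
    (((hΦc a).continuous_fderiv (by simp)).clm_apply continuous_const).integrable_of_hasCompactSupport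
      ((hΦs a).fderiv_apply ℝ _)
  have hzero : ∫ y, ∑ a, fderiv ℝ (Φ a) y (stdFrame a) = 0 := by
    rw [integral_finsetSum _ fun a _ => hint a]
    exact Finset.sum_eq_zero fun a _ =>
      integral_fderiv_eq_zero_of_hasCompactSupport volume (hΦc a) (hΦs a) _
  have hset : ∫ y in T, ∑ a, fderiv ℝ (Φ a) y (stdFrame a) =
      ∫ y, ∑ a, fderiv ℝ (Φ a) y (stdFrame a) := by
    refine setIntegral_eq_integral_of_forall_compl_eq_zero fun y hy => ?_
    refine Finset.sum_eq_zero fun a _ => ?_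
    rw [(hΦev a y fun h => hy (hKT h)).fderiv_eq]
    simp
  rw [← hzero, ← hset]
  · refine setIntegral_congr_fun hTo.measurableSet fun y hy => ?_
    have hψy : DifferentiableAt ℝ ψ' y :=
      (hψ'd.differentiableOn (by simp)).differentiableAt (hTo.mem_nhds hy)
    have hdiv := sum_fderiv_dualField hψy ((hη.contDiffAt hy).differentiableAt (by simp))
      ((hΘ.contDiffAt hy).differentiableAt (by simp)) (by rw [← inChart_d hΘ hy, hd]; rfl)
    have h1 : ∀ a, fderiv ℝ (Φ a) y (stdFrame a) =
        Real.sign (ρ y) * fderiv ℝ (g a) y (stdFrame a) := by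
      intro a
      rw [(hΦT a y hy).fderiv_eq, fderiv_const_mul
        (((hgd a).differentiableOn (by simp)).differentiableAt (hTo.mem_nhds hy))]
      rfl
    simp only [h1, ← Finset.mul_sum]
    rw [hdiv, stokesIntegrand, ratio_symm _ _ _ _ hy, ratio_symm _ _ _ _ hy]
    simp only [wedgeCoeff]
    rw [show wedge (Ω.inChart x₀ y) (Ω.inChart x₀ y) stdFrame = ρ y from rfl,
      wedgeOneForm_inChart hy (hψ.mdifferentiable (by simp) _), inChart_d hη hy]
    have habs : |ρ y| = Real.sign (ρ y) * ρ y := by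
      rcases lt_or_gt_of_ne (hρ0 y hy) with h | h
      · rw [abs_of_neg h, Real.sign_of_neg h]; ring
      · rw [abs_of_pos h, Real.sign_of_pos h]; ring
    have := hρ0 y hy
    rw [habs, mul_assoc, mul_add]
    congr 2
    · rw [mul_left_comm, mul_div_cancel₀ _ this]
    · rw [mul_div_cancel₀ _ this]

/-- Stokes' theorem: the integral of `d(ψ η) ∧ Θ` vanishes if `Θ` is closed. -/
theorem integral_stokesIntegrand [T2Space M] {J : EndField M} [Nonempty M] (hψ : ContMDiff (𝓡 4) 𝓘(ℝ, ℝ) 1 ψ)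
    (hη : IsSmoothForm η) (hΘ : IsSmoothForm Θ) (hd : d Θ = 0) (hJ : IsAlmostComplex J)
    (hΩ : IsAlmostKahlerForm J Ω) :
    ∫ x, stokesIntegrand Ω Θ η ψ x ∂(formMeasure (wedgeForm Ω Ω)) = 0 := by
  have hfin := isFiniteMeasure_formMeasure hJ hΩ
  have hne := hΩ.wedge_ne_zero hJ
  obtain ⟨f, hf⟩ := SmoothPartitionOfUnity.exists_isSubordinate_chartAt_source (𝓡 4) M
  -- By compactness only finitely many functions of the partition of unity are nonzero, and the
  -- integrand is additive in `ψ`, so the local statement suffices.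
  have hsupp : {i | (Function.support (f i)).Nonempty}.Finite :=
    f.locallyFinite.finite_nonempty_of_compact
  have hfψ : ∀ i, ContMDiff (𝓡 4) 𝓘(ℝ, ℝ) 1 fun x => f i x * ψ x := fun i =>
    ((f i).contMDiff.of_le (by simp)).mul hψ
  have hsum : ∀ s : Finset M, ContMDiff (𝓡 4) 𝓘(ℝ, ℝ) 1 (fun x => ∑ i ∈ s, f i x * ψ x) ∧
      ∫ x, stokesIntegrand Ω Θ η (fun x => ∑ i ∈ s, f i x * ψ x) x
        ∂(formMeasure (wedgeForm Ω Ω)) = 0 := by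
    intro s
    classical
    induction s using Finset.induction_on with
    | empty =>
      simp only [Finset.sum_empty]
      refine ⟨contMDiff_const, ?_⟩
      have : ∀ x, stokesIntegrand Ω Θ η (fun _ => 0) x = 0 := fun x =>
        stokesIntegrand_eq_zero Ω Θ η (by simp [tsupport, Function.support_fun_zero])
      simp [this]
    | insert i s hi ih =>
      simp only [Finset.sum_insert hi]
      refine ⟨(hfψ i).add ih.1, ?_⟩
      simp only [stokesIntegrand_add Ω Θ η ((hfψ i).mdifferentiable (by simp))
        (ih.1.mdifferentiable (by simp))]
      rw [integral_add
        (Continuous.integrable_of_compactSpace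
          (continuous_stokesIntegrand (hfψ i) hη hΘ hΩ.smooth hne) _)
        (Continuous.integrable_of_compactSpace
          (continuous_stokesIntegrand ih.1 hη hΘ hΩ.smooth hne) _), ih.2, add_zero]
      refine integral_stokesIntegrand_of_subset (x₀ := i) (hfψ i) hη hΘ hd hΩ.smooth hne ?_
      rw [extChartAt_source]
      exact (closure_mono (Function.support_mul_subset_left _ _)).trans (hf i)
  have key : ψ = fun x => ∑ i ∈ hsupp.toFinset, f i x * ψ x := by
    funext x
    have h1 := f.sum_eq_one (mem_univ x)
    rw [finsum_eq_sum_of_support_subset (s := hsupp.toFinset)] at h1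
    · rw [← Finset.sum_mul, h1, one_mul]
    · intro i hi
      simp only [Finite.coe_toFinset, mem_ofPred_eq]
      exact ⟨x, hi⟩
  rw [key]
  exact (hsum _).2

end Stokes

end AlmostKahler

namespace AlmostKahler

/-! ### The potential as a weak solution -/

section Potential

open MeasureTheory

variable {M : Type*} [TopologicalSpace M] [ChartedSpace R4 M]

theorem IsSmoothForm.add {k : ℕ} {α β : Form M k} (hα : IsSmoothForm α) (hβ : IsSmoothForm β) :
    IsSmoothForm (α + β) := fun x₀ => (hα x₀).add (hβ x₀)

theorem d_add {k : ℕ} {α β : Form M k} (hα : IsSmoothForm α) (hβ : IsSmoothForm β) :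
    d (α + β) = d α + d β := by
  funext x
  have hx := mem_extChartAt_target (I := 𝓡 4) x
  have h : extDeriv ((α + β).inChart x) (extChartAt (𝓡 4) x x) =
      extDeriv (α.inChart x) (extChartAt (𝓡 4) x x) +
        extDeriv (β.inChart x) (extChartAt (𝓡 4) x x) :=
    extDeriv_add ((hα.contDiffAt hx).differentiableAt (by simp))
      ((hβ.contDiffAt hx).differentiableAt (by simp))
  have h2 : d (α + β) x = (extDeriv ((α + β).inChart x)
    (extChartAt (𝓡 4) x x)).compContinuousLinearMap (chartDeriv x x) := rfl
  rw [h2, h]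
  rfl

theorem Jd_apply (J : EndField M) (φ : M → ℝ) (x : M) (v : R4) :
    Jd J φ x ![v] = differential φ x (J x v) := rfl

variable {J J₀ : EndField M} {Ω Ω₀ : Form M 2}

/-- Almost-Kähler structures with the same metric have the same volume measure. -/
theorem formMeasure_eq [MeasurableSpace M] (hJ : IsAlmostComplex J) (hJ₀ : IsAlmostComplex J₀)
    (h : ∀ (x : M) (v w : R4), Ω x ![v, J x w] = Ω₀ x ![v, J₀ x w]) :
    formMeasure (wedgeForm Ω Ω) = formMeasure (wedgeForm Ω₀ Ω₀) := by
  refine iSup_congr fun x₀ => ?_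
  have e : ∀ y, |wedgeCoeff Ω Ω x₀ y| = |wedgeCoeff Ω₀ Ω₀ x₀ y| := by
    intro y
    rw [wedgeForm_apply_eq, wedgeForm_apply_eq, abs_mul, abs_mul]
    congr 1
    exact abs_wedge_self_eq (hJ.sq_eq_neg _) (hJ₀.sq_eq_neg _) (h _)
  simp only [chartMeasure_wedgeForm, e]

theorem EnergyBound.of_metric_eq {w q : M → ℝ} (hw : EnergyBound J Ω w q)
    (h : ∀ (x : M) (v w : R4), Ω x ![v, J x w] = Ω₀ x ![v, J₀ x w]) : EnergyBound J₀ Ω₀ w q :=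
  ⟨hw.contMDiff, hw.continuous, hw.nonneg, fun x v => (h x v v) ▸ hw.sq_le x v⟩

/-- The integrated form of an equation `Δw = h` for an operator `Δ` whose energy density `q`
dominates the square of the norm of `dw`. -/
structure WeakSolution [MeasurableSpace M] (J : EndField M) (Ω : Form M 2) (w q h : M → ℝ) :
    Prop where
  energyBound : EnergyBound J Ω w q
  continuous : Continuous h
  integral_eq : ∀ G : ℝ → ℝ, ContDiff ℝ 1 G →
    ∫ x, deriv G (w x) * q x ∂(formMeasure (wedgeForm Ω Ω)) =
      ∫ x, G (w x) * h x ∂(formMeasure (wedgeForm Ω Ω))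

/-- The notion depends on `(J, Ω)` only through the metric and the measure. This moves every
solution to a fixed reference pair and makes the constants uniform. -/
theorem WeakSolution.of_metric_eq [MeasurableSpace M] {w q h : M → ℝ}
    (hw : WeakSolution J Ω w q h) (hJ : IsAlmostComplex J) (hJ₀ : IsAlmostComplex J₀)
    (hm : ∀ (x : M) (v w : R4), Ω x ![v, J x w] = Ω₀ x ![v, J₀ x w]) :
    WeakSolution J₀ Ω₀ w q h :=
  ⟨hw.energyBound.of_metric_eq hm, hw.continuous, formMeasure_eq hJ hJ₀ hm ▸ hw.integral_eq⟩

theorem differential_comp {G : ℝ → ℝ} (hG : ContDiff ℝ 1 G) {φ : M → ℝ} {x : M}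
    (hφ : MDifferentiableAt (𝓡 4) 𝓘(ℝ, ℝ) φ x) :
    differential (fun z => G (φ z)) x = deriv G (φ x) • differential φ x := by
  have h := mfderiv_comp x (g := G) ((hG.differentiable (by simp)).mdifferentiable (φ x)) hφ
  rw [mfderiv_eq_fderiv] at h
  refine Eq.trans h ?_
  ext v
  have h2 : fderiv ℝ G (φ x) (differential φ x v) = deriv G (φ x) * differential φ x v :=
    (fderiv_eq_smul_deriv (f := G) (x := φ x) (differential φ x v)).trans (mul_comm _ _)
  exact h2

theorem wedgeOneForm_comp {G : ℝ → ℝ} (hG : ContDiff ℝ 1 G) {φ : M → ℝ} {x : M}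
    (hφ : MDifferentiableAt (𝓡 4) 𝓘(ℝ, ℝ) φ x) (η : Form M 1) :
    wedgeOneForm (fun z => G (φ z)) η x = deriv G (φ x) • wedgeOneForm φ η x := by
  rw [wedgeOneForm, differential_comp hG hφ]
  exact wedgeOne_smul_left _ _ _

/-- Chain rule. It makes the Sobolev inequality available for powers of truncations with an explicit
energy. -/
theorem EnergyBound.comp {w q : M → ℝ} (hw : EnergyBound J Ω w q) {G : ℝ → ℝ}
    (hG : ContDiff ℝ 1 G) :
    EnergyBound J Ω (fun x => G (w x)) (fun x => deriv G (w x) ^ 2 * q x) where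
  contMDiff := hG.contMDiff.comp hw.contMDiff
  continuous := (((hG.continuous_deriv le_rfl).comp hw.contMDiff.continuous).pow 2).mul
    hw.continuous
  nonneg x := mul_nonneg (sq_nonneg _) (hw.nonneg x)
  sq_le x v := by
    rw [differential_comp hG (hw.contMDiff.mdifferentiable (by simp) x)]
    calc ((deriv G (w x) • differential w x) v) ^ 2
        = deriv G (w x) ^ 2 * differential w x v ^ 2 := by
          rw [smul_apply, smul_eq_mul, mul_pow]
      _ ≤ deriv G (w x) ^ 2 * (q x * Ω x ![v, J x v]) :=
          mul_le_mul_of_nonneg_left (hw.sq_le x v) (sq_nonneg _)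
      _ = _ := by ring

/-- Here `s = ±1`; the choice -1 turns upper bounds into lower bounds. The test function `s G(s(t -
c))` has derivative `G'(s(t - c))` since `s² = 1`. -/
theorem WeakSolution.comp_of_sq_eq_one [MeasurableSpace M] {w q h : M → ℝ}
    (hw : WeakSolution J Ω w q h) {s : ℝ} (hs : s ^ 2 = 1) (c : ℝ) :
    WeakSolution J Ω (fun x => s * (w x - c)) q (fun x => s * h x) := by
  have hL : ContDiff ℝ 1 fun t : ℝ => s * (t - c) := contDiff_const.mul (contDiff_id.sub contDiff_const)
  have hd : ∀ t, HasDerivAt (fun t : ℝ => s * (t - c)) s t := fun t => by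
    simpa using ((hasDerivAt_id t).sub_const c).const_mul s
  refine ⟨?_, continuous_const.mul hw.continuous, fun G hG => ?_⟩
  · have h := hw.energyBound.comp hL
    simpa [(hd _).deriv, hs] using h
  · have h := hw.integral_eq _ (contDiff_const.mul (hG.comp hL) : ContDiff ℝ 1 fun t => s * G (s * (t - c)))
    have e : ∀ t, deriv (fun t => s * G (s * (t - c))) t = deriv G (s * (t - c)) := by
      intro t
      have := (((hG.differentiable (by simp)) (s * (t - c))).hasDerivAt.comp t (hd t)).const_mul s
      refine this.deriv.trans ?_
      linear_combination deriv G (s * (t - c)) * hs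
    simp only [e] at h
    rw [h]
    refine integral_congr_ae (.of_forall fun x => ?_)
    simp only
    ring

variable [IsManifold (𝓡 4) ∞ M]

theorem IsAlmostComplex.isSmoothForm_Jd (hJ : IsAlmostComplex J) {φ : M → ℝ}
    (hφ : ContMDiff (𝓡 4) 𝓘(ℝ, ℝ) ∞ φ) : IsSmoothForm (Jd J φ) := by
  intro x₀
  have h1 : ContDiffOn ℝ ∞ (fun y => (fderiv ℝ (fun z => φ ((extChartAt (𝓡 4) x₀).symm z)) y).comp
      (J.inChart x₀ y)) (extChartAt (𝓡 4) x₀).target :=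
    ((contDiffOn_comp_symm le_rfl hφ x₀).fderiv_of_isOpen (isOpen_extChartAt_target x₀)
      (by simp)).clm_comp (hJ.smooth x₀)
  have h2 := (ContinuousAlternatingMap.ofSubsingletonLIE (𝕜 := ℝ) (E := R4) (F := ℝ)
    (0 : Fin 1)).toContinuousLinearEquiv.contDiff.comp_contDiffOn h1
  refine h2.congr fun y hy => ?_
  ext v
  have h3 := fderiv_comp_symm hy (hφ.mdifferentiable (by simp) _)
  change differential φ _ (J _ (paramDeriv x₀ y (v 0))) =
    fderiv ℝ (fun z => φ ((extChartAt (𝓡 4) x₀).symm z)) y (J.inChart x₀ y (v 0))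
  rw [h3, ← paramDeriv_endField_inChart J hy]
  rfl

variable [MeasurableSpace M] [BorelSpace M] [CompactSpace M] [T2Space M]

/-- The almost-Kähler potential solves an equation in divergence form with respect to the sum of
two almost-Kähler forms. -/
theorem weakSolution_potential [Nonempty M] {Ω' : Form M 2} {φ : M → ℝ} (hJ : IsAlmostComplex J)
    (hΩ : IsAlmostKahlerForm J Ω) (hΩ' : IsAlmostKahlerForm J Ω')
    (hφ : ContMDiff (𝓡 4) 𝓘(ℝ, ℝ) ∞ φ) :
    WeakSolution J Ω φ
      (fun x => 2 * -ratio (wedgeForm (wedgeOneForm φ (Jd J φ)) (Ω + Ω')) (wedgeForm Ω Ω) x)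
      (fun x => 2 * ratio (wedgeForm (d (Jd J φ)) (Ω + Ω')) (wedgeForm Ω Ω) x) := by
  have hne := hΩ.wedge_ne_zero hJ
  have hη := hJ.isSmoothForm_Jd hφ
  have hΘ : IsSmoothForm (Ω + Ω') := hΩ.smooth.add hΩ'.smooth
  have hd : d (Ω + Ω') = 0 := by
    rw [d_add hΩ.smooth hΩ'.smooth, hΩ.closed, hΩ'.closed, add_zero]
  have hφ1 : ContMDiff (𝓡 4) 𝓘(ℝ, ℝ) 1 φ := hφ.of_le (by simp)
  have hle := fun x => (hΩ.linearAlmostKahler x).sq_le (hJ.sq_eq_neg x) (hΩ'.linearAlmostKahler x)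
    (differential φ x) (Jd J φ x) (Jd_apply J φ x)
  have hqc := continuous_ratio_wedgeOneForm hφ1 hη hΘ hΩ.smooth hne
  have hrc := continuous_ratio hη.d hΘ hΩ.smooth hne
  have hfin := isFiniteMeasure_formMeasure hJ hΩ
  refine ⟨⟨hφ1, continuous_const.mul hqc.neg, fun x => mul_nonneg zero_le_two (hle x).1,
    fun x => (hle x).2⟩, continuous_const.mul hrc, fun G hG => ?_⟩
  -- Stokes for `d(G(φ) J dφ) ∧ (Ω + Ω')`: the part with `d(J dφ)` gives the right-hand side and the
  -- part with `dφ ∧ J dφ` gives the energy.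
  have hs := integral_stokesIntegrand (ψ := fun x => G (φ x)) (hG.contMDiff.comp hφ1) hη hΘ hd hJ hΩ
  have e : ∀ x, stokesIntegrand Ω (Ω + Ω') (Jd J φ) (fun x => G (φ x)) x =
      (1 / 2 : ℝ) * (G (φ x) * (2 * ratio (wedgeForm (d (Jd J φ)) (Ω + Ω')) (wedgeForm Ω Ω) x) -
      deriv G (φ x) *
        (2 * -ratio (wedgeForm (wedgeOneForm φ (Jd J φ)) (Ω + Ω')) (wedgeForm Ω Ω) x)) := by
    intro x
    rw [stokesIntegrand, ratio_smul _ _ _ _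
      (wedgeOneForm_comp hG (hφ1.mdifferentiable (by simp) x) (Jd J φ))]
    ring
  simp only [e] at hs
  rw [integral_const_mul, integral_sub] at hs
  · linarith
  · exact Continuous.integrable_of_compactSpace
      ((hG.continuous.comp hφ.continuous).mul (continuous_const.mul hrc)) _
  · exact Continuous.integrable_of_compactSpace
      (((hG.continuous_deriv le_rfl).comp hφ.continuous).mul (continuous_const.mul hqc.neg)) _

end Potential

end AlmostKahler

namespace AlmostKahler

/-! ### Powers of the positive part as C¹ test functions -/

section PositivePart

theorem hasDerivAt_max_pow (k : ℝ) (n : ℕ) (t : ℝ) :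
    HasDerivAt (fun t => max (t - k) 0 ^ (n + 2)) ((n + 2) * max (t - k) 0 ^ (n + 1)) t := by
  have hc : Continuous fun t : ℝ => max (t - k) 0 := by fun_prop
  refine hasDerivAt_of_hasDerivAt_of_ne' (x := k) (f := fun t => max (t - k) 0 ^ (n + 2))
    (g := fun t => (n + 2) * max (t - k) 0 ^ (n + 1)) (fun y hy => ?_)
    (hc.pow _).continuousAt (continuous_const.mul (hc.pow _)).continuousAt t
  rcases lt_or_gt_of_ne hy with h | h
  · have hev : (fun t => max (t - k) 0 ^ (n + 2)) =ᶠ[nhds y] fun _ => 0 := by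
      filter_upwards [gt_mem_nhds h] with z hz
      rw [max_eq_right (by linarith), zero_pow (by simp)]
    rw [max_eq_right (by linarith), zero_pow (by simp), mul_zero]
    exact (hasDerivAt_const y (0 : ℝ)).congr_of_eventuallyEq hev
  · have hev : (fun t => max (t - k) 0 ^ (n + 2)) =ᶠ[nhds y] fun t => (t - k) ^ (n + 2) := by
      filter_upwards [lt_mem_nhds h] with z hz
      rw [max_eq_left (by linarith)]
    rw [max_eq_left (by linarith)]
    refine HasDerivAt.congr_of_eventuallyEq ?_ hev
    have h1 : HasDerivAt (fun t => t - k) 1 y := (hasDerivAt_id y).sub_const k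
    simpa using h1.fun_pow (n + 2)

/-- An exponent of at least 2 makes the derivative continuous across `t = k`; the exponents 2 and 3
are the ones used. -/
theorem contDiff_max_pow (k : ℝ) (n : ℕ) :
    ContDiff ℝ 1 fun t : ℝ => max (t - k) 0 ^ (n + 2) := by
  rw [contDiff_one_iff_deriv]
  refine ⟨fun t => (hasDerivAt_max_pow k n t).differentiableAt, ?_⟩
  rw [show deriv (fun t : ℝ => max (t - k) 0 ^ (n + 2)) =
    fun t => (n + 2) * max (t - k) 0 ^ (n + 1) from funext fun t => (hasDerivAt_max_pow k n t).deriv]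
  fun_prop

end PositivePart

/-! ### Oscillation bound for weak solutions -/

section UniformBound

open MeasureTheory Set

variable {M : Type*} [TopologicalSpace M] [ChartedSpace R4 M] [IsManifold (𝓡 4) ∞ M]
  [MeasurableSpace M] [BorelSpace M] [CompactSpace M] {J : EndField M} {Ω : Form M 2}

/-- The Sobolev inequality, for Bochner integrals. -/
theorem exists_sobolev_integral [Nonempty M] (hJ : IsAlmostComplex J)
    (hΩ : IsAlmostKahlerForm J Ω) : ∃ C : ℝ, 0 ≤ C ∧ ∀ w q, EnergyBound J Ω w q →
      (∫ x, w x ^ 4 ∂(formMeasure (wedgeForm Ω Ω))) ^ (1 / 2 : ℝ) ≤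
        C * (∫ x, q x ∂(formMeasure (wedgeForm Ω Ω)) +
          ∫ x, w x ^ 2 ∂(formMeasure (wedgeForm Ω Ω))) := by
  have hfin := isFiniteMeasure_formMeasure hJ hΩ
  obtain ⟨C, hC⟩ := exists_sobolev hJ hΩ
  refine ⟨C, C.coe_nonneg, fun w q h => ?_⟩
  have h1 := hC w q h
  have hw := h.contMDiff.continuous
  have hi : ∀ n : ℕ, Integrable (fun x => w x ^ n) (formMeasure (wedgeForm Ω Ω)) := fun n =>
    Continuous.integrable_of_compactSpace (hw.pow n) _
  have hiq := Continuous.integrable_of_compactSpace h.continuous (formMeasure (wedgeForm Ω Ω))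
  have e : ∀ n : ℕ, Even n → ∀ x, ‖w x‖ₑ ^ n = ENNReal.ofReal (w x ^ n) := fun n hn x => by
    rw [← enorm_pow, Real.enorm_of_nonneg (hn.pow_nonneg _)]
  have e2 : ∀ x, ENNReal.ofReal (q x) + ‖w x‖ₑ ^ 2 = ENNReal.ofReal (q x + w x ^ 2) := fun x => by
    rw [e 2 even_two, ENNReal.ofReal_add (h.nonneg x) (sq_nonneg _)]
  have h4 : 0 ≤ ∫ x, w x ^ 4 ∂(formMeasure (wedgeForm Ω Ω)) :=
    integral_nonneg fun x => Even.pow_nonneg (by decide) _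
  have h2 : 0 ≤ ∫ x, q x + w x ^ 2 ∂(formMeasure (wedgeForm Ω Ω)) :=
    integral_nonneg fun x => add_nonneg (h.nonneg x) (sq_nonneg _)
  have hi2 : Integrable (fun x => q x + w x ^ 2) (formMeasure (wedgeForm Ω Ω)) := hiq.add (hi 2)
  simp only [e 4 (by decide), e2] at h1
  rw [← ofReal_integral_eq_lintegral_ofReal (hi 4) (.of_forall fun x => Even.pow_nonneg (by decide) _),
    ← ofReal_integral_eq_lintegral_ofReal hi2
      (.of_forall fun x => add_nonneg (h.nonneg x) (sq_nonneg _)),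
    ENNReal.ofReal_rpow_of_nonneg h4 (by norm_num), ← ENNReal.ofReal_coe_nnreal,
    ← ENNReal.ofReal_mul C.coe_nonneg, ENNReal.ofReal_le_ofReal_iff (mul_nonneg C.coe_nonneg h2),
    integral_add hiq (hi 2)] at h1
  exact h1

/-- The Poincaré inequality, for Bochner integrals. -/
theorem exists_poincare_integral [ConnectedSpace M] (hJ : IsAlmostComplex J)
    (hΩ : IsAlmostKahlerForm J Ω) : ∃ C : ℝ, 0 ≤ C ∧ ∀ w q, EnergyBound J Ω w q → ∃ c : ℝ,
      ∫ x, (w x - c) ^ 2 ∂(formMeasure (wedgeForm Ω Ω)) ≤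
        C * ∫ x, q x ∂(formMeasure (wedgeForm Ω Ω)) := by
  have hfin := isFiniteMeasure_formMeasure hJ hΩ
  obtain ⟨C, hC⟩ := exists_poincare hJ hΩ
  refine ⟨C, C.coe_nonneg, fun w q h => ?_⟩
  obtain ⟨c, h1⟩ := hC w q h
  refine ⟨c, ?_⟩
  have hi : Integrable (fun x => (w x - c) ^ 2) (formMeasure (wedgeForm Ω Ω)) :=
    Continuous.integrable_of_compactSpace
      ((h.contMDiff.continuous.sub continuous_const).pow 2) _
  have hiq := Continuous.integrable_of_compactSpace h.continuous (formMeasure (wedgeForm Ω Ω))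
  have e : ∀ x, ‖w x - c‖ₑ ^ 2 = ENNReal.ofReal ((w x - c) ^ 2) := fun x => by
    rw [← enorm_pow, Real.enorm_of_nonneg (sq_nonneg _)]
  simp only [e] at h1
  rw [← ofReal_integral_eq_lintegral_ofReal hi (.of_forall fun x => sq_nonneg _),
    ← ofReal_integral_eq_lintegral_ofReal hiq (.of_forall h.nonneg), ← ENNReal.ofReal_coe_nnreal,
    ← ENNReal.ofReal_mul C.coe_nonneg,
    ENNReal.ofReal_le_ofReal_iff (mul_nonneg C.coe_nonneg (integral_nonneg h.nonneg))] at h1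
  exact h1

/-- The `L²` bound for the solutions of a weak equation. -/
theorem exists_sub_const_sq_le [ConnectedSpace M] (hJ : IsAlmostComplex J)
    (hΩ : IsAlmostKahlerForm J Ω) : ∃ C : ℝ, 0 ≤ C ∧ ∀ w q h, WeakSolution J Ω w q h → ∃ c : ℝ,
      ∫ x, (w x - c) ^ 2 ∂(formMeasure (wedgeForm Ω Ω)) ≤
        C * ∫ x, |h x| ^ (2 : ℝ) ∂(formMeasure (wedgeForm Ω Ω)) := by
  have hfin := isFiniteMeasure_formMeasure hJ hΩ
  obtain ⟨C, hC0, hC⟩ := exists_poincare_integral hJ hΩ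
  refine ⟨C ^ 2, sq_nonneg C, fun w q h hw => ?_⟩
  obtain ⟨c, hc⟩ := hC w q hw.energyBound
  refine ⟨c, ?_⟩
  have hwc : Continuous fun x => w x - c := hw.energyBound.contMDiff.continuous.sub continuous_const
  -- Testing with `t - c` expresses the whole energy as the integral of `(w - c) h`.
  have h1 := hw.integral_eq (fun t => t - c) (contDiff_id.sub contDiff_const)
  have hd : ∀ t, deriv (fun t : ℝ => t - c) t = 1 := fun t => ((hasDerivAt_id t).sub_const c).deriv
  simp only [hd, one_mul] at h1
  rw [h1] at hc
  -- Young's inequality, weighted so that half of the L² norm is absorbed on the left.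
  have h2 : ∫ x, C * ((w x - c) * h x) ∂(formMeasure (wedgeForm Ω Ω)) ≤
      ∫ x, (1 / 2 * (w x - c) ^ 2 + C ^ 2 / 2 * |h x| ^ (2 : ℝ)) ∂(formMeasure (wedgeForm Ω Ω)) := by
    refine integral_mono (Continuous.integrable_of_compactSpace
      (continuous_const.mul (hwc.mul hw.continuous)) _) (Continuous.integrable_of_compactSpace
      ((continuous_const.mul (hwc.pow 2)).add (continuous_const.mul
        (hw.continuous.abs.rpow_const fun _ => Or.inr zero_le_two))) _) fun x => ?_
    simp only [Real.rpow_two, sq_abs]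
    nlinarith [sq_nonneg (w x - c - C * h x)]
  rw [integral_const_mul, integral_add, integral_const_mul, integral_const_mul] at h2
  · linarith
  · exact Continuous.integrable_of_compactSpace (continuous_const.mul (hwc.pow 2)) _
  · exact Continuous.integrable_of_compactSpace (continuous_const.mul
      (hw.continuous.abs.rpow_const fun _ => Or.inr zero_le_two)) _

/-- The inequality satisfied by the truncations of the solutions of a weak equation. -/
theorem exists_truncation_le [Nonempty M] (hJ : IsAlmostComplex J) (hΩ : IsAlmostKahlerForm J Ω) :
    ∃ C : ℝ, 0 ≤ C ∧ ∀ u q h, WeakSolution J Ω u q h → ∀ k : ℝ,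
      (∫ x, max (u x - k) 0 ^ 8 ∂(formMeasure (wedgeForm Ω Ω))) ^ (1 / 2 : ℝ) ≤
        C * (∫ x, max (u x - k) 0 ^ 3 * |h x| ∂(formMeasure (wedgeForm Ω Ω)) +
          ∫ x, max (u x - k) 0 ^ 4 ∂(formMeasure (wedgeForm Ω Ω))) := by
  have hfin := isFiniteMeasure_formMeasure hJ hΩ
  obtain ⟨C, hC0, hC⟩ := exists_sobolev_integral hJ hΩ
  refine ⟨2 * C, by positivity, fun u q h hu k => ?_⟩
  have huc := hu.energyBound.contMDiff.continuous
  have hvc : Continuous fun x => max (u x - k) 0 := (huc.sub continuous_const).max continuous_const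
  have hv0 : ∀ x, 0 ≤ max (u x - k) 0 := fun x => le_max_right _ _
  -- Write `v = (u - k)⁺`. Sobolev is applied to `v²`, whose energy is `4 v² q`; testing the
  -- equation with `v³` produces `3 v² q`, whence the factor 4/3 below.
  have h1 := hC _ _ (hu.energyBound.comp (contDiff_max_pow k 0))
  have h2 := hu.integral_eq _ (contDiff_max_pow k 1)
  simp only [(hasDerivAt_max_pow k _ _).deriv] at h1 h2
  have e1 : ∀ x, (((0 : ℕ) + 2 : ℝ) * max (u x - k) 0 ^ (0 + 1)) ^ 2 * q x =
      4 / 3 * (((1 : ℕ) + 2 : ℝ) * max (u x - k) 0 ^ (1 + 1) * q x) := fun x => by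
    push_cast; ring
  have e2 : ∀ x, (max (u x - k) 0 ^ (0 + 2)) ^ 4 = max (u x - k) 0 ^ 8 := fun x => by ring
  have e3 : ∀ x, (max (u x - k) 0 ^ (0 + 2)) ^ 2 = max (u x - k) 0 ^ 4 := fun x => by ring
  simp only [e1, e2, e3] at h1
  rw [integral_const_mul, h2] at h1
  have h3 : ∫ x, max (u x - k) 0 ^ (1 + 2) * h x ∂(formMeasure (wedgeForm Ω Ω)) ≤
      ∫ x, max (u x - k) 0 ^ 3 * |h x| ∂(formMeasure (wedgeForm Ω Ω)) :=
    integral_mono (Continuous.integrable_of_compactSpace ((hvc.pow 3).mul hu.continuous) _)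
      (Continuous.integrable_of_compactSpace ((hvc.pow 3).mul hu.continuous.abs) _) fun x =>
      mul_le_mul_of_nonneg_left (le_abs_self _) (pow_nonneg (hv0 x) 3)
  have h4 : 0 ≤ ∫ x, max (u x - k) 0 ^ 3 * |h x| ∂(formMeasure (wedgeForm Ω Ω)) :=
    integral_nonneg fun x => mul_nonneg (pow_nonneg (hv0 x) 3) (abs_nonneg _)
  have h5 : 0 ≤ ∫ x, max (u x - k) 0 ^ 4 ∂(formMeasure (wedgeForm Ω Ω)) :=
    integral_nonneg fun x => pow_nonneg (hv0 x) 4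
  calc _ ≤ _ := h1
    _ ≤ C * (2 * (∫ x, max (u x - k) 0 ^ 3 * |h x| ∂(formMeasure (wedgeForm Ω Ω)) +
          ∫ x, max (u x - k) 0 ^ 4 ∂(formMeasure (wedgeForm Ω Ω)))) :=
        mul_le_mul_of_nonneg_left (by linarith) hC0
    _ = _ := by ring

/-- The oscillation of the solutions of a weak equation is bounded in terms of the `Lᵖ` norm of the
right hand side. -/
theorem exists_oscillation_le [ConnectedSpace M] (hJ : IsAlmostComplex J)
    (hΩ : IsAlmostKahlerForm J Ω) {p : ℝ} (hp : 2 < p) (H : ℝ) :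
    ∃ D : ℝ, ∀ w q h, WeakSolution J Ω w q h →
      (∫ x, |h x| ^ p ∂(formMeasure (wedgeForm Ω Ω))) ^ (1 / p) ≤ H → ∀ x y, w x - w y ≤ D := by
  have hfin := isFiniteMeasure_formMeasure hJ hΩ
  have hpos := isOpenPosMeasure_formMeasure hJ hΩ
  obtain ⟨A, hA0, hA⟩ := exists_sub_const_sq_le hJ hΩ
  obtain ⟨C, hC0, hC⟩ := exists_truncation_le hJ hΩ
  set μ := formMeasure (wedgeForm Ω Ω)
  -- The L² bound on `w - c`: the L² norm of `h` is estimated by its Lᵖ norm on a space of finite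
  -- measure.
  set H₂ : ℝ := A * (max H 0 ^ 2 * μ.real univ ^ (1 - 2 / p)) with hH₂
  have hH₂0 : 0 ≤ H₂ := by positivity
  obtain ⟨D, hD⟩ := exists_upper_bound μ hp C (max H 0 + H₂) hC0 (by positivity)
  refine ⟨2 * D, fun w q h hw hH => ?_⟩
  have hH' : (∫ x, |h x| ^ p ∂μ) ^ (1 / p) ≤ max H 0 := hH.trans (le_max_left _ _)
  obtain ⟨c, hc⟩ := hA w q h hw
  have hL2 : ∫ x, (w x - c) ^ 2 ∂μ ≤ H₂ := by
    refine hc.trans (mul_le_mul_of_nonneg_left ?_ hA0)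
    refine (integral_rpow_le_rpow zero_lt_two hp hw.continuous.abs (fun x => abs_nonneg _) μ).trans ?_
    have hn : 0 ≤ ∫ x, |h x| ^ p ∂μ := integral_nonneg fun x => Real.rpow_nonneg (abs_nonneg _) _
    refine mul_le_mul_of_nonneg_right ?_ (by positivity)
    rw [show 2 / p = 1 / p * (2 : ℕ) by push_cast; ring, Real.rpow_mul hn, Real.rpow_natCast]
    exact pow_le_pow_left₀ (Real.rpow_nonneg hn _) hH' 2
  have key : ∀ s : ℝ, s ^ 2 = 1 → ∀ x, s * (w x - c) ≤ D := by
    intro s hs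
    have hu := hw.comp_of_sq_eq_one hs c
    have habs : ∀ x, |s * h x| = |h x| := fun x => by
      rw [abs_mul, ← Real.sqrt_sq_eq_abs s, hs, Real.sqrt_one, one_mul]
    refine hD _ _ hu.energyBound.contMDiff.continuous hu.continuous ?_ ?_ (hC _ _ _ hu)
    · simp only [habs]
      linarith
    · simp only [mul_pow, hs, one_mul]
      linarith [le_max_right H 0]
  intro x y
  linarith [key 1 (by norm_num) x, key (-1) (by norm_num) y]

end UniformBound

end AlmostKahler

namespace AlmostKahler

/-! ### The equation for the potential and the conclusion -/

section CalabiYau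

open MeasureTheory

variable {M : Type*} [TopologicalSpace M] [ChartedSpace R4 M]

/-- The right hand side of the equation for the almost-Kähler potential of a solution of the
Calabi–Yau equation. -/
theorem ratio_potential {J : EndField M} {Ω Ω' : Form M 2} (hJ : IsAlmostComplex J)
    (hΩ : IsAlmostKahlerForm J Ω) {D A : Form M 2} {c : ℝ} {x : M}
    (hCY : wedgeForm Ω' Ω' x = c • wedgeForm Ω Ω x)
    (hφ : wedgeForm Ω' Ω' x - wedgeForm Ω Ω' x = -(1 / 2 : ℝ) • wedgeForm Ω' D x)
    (hA : Ω' x = Ω x - (1 / 2 : ℝ) • D x + A x) :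
    2 * ratio (wedgeForm D (Ω + Ω')) (wedgeForm Ω Ω) x =
      -4 * (c - 1) + 4 * ratio (wedgeForm A Ω) (wedgeForm Ω Ω) x := by
  have hne := hΩ.wedge_ne_zero hJ x
  -- `D ∧ Ω` is read off from the decomposition of `Ω'` wedged with `Ω`, and `D ∧ Ω'` from the
  -- definition of the potential; in the sum the mixed term `Ω ∧ Ω'` cancels.
  have e1 : wedge (Ω' x) (Ω' x) stdFrame = c * wedge (Ω x) (Ω x) stdFrame :=
    congrArg (fun t => t stdFrame) hCY
  have e2 : wedge (Ω' x) (Ω' x) stdFrame - wedge (Ω x) (Ω' x) stdFrame =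
      -(1 / 2 : ℝ) * wedge (Ω' x) (D x) stdFrame := congrArg (fun t => t stdFrame) hφ
  have e3 : wedge (Ω' x) (Ω x) stdFrame = wedge (Ω x) (Ω x) stdFrame -
      (1 / 2 : ℝ) * wedge (D x) (Ω x) stdFrame + wedge (A x) (Ω x) stdFrame := by
    have h : wedge (Ω' x) (Ω x) = wedge (Ω x) (Ω x) - (1 / 2 : ℝ) • wedge (D x) (Ω x) +
        wedge (A x) (Ω x) := by
      rw [hA, wedge_add_left, wedge_sub_left, wedge_smul_left]
    exact congrArg (fun t => t stdFrame) h
  have e4 : wedge (D x) ((Ω + Ω') x) stdFrame =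
      wedge (D x) (Ω x) stdFrame + wedge (D x) (Ω' x) stdFrame :=
    congrArg (fun t => t stdFrame) (wedge_add_right (D x) (Ω x) (Ω' x))
  rw [AlmostKahler.wedge_comm (Ω x) (Ω' x), AlmostKahler.wedge_comm (Ω' x) (D x)] at e2
  simp only [ratio, wedgeForm] at hne ⊢
  field_simp
  linear_combination 2 * e4 - 4 * e1 + 4 * e2 + 4 * e3

theorem abs_exp_sub_one_le {t K : ℝ} (h : |t| ≤ K) : |Real.exp t - 1| ≤ Real.exp K + 1 := by
  have h1 := Real.exp_le_exp.2 ((le_abs_self t).trans h)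
  have h2 := Real.exp_pos t
  rw [abs_le]
  constructor <;> linarith

/-- An `Lᵖ` bound for a sum of a bounded function and a function bounded in `Lᵖ`. -/
theorem integral_rpow_le_of_eLpNorm_le {X : Type*} [TopologicalSpace X] [CompactSpace X]
    [MeasurableSpace X] [BorelSpace X] (μ : Measure X) [IsFiniteMeasure μ] {p : ℝ} (hp : 1 ≤ p)
    {b f h : X → ℝ} {E : ℝ} {B : ENNReal} (hb : Continuous b) (hf : Continuous f)
    (hB : B ≠ ⊤) (hbE : ∀ x, |b x| ≤ E) (hfB : eLpNorm f (ENNReal.ofReal p) μ ≤ B)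
    (hh : ∀ x, h x = b x + f x) :
    (∫ x, |h x| ^ p ∂μ) ^ (1 / p) ≤
      (μ Set.univ ^ p⁻¹ * ENNReal.ofReal E + B).toReal := by
  have hp0 : 0 < p := zero_lt_one.trans_le hp
  have hpr : (ENNReal.ofReal p).toReal = p := ENNReal.toReal_ofReal hp0.le
  obtain rfl : h = b + f := funext hh
  have h1 : eLpNorm (b + f) (ENNReal.ofReal p) μ ≤ μ Set.univ ^ p⁻¹ * ENNReal.ofReal E + B := by
    refine (eLpNorm_add_le hb.measurable.aestronglyMeasurable hf.measurable.aestronglyMeasurable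
      (by simpa using hp)).trans (add_le_add ?_ hfB)
    have := eLpNorm_le_of_ae_bound (μ := μ) (p := ENNReal.ofReal p) (f := b) (C := E)
      (.of_forall hbE)
    rwa [hpr] at this
  have hm := (Continuous.memLp_of_compactSpace (hb.add hf) (ENNReal.ofReal p) μ)
  rw [hm.eLpNorm_eq_integral_rpow_norm (by simpa using hp0) ENNReal.ofReal_ne_top, hpr] at h1
  have h2 : μ Set.univ ^ p⁻¹ * ENNReal.ofReal E + B ≠ ⊤ :=
    ENNReal.add_ne_top.2 ⟨ENNReal.mul_ne_top (ENNReal.rpow_ne_top_of_nonneg (by positivity)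
      (measure_ne_top _ _)) ENNReal.ofReal_ne_top, hB⟩
  rw [one_div]
  exact (ENNReal.ofReal_le_iff_le_toReal h2).1 h1

end CalabiYau

end AlmostKahler

theorem lemma6p1 {M : Type*} [TopologicalSpace M] [ChartedSpace R4 M] [IsManifold (𝓡 4) ∞ M]
    [T2Space M] [CompactSpace M] [ConnectedSpace M] [MeasurableSpace M] [BorelSpace M]
    (g : Bundle.ContMDiffRiemannianMetric (𝓡 4) ∞ R4 (fun x : M => TangentSpace (𝓡 4) x))
    (p : ℝ) (hp : 2 < p) (B K : ℝ) :
    ∃ C' : ℝ, ∀ (J : EndField M) (Ω Ω' : Form M 2) (F φ₁ : M → ℝ) (a₁ : Form M 1),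
      -- `(M, Ω, J)` is almost-Kähler with associated metric `g`
      IsAlmostComplex J → IsAlmostKahlerForm J Ω →
      (∀ (x : M) (v w : TangentSpace (𝓡 4) x), g.inner x v w = Ω x ![v, J x w]) →
      -- `Ω'` is an almost-Kähler form solving the Calabi-Yau equation `Ω'² = e^F Ω²`
      IsAlmostKahlerForm J Ω' →
      ContMDiff (𝓡 4) 𝓘(ℝ, ℝ) ∞ F → (∀ x, |F x| ≤ K) →
      (∀ x, wedgeForm Ω' Ω' x = Real.exp (F x) • wedgeForm Ω Ω x) →
      -- `φ₁` is the almost-Kähler potential: `Ω'² - Ω ∧ Ω' = -½ Ω' ∧ d(J dφ₁)`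
      ContMDiff (𝓡 4) 𝓘(ℝ, ℝ) ∞ φ₁ →
      (∀ x, wedgeForm Ω' Ω' x - wedgeForm Ω Ω' x
        = -(1 / 2 : ℝ) • wedgeForm Ω' (d (Jd J φ₁)) x) →
      -- `Ω' = Ω - ½ d(J dφ₁) + da₁`
      IsSmoothForm a₁ →
      (∀ x, Ω' x = Ω x - (1 / 2 : ℝ) • d (Jd J φ₁) x + d a₁ x) →
      -- the `L^p` norm of `(da₁ ∧ Ω) / Ω²` with respect to `Ω²` is at most `B`
      MeasureTheory.eLpNorm (ratio (wedgeForm (d a₁) Ω) (wedgeForm Ω Ω)) (ENNReal.ofReal p)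
        (formMeasure (wedgeForm Ω Ω)) ≤ ENNReal.ofReal B →
      (⨆ x, φ₁ x) - (⨅ x, φ₁ x) ≤ C' := by
  -- All constants are taken from one reference structure compatible with `g`; if there is none, the
  -- claim is vacuous.
  by_cases hex : ∃ (J₀ : EndField M) (Ω₀ : Form M 2), IsAlmostComplex J₀ ∧
      IsAlmostKahlerForm J₀ Ω₀ ∧
      ∀ (x : M) (v w : TangentSpace (𝓡 4) x), g.inner x v w = Ω₀ x ![v, J₀ x w]
  swap
  · exact ⟨0, fun J Ω Ω' F φ₁ a₁ hJ hΩ hg => (hex ⟨J, Ω, hJ, hΩ, hg⟩).elim⟩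
  obtain ⟨J₀, Ω₀, hJ₀, hΩ₀, hg₀⟩ := hex
  -- Minkowski bound for the right-hand side: `4 (e^K + 1)` dominates `4 |e^F - 1|`, and the second
  -- term is 4 times the Lᵖ bound on `(da₁ ∧ Ω)/Ω²`.
  obtain ⟨D, hD⟩ := exists_oscillation_le hJ₀ hΩ₀ hp
    (formMeasure (wedgeForm Ω₀ Ω₀) Set.univ ^ p⁻¹ * ENNReal.ofReal (4 * (Real.exp K + 1)) +
      ENNReal.ofReal 4 * ENNReal.ofReal B).toReal
  refine ⟨D, fun J Ω Ω' F φ₁ a₁ hJ hΩ hg hΩ' hF hFK hCY hφ hφeq ha haeq hB => ?_⟩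
  have hm : ∀ (x : M) (v w : R4), Ω x ![v, J x w] = Ω₀ x ![v, J₀ x w] := fun x v w =>
    (hg x v w).symm.trans (hg₀ x v w)
  have hw := (weakSolution_potential hJ hΩ hΩ' hφ).of_metric_eq hJ hJ₀ hm
  have hfin := isFiniteMeasure_formMeasure hJ₀ hΩ₀
  rw [formMeasure_eq hJ hJ₀ hm] at hB
  have hfc := continuous_ratio ha.d hΩ.smooth hΩ.smooth (hΩ.wedge_ne_zero hJ)
  have hosc := hD _ _ _ hw (integral_rpow_le_of_eLpNorm_le (formMeasure (wedgeForm Ω₀ Ω₀))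
    (by linarith) (b := fun x => -4 * (Real.exp (F x) - 1))
    (f := fun x => 4 * ratio (wedgeForm (d a₁) Ω) (wedgeForm Ω Ω) x)
    (continuous_const.mul ((Real.continuous_exp.comp hF.continuous).sub continuous_const))
    (continuous_const.mul hfc) (ENNReal.mul_ne_top ENNReal.ofReal_ne_top ENNReal.ofReal_ne_top)
    (fun x => by
      rw [abs_mul, abs_neg, abs_of_nonneg (by norm_num : (0 : ℝ) ≤ 4)]
      exact mul_le_mul_of_nonneg_left (abs_exp_sub_one_le (hFK x)) (by norm_num))
    (by
      refine (MeasureTheory.eLpNorm_const_smul (4 : ℝ) _ _ _).le.trans (mul_le_mul' ?_ hB)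
      rw [Real.enorm_of_nonneg (by norm_num)])
    (fun x => ratio_potential hJ hΩ (hCY x) (hφeq x) (haeq x)))
  obtain ⟨y⟩ : Nonempty M := inferInstance
  have hsup : ∀ y, (⨆ x, φ₁ x) ≤ D + φ₁ y := fun y => ciSup_le fun x => by linarith [hosc x y]
  have hinf : (⨆ x, φ₁ x) - D ≤ ⨅ x, φ₁ x := le_ciInf fun y => by linarith [hsup y]
  linarith
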